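/- **Setting.** Let $\mathcal N$ be a smooth finite-dimensional (Hausdorff, boundaryless) manifold and $X_a,X_b,X_c$ smooth vector fields on $\mathcal N$ with $$[X_a,X_b]=2X_a,\qquad [X_a,X_c]=-X_b,\qquad [X_b,X_c]=2X_c .$$ Let $T>0$, $M>0$, let $u_a,u_b,u_c:[0,T]\to\mathbb R$ be measurable with $|u_d|\le M$ for $d=a,b,c$, and let $x_0\in\mathcal N$. Consider the (Carathéodory) initial value problem $$\dot x(t)=u_c(t)X_c+u_b(t)X_b+u_a(t)X_a,\qquad x(0)=x_0. \tag{1}$$ A continuous curve $x:[0,\tau)\to\mathcal N$ with $x(0)=x_0$ is a solution of (1) if for every smooth $f:\mathcal N\to\mathbb R$ and $t\in[0,\tau)$ the function $s\mapsto\sum_d u_d(s)\,(X_df)(x(s))$ is integrable on $[0,t]$ and $f(x(t))=f(x_0)+\int_0^t\sum_{d}u_d(s)\,(X_df)(x(s))\,ds$. On the space $\mathbb R\langle\langle a,b,c\rangle\rangle$ of noncommutative formal power series let $\cdot$ be the concatenation product and $⧢$ the shuffle product, given on words by $\emptyset⧢ w=w⧢\emptyset=w$ and $(vd)⧢(we)=(v⧢(we))\cdot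 d+((vd)⧢ w)\cdot e$ for words $v,w$ and letters $d,e$; put $\exp_{⧢}(S)=\sum_{n\ge0}S^{⧢ n}/n!$. For words let $\Upsilon^t(\emptyset)=1$ and $\Upsilon^t(vd)=\int_0^t\Upsilon^s(v)\,u_d(s)\,ds$, and for a series $S$ with homogeneous parts $S_k$ let $\Upsilon^t(S)=\sum_{k\ge0}\Upsilon^t(S_k)$ whenever this converges. **Proposition.** The equation $A=b-a\cdot\exp_{⧢}(2A)\cdot c$ has a unique solution $A\in\mathbb R\langle\langle a,b,c\rangle\rangle$. Put $$S^{a}=a\cdot\exp_{⧢}(2A),\qquad S^{b}=A,\qquad S^{c}=\exp_{⧢}(2A)\cdot c .$$ 1. For $d=a,b,c$ and every $0\le t<\min\{T,1/M\}$ the series $\Xi_d(t):=\Upsilon^t(S^{d})=\sum_k\Upsilon^t(S^{d}_k)$ converges absolutely. 2. Consider $$x(t)=\exp(\Xi_c(t)X_c)\exp(\Xi_b(t)X_b)\exp(\Xi_a(t)X_a)(x_0), \tag{2}$$ where the exponentials are multiplied as operators on functions, so that $x_0$ is moved by the flow of $X_c$ for time $\Xi_c(t)$, then by the flow of $X_b$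 for time $\Xi_b(t)$, then by the flow of $X_a$ for time $\Xi_a(t)$. The flows in (2) are defined for all sufficiently small $t\ge0$, and for every $0<\tau\le\min\{T,1/M\}$ such that they are defined for all $t\in[0,\tau)$, the curve (2) is a solution of (1) on $[0,\tau)$. 3. In particular, if $X_a,X_b,X_c$ are complete, then the solution (2) of (1) exists for all $0\le t<\min\{T,1/M\}$. -/

import Mathlib

open Set MeasureTheory
open scoped Manifold ContDiff Interval

noncomputable section

namespace LieScheffers

/-- The alphabet `{a, b, c}`. -/
inductive Letter
  | a
  | b
  | c
  deriving DecidableEq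

instance : Fintype Letter where
  elems := {.a, .b, .c}
  complete := by rintro (_ | _ | _) <;> simp

/-- A word over `{a, b, c}`. The word `b₁ b₂ ⋯ bₖ` is stored with its LAST letter at the head,
i.e. as the list `[bₖ, …, b₂, b₁]`; thus `e :: v` is the word `v · e`, and the recursions
below, which all peel off the last letter, are recursions on lists. -/
abbrev Word := List Letter

/-- Noncommutative formal power series in `a, b, c` with real coefficients;
`S w` is the coefficient of the word `w` in `S`. -/
abbrev Series := Word → ℝ

/-- The finite set of words of length `k`. -/
def wordsOfLength (k : ℕ) : Finset Word :=
  Finset.univ.map ⟨fun f : Fin k → Letter => List.ofFn f, List.ofFn_injective⟩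

theorem mem_wordsOfLength {k : ℕ} {w : Word} : w ∈ wordsOfLength k ↔ w.length = k := by
  simp only [wordsOfLength, Finset.mem_map, Finset.mem_univ, true_and,
    Function.Embedding.coeFn_mk]
  constructor
  · rintro ⟨f, rfl⟩
    simp
  · rintro rfl
    exact ⟨w.get, List.ofFn_get w⟩

/-- The series consisting of the single word `w`. -/
def word (w : Word) : Series := Pi.single w 1

/-- The series consisting of the single letter `e`. -/
def letter (e : Letter) : Series := word [e]

/-- The concatenation product: the coefficient of `w` in `S · R` is the sum of
`S p * R q` over all factorizations `w = p q`. (Words are stored last letter first, so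
`w.take i` is the suffix of length `i`, and `w.drop i` is the complementary prefix.) -/
def concat (S R : Series) : Series := fun w =>
  ∑ i ∈ Finset.range (w.length + 1), S (w.drop i) * R (w.take i)

/-- The shuffle product of two words, as a multiset of words: `∅ ⧢ w = w ⧢ ∅ = w` and
`(v e) ⧢ (w f) = (v ⧢ (w f)) · e + ((v e) ⧢ w) · f`. -/
def shuffleWords : Word → Word → Multiset Word
  | [], w => {w}
  | e :: v, [] => {e :: v}
  | e :: v, f :: w =>
      (shuffleWords v (f :: w)).map (List.cons e) + (shuffleWords (e :: v) w).map (List.cons f)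
  termination_by v w => v.length + w.length

/-- The shuffle product of two series, the bilinear extension of the shuffle product of words.
A shuffle of `v` and `v'` has length `|v| + |v'|`, so only finitely many pairs contribute to
the coefficient of a given word. -/
def shuffle (S R : Series) : Series := fun w =>
  ∑ i ∈ Finset.range (w.length + 1), ∑ v ∈ wordsOfLength i, ∑ v' ∈ wordsOfLength (w.length - i),
    S v * R v' * ((shuffleWords v v').count w : ℝ)

/-- Shuffle powers: `S^{⧢ 0} = ∅` and `S^{⧢ (n+1)} = S ⧢ S^{⧢ n}`. -/
def shufflePow (S : Series) : ℕ → Series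
  | 0 => word []
  | n + 1 => shuffle S (shufflePow S n)

/-- The shuffle exponential `exp_⧢ S = ∑ₙ S^{⧢ n} / n!`, coefficient by coefficient. -/
def shuffleExp (S : Series) : Series := fun w =>
  ∑' n : ℕ, shufflePow S n w / (n.factorial : ℝ)

/-- The algebraic equation `A = b - a · exp_⧢(2 A) · c`. -/
def IsA1Series (A : Series) : Prop :=
  A = letter .b - concat (concat (letter .a) (shuffleExp ((2 : ℝ) • A))) (letter .c)

/-- The three series `S_a = a · exp_⧢(2 A)`, `S_b = A`, `S_c = exp_⧢(2 A) · c`. -/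
def coordSeries (A : Series) : Letter → Series
  | .a => concat (letter .a) (shuffleExp ((2 : ℝ) • A))
  | .b => A
  | .c => concat (shuffleExp ((2 : ℝ) • A)) (letter .c)

/-- Chen's iterated integral of a word: `Υᵗ(∅) = 1` and `Υᵗ(v e) = ∫₀ᵗ Υˢ(v) u_e(s) ds`. -/
def iteratedInt (u : Letter → ℝ → ℝ) : Word → ℝ → ℝ
  | [], _ => 1
  | e :: v, t => ∫ s in (0 : ℝ)..t, iteratedInt u v s * u e s

/-- `Υᵗ(S_k)`, where `S_k` is the homogeneous part of degree `k` of the series `S`. -/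
def homogeneousInt (u : Letter → ℝ → ℝ) (S : Series) (k : ℕ) (t : ℝ) : ℝ :=
  ∑ w ∈ wordsOfLength k, S w * iteratedInt u w t

/-- `Υᵗ(S) = ∑ₖ Υᵗ(S_k)`. -/
def seriesInt (u : Letter → ℝ → ℝ) (S : Series) (t : ℝ) : ℝ :=
  ∑' k : ℕ, homogeneousInt u S k t

section Manifold

variable {E : Type*} [NormedAddCommGroup E] [NormedSpace ℝ E]
  {N : Type*} [TopologicalSpace N] [ChartedSpace E N]

/-- `FlowsTo V s p q`: the flow `exp(s V)` is defined at `p` and `exp(s V)(p) = q`, i.e. there is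
an integral curve of `V`, defined on the segment between `0` and `s`, from `p` at time `0`
to `q` at time `s` (the time `s` may be negative). -/
def FlowsTo (V : (p : N) → TangentSpace 𝓘(ℝ, E) p) (s : ℝ) (p q : N) : Prop :=
  ∃ γ : ℝ → N, γ 0 = p ∧ γ s = q ∧ IsMIntegralCurveOn γ V [[0, s]]

/-- A vector field is complete if each of its integral curves extends to all times. -/
def IsCompleteField (V : (p : N) → TangentSpace 𝓘(ℝ, E) p) : Prop :=
  ∀ p : N, ∃ γ : ℝ → N, γ 0 = p ∧ IsMIntegralCurve γ V

/-- `y = exp(ξ_c X_c) exp(ξ_b X_b) exp(ξ_a X_a) (x₀)` and all flows involved are defined.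
Exponentials of vector fields multiply as operators acting on functions (as compositions of
vector fields do), i.e. `f y = (exp(ξ_c X_c) exp(ξ_b X_b) exp(ξ_a X_a) f)(x₀)`: the point `x₀` is
moved first along `X_c`, then along `X_b`, then along `X_a`. -/
def IsProductOfFlows (X : Letter → (p : N) → TangentSpace 𝓘(ℝ, E) p) (ξ : Letter → ℝ)
    (x₀ y : N) : Prop :=
  ∃ p q : N, FlowsTo (X .c) (ξ .c) x₀ p ∧ FlowsTo (X .b) (ξ .b) p q ∧ FlowsTo (X .a) (ξ .a) q y

/-- `x` is a (Carathéodory) solution on `[0, τ)` of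
`ẋ(t) = u_c(t) X_c + u_b(t) X_b + u_a(t) X_a`, `x(0) = x₀`: it is continuous, starts at `x₀`, and
satisfies the integral equation
`f(x(t)) = f(x₀) + ∫₀ᵗ (u_c X_c f + u_b X_b f + u_a X_a f)(x(s)) ds` for every smooth
function `f`, in particular for the local coordinates (cut off to smooth functions). -/
def IsSolutionOn (X : Letter → (p : N) → TangentSpace 𝓘(ℝ, E) p) (u : Letter → ℝ → ℝ)
    (x₀ : N) (τ : ℝ) (x : ℝ → N) : Prop :=
  ContinuousOn x (Ico 0 τ) ∧ x 0 = x₀ ∧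
    ∀ f : N → ℝ, ContMDiff 𝓘(ℝ, E) 𝓘(ℝ, ℝ) ∞ f → ∀ t ∈ Ico 0 τ,
      IntervalIntegrable (fun s => ∑ d, u d s * mvfderiv 𝓘(ℝ, E) f (x s) (X d (x s))) volume 0 t ∧
      f (x t) = f x₀ +
        ∫ s in (0 : ℝ)..t, ∑ d, u d s * mvfderiv 𝓘(ℝ, E) f (x s) (X d (x s))

end Manifold

end LieScheffers

end

/-! Write D_e for `lastDeriv e` and E for the shuffle exponential of 2A. Iterated integrals satisfy
(Υ(S))' = Σ_e Υ(D_e S) u_e in integrated form (`seriesInt_eq_integral`) and turn shuffles into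
products (`Tame.seriesInt_shuffle`), while D_e is a derivation of the shuffle product. The equation
for A gives D_a S^a = 1, D_b S^a = 2S^a, D_c S^a = -S^a ⧢ S^a, D_b A = 1, D_c A = -S^a, D_c S^c = E,
the other derivatives being zero. As Υ(E) = exp(2Ξ_b) (`seriesInt_shuffleExp`), the coordinates
solve the Wei–Norman system Ξ_a' = u_a + 2Ξ_a u_b - Ξ_a² u_c, Ξ_b' = u_b - Ξ_a u_c, Ξ_c' = exp(2Ξ_b)
u_c from zero (`seriesInt_coordSeries`). The equation for A itself is a fixed-point problem whose
right-hand side gains one degree of accuracy at each application (`algebraicMap_congr`).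

For convergence, the ℓ¹ norm of the degree k part divided by k! (`growth`) is submultiplicative for
shuffles and obeys (k+1) g_{k+1}(S) = Σ_e g_k(D_e S). The derivatives above become a recursive
inequality for S^a whose majorant solves y' = (1+y)², y(0) = 0, that is y = r/(1-r). Its radius is
1, and since an iterated integral of length k is at most (Mt)^k/k!, the series converge for Mt < 1.

On the manifold, a flow of one X_d carries combinations of X_a, X_b, X_c to such combinations, the
coefficients following a linear equation given by the structure constants
(`HasTangentWithinAt.flowsTo`). This rests on differentiability of flows in the initial value
(`hasDerivWithinAt_of_linearized`) and on cutting a long flow into short ones inside charts. Applied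
three times, it shows that the product of flows has velocity Σ u_d X_d wherever the Wei–Norman
equations hold, hence almost everywhere. The curve is locally Lipschitz, so its composition with a
smooth function is absolutely continuous and is recovered from its derivative
(`isSolutionOn_of_isProductOfFlows`). -/

namespace LieScheffers

/-! ### Algebra of series -/

/-- The series of coefficients of the words ending in the letter `e`, with that letter removed. -/
def lastDeriv (e : Letter) (S : Series) : Series := fun v => S (e :: v)

theorem Series.ext_lastDeriv {S R : Series} (h0 : S [] = R [])
    (h : ∀ e, lastDeriv e S = lastDeriv e R) : S = R := by
  funext w
  cases w with
  | nil => exact h0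
  | cons e v => exact congrFun (h e) v

@[simp] theorem lastDeriv_add (e : Letter) (S R : Series) :
    lastDeriv e (S + R) = lastDeriv e S + lastDeriv e R := rfl

@[simp] theorem lastDeriv_sub (e : Letter) (S R : Series) :
    lastDeriv e (S - R) = lastDeriv e S - lastDeriv e R := rfl

@[simp] theorem lastDeriv_smul (e : Letter) (c : ℝ) (S : Series) :
    lastDeriv e (c • S) = c • lastDeriv e S := rfl

theorem word_nil_nil : word [] [] = 1 := by simp [word]

theorem word_nil_cons (e : Letter) (v : Word) : word [] (e :: v) = 0 := by simp [word]

@[simp] theorem lastDeriv_word_nil (e : Letter) : lastDeriv e (word []) = 0 := by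
  funext v
  exact word_nil_cons e v

theorem letter_nil (e : Letter) : letter e [] = 0 := by simp [letter, word]

theorem lastDeriv_letter (e f : Letter) :
    lastDeriv e (letter f) = if e = f then word [] else 0 := by
  funext v
  by_cases h : e = f
  · subst h
    by_cases hv : v = [] <;> simp [lastDeriv, letter, word, hv]
  · simp [lastDeriv, letter, word, h]

theorem sum_wordsOfLength_zero (f : Word → ℝ) : ∑ w ∈ wordsOfLength 0, f w = f [] := by
  have : wordsOfLength 0 = {[]} := by
    ext w
    simp [mem_wordsOfLength]
  simp [this]

theorem sum_wordsOfLength_succ (k : ℕ) (f : Word → ℝ) :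
    ∑ w ∈ wordsOfLength (k + 1), f w = ∑ e : Letter, ∑ v ∈ wordsOfLength k, f (e :: v) := by
  rw [← Finset.sum_product']
  symm
  refine Finset.sum_bij (fun p _ => p.1 :: p.2) ?_ ?_ ?_ ?_
  · rintro ⟨e, v⟩ h
    simpa [mem_wordsOfLength] using h
  · rintro ⟨e, v⟩ _ ⟨e', v'⟩ _ h
    simpa using h
  · intro w hw
    rw [mem_wordsOfLength] at hw
    cases w with
    | nil => simp at hw
    | cons e v => exact ⟨(e, v), by simpa [mem_wordsOfLength] using hw, rfl⟩
  · intros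
    rfl

theorem count_map_cons (e f : Letter) (s : Multiset Word) (w : Word) :
    (s.map (List.cons e)).count (f :: w) = if e = f then s.count w else 0 := by
  split_ifs with h
  · subst h
    exact Multiset.count_map_eq_count' _ _ List.cons_injective _
  · rw [Multiset.count_eq_zero]
    simp only [Multiset.mem_map, List.cons.injEq, not_exists, not_and]
    intro _ _ h'
    exact absurd h' h

/-- The words obtained from `v` by removing a last letter `e`, as a sum. -/
theorem count_shuffleWords_cons (e : Letter) (w v v' : Word) :
    (shuffleWords v v').count (e :: w) =
      (match v with
        | [] => 0
        | f :: v₁ => if f = e then (shuffleWords v₁ v').count w else 0) +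
      (match v' with
        | [] => 0
        | f :: v₂ => if f = e then (shuffleWords v v₂).count w else 0) := by
  have hnil : ∀ v : Word, shuffleWords v [] = {v} := by
    intro v
    cases v <;> simp [shuffleWords]
  have hnil' : ∀ v : Word, shuffleWords [] v = {v} := by
    intro v
    simp [shuffleWords]
  cases v with
  | nil =>
    cases v' with
    | nil => simp [hnil]
    | cons f v₂ =>
      simp only [hnil', Multiset.count_singleton, List.cons.injEq]
      grind
  | cons f v₁ =>
    cases v' with
    | nil =>
      simp only [hnil, Multiset.count_singleton, List.cons.injEq]
      grind
    | cons g v₂ =>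
      rw [shuffleWords, Multiset.count_add, count_map_cons, count_map_cons]

theorem shuffle_nil (S R : Series) : shuffle S R [] = S [] * R [] := by
  simp [shuffle, sum_wordsOfLength_zero, shuffleWords]

/-- Removing the last letter is a derivation of the shuffle product. -/
theorem shuffle_cons (S R : Series) (e : Letter) (w : Word) :
    shuffle S R (e :: w) = shuffle (lastDeriv e S) R w + shuffle S (lastDeriv e R) w := by
  have h1 : ∀ i v', ∑ v ∈ wordsOfLength (i + 1), S v * R v' *
      (((match v with
        | [] => 0
        | f :: v₁ => if f = e then (shuffleWords v₁ v').count w else 0 : ℕ)) : ℝ) =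
      ∑ v ∈ wordsOfLength i, lastDeriv e S v * R v' * ((shuffleWords v v').count w : ℝ) := by
    intro i v'
    rw [sum_wordsOfLength_succ, Finset.sum_eq_single e]
    · simp [lastDeriv]
    · intro f _ hf
      simp [hf]
    · simp
  have h2 : ∀ i v, ∑ v' ∈ wordsOfLength (i + 1), S v * R v' *
      (((match v' with
        | [] => 0
        | f :: v₂ => if f = e then (shuffleWords v v₂).count w else 0 : ℕ)) : ℝ) =
      ∑ v' ∈ wordsOfLength i, S v * lastDeriv e R v' * ((shuffleWords v v').count w : ℝ) := by
    intro i v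
    rw [sum_wordsOfLength_succ, Finset.sum_eq_single e]
    · simp [lastDeriv]
    · intro f _ hf
      simp [hf]
    · simp
  unfold shuffle
  simp only [count_shuffleWords_cons, Nat.cast_add, mul_add, Finset.sum_add_distrib,
    List.length_cons]
  congr 1
  -- An empty `v` has no last letter to remove, so the index 0 contributes nothing and the length of
  -- `v` shifts down by one.
  · rw [Finset.sum_range_succ']
    rw [show ∀ a b c : ℝ, a + b = c ↔ a = c - b from fun a b c => eq_sub_iff_add_eq.symm]
    rw [sum_wordsOfLength_zero]
    simp only [Nat.cast_zero, mul_zero, Finset.sum_const_zero, sub_zero]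
    refine Finset.sum_congr rfl fun i _ => ?_
    rw [Finset.sum_comm]
    simp only [h1]
    rw [Finset.sum_comm, Nat.add_sub_add_right]
  -- Here the top index leaves `v'` empty and drops out; for the others `v'` has successor length.
  · rw [Finset.sum_range_succ]
    have : ∀ v, ∑ v' ∈ wordsOfLength (w.length + 1 - (w.length + 1)), S v * R v' *
      (((match v' with
        | [] => 0
        | f :: v₂ => if f = e then (shuffleWords v v₂).count w else 0 : ℕ)) : ℝ) = 0 := by
      intro v
      rw [Nat.sub_self, sum_wordsOfLength_zero]
      simp
    simp only [this, Finset.sum_const_zero, add_zero]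
    refine Finset.sum_congr rfl fun i hi => ?_
    rw [Nat.sub_add_comm (Nat.lt_succ_iff.mp (Finset.mem_range.mp hi))]
    simp only [h2]

theorem lastDeriv_shuffle (e : Letter) (S R : Series) :
    lastDeriv e (shuffle S R) = shuffle (lastDeriv e S) R + shuffle S (lastDeriv e R) :=
  funext fun w => shuffle_cons S R e w

/-- A coefficient of a shuffle only involves factors no longer than the word. All truncation
arguments below rely on this. -/
theorem shuffle_congr {S S' R R' : Series} {n : ℕ} (hS : ∀ w : Word, w.length ≤ n → S w = S' w)
    (hR : ∀ w : Word, w.length ≤ n → R w = R' w) {w : Word} (hw : w.length ≤ n) :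
    shuffle S R w = shuffle S' R' w := by
  unfold shuffle
  refine Finset.sum_congr rfl fun i hi => Finset.sum_congr rfl fun v hv =>
    Finset.sum_congr rfl fun v' hv' => ?_
  rw [mem_wordsOfLength] at hv hv'
  rw [Finset.mem_range] at hi
  rw [hS v (by omega), hR v' (by omega)]

/-- Both sides obey the same Leibniz rule and have the same constant term, so induction on the word,
for all series at once, suffices. The unit law and associativity follow in the same way. -/
theorem shuffle_comm (S R : Series) : shuffle S R = shuffle R S := by
  funext w
  induction w generalizing S R with
  | nil => rw [shuffle_nil, shuffle_nil, mul_comm]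
  | cons e v ih => rw [shuffle_cons, shuffle_cons, ih, ih S, add_comm]

theorem shuffle_add (S R R' : Series) : shuffle S (R + R') = shuffle S R + shuffle S R' := by
  funext w
  simp only [shuffle, Pi.add_apply, mul_add, add_mul, Finset.sum_add_distrib]

theorem add_shuffle (S S' R : Series) : shuffle (S + S') R = shuffle S R + shuffle S' R := by
  rw [shuffle_comm, shuffle_add, shuffle_comm R, shuffle_comm R]

theorem shuffle_smul (c : ℝ) (S R : Series) : shuffle S (c • R) = c • shuffle S R := by
  funext w
  simp only [shuffle, Pi.smul_apply, smul_eq_mul, Finset.mul_sum]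
  refine Finset.sum_congr rfl fun i _ => Finset.sum_congr rfl fun v _ =>
    Finset.sum_congr rfl fun v' _ => ?_
  ring

theorem smul_shuffle (c : ℝ) (S R : Series) : shuffle (c • S) R = c • shuffle S R := by
  rw [shuffle_comm, shuffle_smul, shuffle_comm]

theorem shuffle_zero (S : Series) : shuffle S 0 = 0 := by
  simpa using shuffle_smul 0 S 0

theorem zero_shuffle (S : Series) : shuffle 0 S = 0 := by
  rw [shuffle_comm, shuffle_zero]

theorem shuffle_sum {ι : Type*} (s : Finset ι) (S : Series) (R : ι → Series) :
    shuffle S (∑ i ∈ s, R i) = ∑ i ∈ s, shuffle S (R i) := by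
  classical
  induction s using Finset.induction_on with
  | empty => simp [shuffle_zero]
  | insert i s hi ih => rw [Finset.sum_insert hi, Finset.sum_insert hi, shuffle_add, ih]

theorem word_nil_shuffle (S : Series) : shuffle (word []) S = S := by
  funext w
  induction w generalizing S with
  | nil => rw [shuffle_nil, word_nil_nil, one_mul]
  | cons e v ih =>
    rw [shuffle_cons, ih, lastDeriv_word_nil, zero_shuffle]
    simp [lastDeriv]

theorem shuffle_assoc (S R Q : Series) : shuffle (shuffle S R) Q = shuffle S (shuffle R Q) := by
  funext w
  induction w generalizing S R Q with
  | nil => simp only [shuffle_nil, mul_assoc]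
  | cons e v ih =>
    simp only [shuffle_cons, lastDeriv_shuffle, add_shuffle, shuffle_add, Pi.add_apply, ih]
    ring

theorem shuffle_left_comm (S R Q : Series) :
    shuffle S (shuffle R Q) = shuffle R (shuffle S Q) := by
  rw [← shuffle_assoc, shuffle_comm S, shuffle_assoc]

theorem concat_nil (S R : Series) : concat S R [] = S [] * R [] := by
  simp [concat]

/-- The last letter lies in the right factor unless that factor is empty; the exceptional
factorization is the index 0. -/
theorem lastDeriv_concat (e : Letter) (S R : Series) :
    lastDeriv e (concat S R) = R [] • lastDeriv e S + concat S (lastDeriv e R) := by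
  funext w
  simp only [lastDeriv, concat, List.length_cons, Pi.add_apply, Pi.smul_apply, smul_eq_mul]
  rw [Finset.sum_range_succ', add_comm]
  simp [mul_comm]

theorem concat_add (S R R' : Series) : concat S (R + R') = concat S R + concat S R' := by
  funext w
  simp only [concat, Pi.add_apply, mul_add, Finset.sum_add_distrib]

theorem concat_smul (c : ℝ) (S R : Series) : concat S (c • R) = c • concat S R := by
  funext w
  simp only [concat, Pi.smul_apply, smul_eq_mul, Finset.mul_sum]
  exact Finset.sum_congr rfl fun i _ => by ring

theorem concat_zero (S : Series) : concat S 0 = 0 := by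
  simpa using concat_smul 0 S 0

theorem concat_word_nil (S : Series) : concat S (word []) = S := by
  refine Series.ext_lastDeriv ?_ fun e => ?_
  · simp [concat_nil, word_nil_nil]
  · simp [lastDeriv_concat, word_nil_nil, concat_zero]

theorem concat_letter_nil (S : Series) (e : Letter) : concat S (letter e) [] = 0 := by
  simp [concat_nil, letter_nil]

theorem letter_concat_nil (S : Series) (e : Letter) : concat (letter e) S [] = 0 := by
  simp [concat_nil, letter_nil]

theorem lastDeriv_concat_letter (S : Series) (e f : Letter) :
    lastDeriv e (concat S (letter f)) = if e = f then S else 0 := by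
  rw [lastDeriv_concat, letter_nil, zero_smul, zero_add, lastDeriv_letter]
  split_ifs
  · exact concat_word_nil S
  · exact concat_zero S

theorem lastDeriv_letter_concat (S : Series) (e f : Letter) :
    lastDeriv e (concat (letter f) S) =
      S [] • (if e = f then word [] else 0) + concat (letter f) (lastDeriv e S) := by
  rw [lastDeriv_concat, lastDeriv_letter]

/-- The shuffle recursion with respect to first letters. -/
theorem letter_concat_shuffle_letter_concat (e f : Letter) (S R : Series) :
    shuffle (concat (letter e) S) (concat (letter f) R) =
      concat (letter e) (shuffle S (concat (letter f) R)) +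
        concat (letter f) (shuffle (concat (letter e) S) R) := by
  funext w
  induction w generalizing S R with
  | nil => simp [shuffle_nil, letter_concat_nil]
  | cons g v ih =>
    rw [shuffle_cons]
    change _ = lastDeriv g _ v
    simp only [lastDeriv_add, lastDeriv_letter_concat, add_shuffle, shuffle_add, smul_shuffle,
      shuffle_smul, lastDeriv_shuffle, concat_add, concat_smul, Pi.add_apply, ih, shuffle_nil,
      letter_concat_nil, Pi.smul_apply, smul_eq_mul]
    split_ifs <;>
    simp only [word_nil_shuffle, shuffle_comm _ (word []), zero_shuffle, shuffle_zero, concat_zero,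
      Pi.zero_apply] <;> ring

theorem shufflePow_nil {S : Series} (hS : S [] = 0) (n : ℕ) :
    shufflePow S n [] = if n = 0 then 1 else 0 := by
  cases n with
  | zero => simp [shufflePow, word_nil_nil]
  | succ n => simp [shufflePow, shuffle_nil, hS]

/-- The power rule for a derivation of a commutative algebra. -/
theorem lastDeriv_shufflePow_succ (e : Letter) (S : Series) (n : ℕ) :
    lastDeriv e (shufflePow S (n + 1)) =
      ((n : ℝ) + 1) • shuffle (lastDeriv e S) (shufflePow S n) := by
  induction n with
  | zero => simp [shufflePow, lastDeriv_shuffle, shuffle_zero]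
  | succ n ih =>
    rw [shufflePow, lastDeriv_shuffle, ih, shuffle_smul, shuffle_left_comm]
    change _ + ((n : ℝ) + 1) • shuffle _ (shufflePow S (n + 1)) = _
    push_cast
    module

/-- Without a constant term every factor uses up at least one letter, so each coefficient of the
shuffle exponential is a finite sum. -/
theorem shufflePow_eq_zero {S : Series} (hS : S [] = 0) (n : ℕ) :
    ∀ w : Word, w.length < n → shufflePow S n w = 0 := by
  induction n with
  | zero => simp
  | succ n ih =>
    intro w hw
    cases w with
    | nil => simp [shufflePow_nil hS]
    | cons e v =>
      simp only [List.length_cons, add_lt_add_iff_right] at hw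
      change lastDeriv e (shufflePow S (n + 1)) v = 0
      rw [lastDeriv_shufflePow_succ, Pi.smul_apply,
        shuffle_congr (n := v.length) (R' := 0) (fun _ _ => rfl)
          (fun w hw' => ih w (hw'.trans_lt hw)) le_rfl, shuffle_zero]
      simp

theorem shufflePow_congr {S R : Series} {k : ℕ} (h : ∀ w : Word, w.length ≤ k → S w = R w)
    (n : ℕ) : ∀ w : Word, w.length ≤ k → shufflePow S n w = shufflePow R n w := by
  induction n with
  | zero => exact fun _ _ => rfl
  | succ n ih => exact fun w hw => shuffle_congr h ih hw

theorem shuffleExp_congr {S R : Series} {k : ℕ} (h : ∀ w : Word, w.length ≤ k → S w = R w)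
    {w : Word} (hw : w.length ≤ k) : shuffleExp S w = shuffleExp R w := by
  unfold shuffleExp
  exact tsum_congr fun n => by rw [shufflePow_congr h n w hw]

/-- The truncation order may be any bound on the length, so that one finite sum serves for all the
words occurring in a shuffle. -/
theorem shuffleExp_eq_sum {S : Series} (hS : S [] = 0) {w : Word} {k : ℕ} (hw : w.length ≤ k) :
    shuffleExp S w = (∑ n ∈ Finset.range (k + 1), (n.factorial : ℝ)⁻¹ • shufflePow S n) w := by
  rw [shuffleExp, tsum_eq_sum (s := Finset.range (k + 1))]
  · simp [Finset.sum_apply, div_eq_inv_mul]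
  · intro n hn
    rw [Finset.mem_range, not_lt] at hn
    rw [shufflePow_eq_zero hS n w (by omega), zero_div]

theorem shuffleExp_nil {S : Series} (hS : S [] = 0) : shuffleExp S [] = 1 := by
  rw [shuffleExp_eq_sum hS (k := 0) le_rfl]
  simp [shufflePow, word_nil_nil]

/-- The chain rule for the exponential, obtained from the power rule on truncations. -/
theorem lastDeriv_shuffleExp {S : Series} (hS : S [] = 0) (e : Letter) :
    lastDeriv e (shuffleExp S) = shuffle (lastDeriv e S) (shuffleExp S) := by
  funext w
  rw [shuffle_congr (n := w.length) (fun _ _ => rfl) (fun w hw => shuffleExp_eq_sum hS hw) le_rfl,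
    -- The left side is evaluated at a word one letter longer, hence truncated one order later; the
    -- power rule compensates for the shift.
    shuffle_sum, lastDeriv, shuffleExp_eq_sum hS (k := w.length + 1) (by simp),
    Finset.sum_range_succ']
  simp only [Finset.sum_apply, Pi.add_apply]
  have : ((0 : ℕ).factorial : ℝ)⁻¹ • shufflePow S 0 = word [] := by simp [shufflePow]
  rw [this, word_nil_cons, add_zero]
  refine Finset.sum_congr rfl fun n _ => ?_
  change (((n + 1).factorial : ℝ)⁻¹ • lastDeriv e (shufflePow S (n + 1))) w = _
  rw [lastDeriv_shufflePow_succ, shuffle_smul, smul_smul]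
  rw [Nat.factorial_succ]
  push_cast
  have : (n.factorial : ℝ) ≠ 0 := by positivity
  field_simp

/-! ### The algebraic equation -/

/-- The right-hand side of the algebraic equation for `A`. -/
noncomputable def algebraicMap (A : Series) : Series :=
  letter .b - concat (concat (letter .a) (shuffleExp ((2 : ℝ) • A))) (letter .c)

/-- The trailing letter `c` uses up one degree, so the map is a contraction for the degree
filtration. Both existence and uniqueness of the fixed point come from this. -/
theorem algebraicMap_congr {A B : Series} {k : ℕ} (h : ∀ w : Word, w.length < k → A w = B w) :
    ∀ w : Word, w.length < k + 1 → algebraicMap A w = algebraicMap B w := by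
  intro w hw
  cases w with
  | nil => simp [algebraicMap, concat_letter_nil]
  | cons e v =>
    change lastDeriv e (algebraicMap A) v = lastDeriv e (algebraicMap B) v
    simp only [algebraicMap, lastDeriv_sub, lastDeriv_concat_letter, Pi.sub_apply]
    congr 1
    split_ifs
    · unfold concat
      refine Finset.sum_congr rfl fun i _ => ?_
      rw [shuffleExp_congr (S := (2 : ℝ) • A) (R := (2 : ℝ) • B) (k := v.length)]
      · intro w' hw'
        rw [Pi.smul_apply, Pi.smul_apply, h w' (by simp at hw; omega)]
      · simp
    · rfl

theorem IsA1Series.unique {A B : Series} (hA : IsA1Series A) (hB : IsA1Series B) : A = B := by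
  have key : ∀ k, ∀ w : Word, w.length < k → A w = B w := by
    intro k
    induction k with
    | zero => simp
    | succ k ih =>
      intro w hw
      rw [hA, hB]
      exact algebraicMap_congr ih w hw
  exact funext fun w => key _ w (Nat.lt_succ_self _)

theorem exists_isA1Series : ∃ A : Series, IsA1Series A := by
  let F : ℕ → Series := fun n => algebraicMap^[n] 0
  have hF : ∀ n, F (n + 1) = algebraicMap (F n) := fun n => Function.iterate_succ_apply' _ _ _
  have h1 : ∀ n, ∀ w : Word, w.length < n → F n w = F (n + 1) w := by
    intro n
    induction n with
    | zero => simp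
    | succ n ih =>
      intro w hw
      rw [hF n, hF (n + 1)]
      exact algebraicMap_congr ih w hw
  have h2 : ∀ n m, ∀ w : Word, w.length < n → F n w = F (n + m) w := by
    intro n m
    induction m with
    | zero => exact fun _ _ => rfl
    | succ m ih => exact fun w hw => (ih w hw).trans (h1 _ w (by omega))
  -- The iterate with index `w.length + 1` is the first one for which `h2` guarantees that the
  -- coefficient of `w` has stabilized.
  let A : Series := fun w => F (w.length + 1) w
  have hA : ∀ n, ∀ w : Word, w.length < n → A w = F n w := by
    intro n w hw
    obtain ⟨m, rfl⟩ : ∃ m, n = w.length + 1 + m := ⟨n - (w.length + 1), by omega⟩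
    exact h2 _ m w (by omega)
  refine ⟨A, funext fun w => ?_⟩
  change A w = algebraicMap A w
  rw [algebraicMap_congr (hA (w.length + 1)) w (by omega), ← hF]
  exact hA _ w (by omega)

/-! ### Last-letter derivatives of the coordinate series -/

section Coordinates

variable {A : Series}

theorem IsA1Series.eq (hA : IsA1Series A) :
    A = letter .b - concat (coordSeries A .a) (letter .c) := hA

theorem IsA1Series.nil (hA : IsA1Series A) : A [] = 0 := by
  rw [hA.eq]
  simp [letter_nil, concat_letter_nil]

theorem coordSeries_nil (hA : IsA1Series A) (d : Letter) : coordSeries A d [] = 0 := by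
  cases d
  · exact letter_concat_nil _ _
  · exact hA.nil
  · exact concat_letter_nil _ _

theorem IsA1Series.shuffleExp_nil (hA : IsA1Series A) : shuffleExp ((2 : ℝ) • A) [] = 1 :=
  LieScheffers.shuffleExp_nil (by simp [hA.nil])

theorem lastDeriv_coordSeries_b (hA : IsA1Series A) (e : Letter) :
    lastDeriv e (coordSeries A .b) =
      (if e = .b then word [] else 0) - (if e = .c then coordSeries A .a else 0) := by
  change lastDeriv e A = _
  conv_lhs => rw [hA.eq]
  rw [lastDeriv_sub, lastDeriv_letter, lastDeriv_concat_letter]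

theorem lastDeriv_coordSeries_c (e : Letter) :
    lastDeriv e (coordSeries A .c) = if e = .c then shuffleExp ((2 : ℝ) • A) else 0 :=
  lastDeriv_concat_letter _ _ _

theorem lastDeriv_shuffleExp_a (hA : IsA1Series A) :
    lastDeriv .a (shuffleExp ((2 : ℝ) • A)) = 0 := by
  rw [lastDeriv_shuffleExp (by simp [hA.nil]), lastDeriv_smul]
  have := lastDeriv_coordSeries_b hA .a
  simp only [coordSeries, reduceCtorEq, if_false, sub_zero] at this
  rw [this, smul_zero, zero_shuffle]

theorem lastDeriv_shuffleExp_b (hA : IsA1Series A) :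
    lastDeriv .b (shuffleExp ((2 : ℝ) • A)) = (2 : ℝ) • shuffleExp ((2 : ℝ) • A) := by
  rw [lastDeriv_shuffleExp (by simp [hA.nil]), lastDeriv_smul]
  have := lastDeriv_coordSeries_b hA .b
  simp only [coordSeries, reduceCtorEq, if_false, sub_zero, if_true] at this
  rw [this, smul_shuffle, word_nil_shuffle]

theorem lastDeriv_shuffleExp_c (hA : IsA1Series A) :
    lastDeriv .c (shuffleExp ((2 : ℝ) • A)) =
      (-2 : ℝ) • shuffle (shuffleExp ((2 : ℝ) • A)) (coordSeries A .a) := by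
  rw [lastDeriv_shuffleExp (by simp [hA.nil]), lastDeriv_smul]
  have := lastDeriv_coordSeries_b hA .c
  simp only [reduceCtorEq, if_false, if_true] at this
  change lastDeriv .c A = _ at this
  rw [this, smul_shuffle, zero_sub, ← neg_one_smul ℝ (coordSeries A .a), smul_shuffle, smul_smul,
    shuffle_comm]
  norm_num

theorem lastDeriv_coordSeries_a_a (hA : IsA1Series A) :
    lastDeriv .a (coordSeries A .a) = word [] := by
  rw [coordSeries, lastDeriv_letter_concat, lastDeriv_shuffleExp_a hA, hA.shuffleExp_nil,
    concat_zero]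
  simp

theorem lastDeriv_coordSeries_a_b (hA : IsA1Series A) :
    lastDeriv .b (coordSeries A .a) = (2 : ℝ) • coordSeries A .a := by
  rw [coordSeries, lastDeriv_letter_concat, lastDeriv_shuffleExp_b hA, concat_smul]
  simp

/-- Removing `c` from a·E gives -2 a·(E ⧢ (a·E)). The first-letter recursion for the square of a·E
yields two equal terms a·(E ⧢ (a·E)), so this is minus that square. This is the source of the
Riccati term in the equation of Ξ_a. -/
theorem lastDeriv_coordSeries_a_c (hA : IsA1Series A) :
    lastDeriv .c (coordSeries A .a) =
      (-1 : ℝ) • shuffle (coordSeries A .a) (coordSeries A .a) := by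
  rw [coordSeries, lastDeriv_letter_concat, lastDeriv_shuffleExp_c hA, concat_smul,
    letter_concat_shuffle_letter_concat, shuffle_comm (concat _ _) (shuffleExp _), ← two_smul ℝ,
    smul_smul, coordSeries]
  simp

end Coordinates

end LieScheffers
namespace LieScheffers

/-! ### Growth of coefficients -/

/-- The normalized `ℓ¹` norm `(1 / k!) ∑_{|w| = k} |S w|` of the homogeneous part of degree `k`. -/
noncomputable def growth (S : Series) (k : ℕ) : ℝ := (∑ w ∈ wordsOfLength k, |S w|) / (k.factorial : ℝ)

theorem growth_nonneg (S : Series) (k : ℕ) : 0 ≤ growth S k := by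
  unfold growth
  positivity

theorem growth_zero_right (S : Series) : growth S 0 = |S []| := by
  simp [growth, sum_wordsOfLength_zero]

/-- Sorting words by their last letter makes `growth` behave like a sequence of Taylor coefficients;
the factor k+1 comes from the factorial. -/
theorem growth_succ (S : Series) (k : ℕ) :
    ((k : ℝ) + 1) * growth S (k + 1) = ∑ e, growth (lastDeriv e S) k := by
  unfold growth
  rw [sum_wordsOfLength_succ, ← Finset.sum_div, Nat.factorial_succ]
  push_cast
  have : (k.factorial : ℝ) ≠ 0 := by positivity
  field_simp
  rfl

theorem growth_add_le (S R : Series) (k : ℕ) : growth (S + R) k ≤ growth S k + growth R k := by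
  unfold growth
  rw [← add_div, ← Finset.sum_add_distrib]
  gcongr with w
  exact abs_add_le _ _

theorem growth_smul (c : ℝ) (S : Series) (k : ℕ) : growth (c • S) k = |c| * growth S k := by
  unfold growth
  rw [← mul_div_assoc, Finset.mul_sum]
  simp [abs_mul]

theorem growth_zero (k : ℕ) : growth 0 k = 0 := by
  simp [growth]

theorem growth_word_nil (k : ℕ) : growth (word []) k = if k = 0 then 1 else 0 := by
  cases k with
  | zero => simp [growth_zero_right, word_nil_nil]
  | succ k =>
    have h := growth_succ (word []) k
    simp only [lastDeriv_word_nil, growth_zero, Finset.sum_const_zero] at h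
    simpa [(by positivity : (k : ℝ) + 1 ≠ 0)] using h

theorem sum_letter (f : Letter → ℝ) : ∑ d, f d = f .a + f .b + f .c := by
  have : (Finset.univ : Finset Letter) = {.a, .b, .c} := rfl
  rw [this, Finset.sum_insert (by simp), Finset.sum_insert (by simp), Finset.sum_singleton,
    add_assoc]

/-- The Leibniz rule for the Cauchy product of two sequences. -/
theorem leibniz_sum_antidiagonal (a b : ℕ → ℝ) (k : ℕ) :
    ((k : ℝ) + 1) * ∑ p ∈ Finset.HasAntidiagonal.antidiagonal (k + 1), a p.1 * b p.2 =
      ∑ p ∈ Finset.HasAntidiagonal.antidiagonal k,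
        (((p.1 : ℝ) + 1) * a (p.1 + 1) * b p.2 + a p.1 * (((p.2 : ℝ) + 1) * b (p.2 + 1))) := by
  have h : ∀ p ∈ Finset.HasAntidiagonal.antidiagonal (k + 1), ((k : ℝ) + 1) * (a p.1 * b p.2) =
      (p.1 : ℝ) * a p.1 * b p.2 + a p.1 * (p.2 * b p.2) := by
    intro p hp
    rw [Finset.HasAntidiagonal.mem_antidiagonal] at hp
    have : ((k : ℝ) + 1) = p.1 + p.2 := by exact_mod_cast hp.symm
    rw [this]
    ring
  rw [Finset.mul_sum, Finset.sum_congr rfl h, Finset.sum_add_distrib, Finset.sum_add_distrib,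
    Finset.Nat.sum_antidiagonal_succ, Finset.Nat.sum_antidiagonal_succ']
  simp

/-- The Leibniz rules for shuffles and for Cauchy products match, so induction on the degree
applies, for all pairs of series at once. -/
theorem growth_shuffle_le (S R : Series) (k : ℕ) :
    growth (shuffle S R) k ≤ ∑ p ∈ Finset.HasAntidiagonal.antidiagonal k, growth S p.1 * growth R p.2 := by
  induction k generalizing S R with
  | zero => simp [growth_zero_right, shuffle_nil, abs_mul]
  | succ k ih =>
    have hk : (0 : ℝ) < (k : ℝ) + 1 := by positivity
    rw [← mul_le_mul_iff_right₀ hk, leibniz_sum_antidiagonal, growth_succ]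
    calc ∑ e, growth (lastDeriv e (shuffle S R)) k
        ≤ ∑ e, (∑ p ∈ Finset.HasAntidiagonal.antidiagonal k, growth (lastDeriv e S) p.1 * growth R p.2 +
            ∑ p ∈ Finset.HasAntidiagonal.antidiagonal k, growth S p.1 * growth (lastDeriv e R) p.2) := by
          gcongr with e
          rw [lastDeriv_shuffle]
          exact (growth_add_le _ _ _).trans (add_le_add (ih _ _) (ih _ _))
      _ = _ := by
          simp only [growth_succ, Finset.sum_add_distrib, Finset.sum_mul, Finset.mul_sum]
          congr 1 <;> exact Finset.sum_comm

/-- The homogeneous parts of the series have iterated integrals with radius of convergence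
at least `1`. -/
def Tame (S : Series) : Prop := ∀ r : ℝ, 0 ≤ r → r < 1 → Summable fun k => growth S k * r ^ k

theorem Tame.of_growth_le {S : Series} (h : ∀ k, growth S k ≤ (k : ℝ) + 1) : Tame S := by
  intro r hr0 hr1
  have hr : ‖r‖ < 1 := by rwa [Real.norm_of_nonneg hr0]
  have h1 := (summable_pow_mul_geometric_of_norm_lt_one 1 hr).add
    (summable_geometric_of_norm_lt_one hr)
  refine h1.of_nonneg_of_le (fun k => mul_nonneg (growth_nonneg _ _) (pow_nonneg hr0 _)) fun k => ?_
  rw [pow_one, ← add_one_mul]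
  exact mul_le_mul_of_nonneg_right (h k) (pow_nonneg hr0 _)

theorem Tame.word_nil : Tame (word []) := by
  refine Tame.of_growth_le fun k => ?_
  rw [growth_word_nil]
  split_ifs <;> linarith [(Nat.cast_nonneg k : (0 : ℝ) ≤ k)]

theorem Tame.zero : Tame 0 := by
  intro r _ _
  simp [growth_zero]

theorem Tame.smul {S : Series} (hS : Tame S) (c : ℝ) : Tame (c • S) := by
  intro r hr0 hr1
  simpa only [growth_smul, mul_assoc] using (hS r hr0 hr1).mul_left |c|

theorem Tame.add {S R : Series} (hS : Tame S) (hR : Tame R) : Tame (S + R) := by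
  intro r hr0 hr1
  refine ((hS r hr0 hr1).add (hR r hr0 hr1)).of_nonneg_of_le
    (fun k => mul_nonneg (growth_nonneg _ _) (pow_nonneg hr0 _)) fun k => ?_
  rw [← add_mul]
  exact mul_le_mul_of_nonneg_right (growth_add_le _ _ _) (pow_nonneg hr0 _)

theorem Tame.shuffle_tame {S R : Series} (hS : Tame S) (hR : Tame R) : Tame (shuffle S R) := by
  intro r hr0 hr1
  have h := summable_norm_sum_mul_antidiagonal_of_summable_norm (hS r hr0 hr1).norm
    (hR r hr0 hr1).norm
  refine h.of_nonneg_of_le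
    (fun k => mul_nonneg (growth_nonneg _ _) (pow_nonneg hr0 _)) fun k => ?_
  refine le_trans ?_ (le_abs_self _)
  refine (mul_le_mul_of_nonneg_right (growth_shuffle_le S R k) (pow_nonneg hr0 _)).trans_eq ?_
  rw [Finset.sum_mul]
  refine Finset.sum_congr rfl fun p hp => ?_
  rw [← Finset.HasAntidiagonal.mem_antidiagonal.mp hp, pow_add]
  ring

/-- Integrating a power series termwise does not shrink its radius of convergence. -/
theorem Tame.of_lastDeriv {S : Series} (hS : ∀ e, Tame (lastDeriv e S)) : Tame S := by
  intro r hr0 hr1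
  rw [← summable_nat_add_iff 1]
  have h : Summable fun k => ∑ e, growth (lastDeriv e S) k * r ^ k :=
    summable_sum fun e _ => hS e r hr0 hr1
  refine h.of_nonneg_of_le
    (fun k => mul_nonneg (growth_nonneg _ _) (pow_nonneg hr0 _)) fun k => ?_
  rw [← Finset.sum_mul, ← growth_succ]
  refine mul_le_mul ?_ (pow_le_pow_of_le_one hr0 hr1.le k.le_succ) (pow_nonneg hr0 _)
    (mul_nonneg (by positivity) (growth_nonneg _ _))
  exact le_mul_of_one_le_left (growth_nonneg _ _) (by simp)

/-! ### Growth of the coordinate series -/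

section Coordinates

variable {A : Series}

/-- The three derivatives give (k+1) g_{k+1} ≤ δ_{k,0} + 2 g_k + Σ_{i+j=k} g_i g_j with g_0 = 0. The
sequence 0, 1, 1, 1, … satisfies this with equality, being the expansion of r/(1-r), which solves y'
= 1 + 2y + y². -/
theorem growth_coordSeries_a_le (hA : IsA1Series A) (k : ℕ) :
    growth (coordSeries A .a) k ≤ 1 := by
  have h0 : growth (coordSeries A .a) 0 = 0 := by
    rw [growth_zero_right, coordSeries_nil hA, abs_zero]
  induction k using Nat.strong_induction_on with
  | _ k ih =>
    cases k with
    | zero => rw [h0]; exact zero_le_one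
    | succ k =>
      have hk : (0 : ℝ) < (k : ℝ) + 1 := by positivity
      rw [← mul_le_mul_iff_right₀ hk, growth_succ, sum_letter, lastDeriv_coordSeries_a_a hA,
        lastDeriv_coordSeries_a_b hA, lastDeriv_coordSeries_a_c hA, growth_word_nil, growth_smul,
        growth_smul]
      have hs := growth_shuffle_le (coordSeries A .a) (coordSeries A .a) k
      cases k with
      | zero =>
        simp only [Finset.Nat.antidiagonal_zero, Finset.sum_singleton, h0] at hs ⊢
        norm_num at hs ⊢
        exact hs
      | succ k =>
        -- Both ends of the convolution vanish because g_0 = 0. There remain `k` products, each at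
        -- most 1, and with the linear term 2 g_{k+1} ≤ 2 they add up to exactly the allowed k+2.
        rw [Finset.Nat.sum_antidiagonal_succ, h0, zero_mul, zero_add,
          Finset.Nat.sum_antidiagonal_eq_sum_range_succ_mk, Finset.sum_range_succ] at hs
        simp only [Nat.sub_self, h0, mul_zero, add_zero] at hs
        have h1 : ∑ i ∈ Finset.range k, growth (coordSeries A .a) (i + 1) *
            growth (coordSeries A .a) (k - i) ≤ ∑ i ∈ Finset.range k, (1 : ℝ) := by
          refine Finset.sum_le_sum fun i hi => ?_
          rw [Finset.mem_range] at hi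
          exact mul_le_one₀ (ih _ (by omega)) (growth_nonneg _ _) (ih _ (by omega))
        simp only [Finset.sum_const, Finset.card_range, nsmul_eq_mul, mul_one] at h1
        have h2 := ih (k + 1) (by omega)
        norm_num
        linarith

/-- The majorant is 1/(1-r)² = Σ (k+1) r^k, the solution of z' = 2z(1+y) with y = r/(1-r) and z(0) =
1. In coefficients, 2(k+1) + k(k+1) = (k+1)(k+2). -/
theorem growth_shuffleExp_le (hA : IsA1Series A) (k : ℕ) :
    growth (shuffleExp ((2 : ℝ) • A)) k ≤ (k : ℝ) + 1 := by
  have h0 : growth (coordSeries A .a) 0 = 0 := by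
    rw [growth_zero_right, coordSeries_nil hA, abs_zero]
  induction k using Nat.strong_induction_on with
  | _ k ih =>
    cases k with
    | zero => simp [growth_zero_right, hA.shuffleExp_nil]
    | succ k =>
      have hk : (0 : ℝ) < (k : ℝ) + 1 := by positivity
      rw [← mul_le_mul_iff_right₀ hk, growth_succ, sum_letter, lastDeriv_shuffleExp_a hA,
        lastDeriv_shuffleExp_b hA, lastDeriv_shuffleExp_c hA, growth_zero, growth_smul,
        growth_smul]
      have hs := growth_shuffle_le (shuffleExp ((2 : ℝ) • A)) (coordSeries A .a) k
      rw [Finset.Nat.sum_antidiagonal_eq_sum_range_succ_mk, Finset.sum_range_succ] at hs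
      simp only [Nat.sub_self, h0, mul_zero, add_zero] at hs
      have h1 : ∑ i ∈ Finset.range k, growth (shuffleExp ((2 : ℝ) • A)) i *
            growth (coordSeries A .a) (k - i) ≤ ∑ i ∈ Finset.range k, ((i : ℝ) + 1) := by
        refine Finset.sum_le_sum fun i hi => ?_
        rw [Finset.mem_range] at hi
        refine (mul_le_of_le_one_right (growth_nonneg _ _) (growth_coordSeries_a_le hA _)).trans
          (ih _ (by omega))
      have h2 : ∑ i ∈ Finset.range k, ((i : ℝ) + 1) = k * (k + 1) / 2 := by
        clear * -
        induction k with
        | zero => simp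
        | succ k ih =>
          rw [Finset.sum_range_succ, ih]
          push_cast
          ring
      have h3 := ih k (by omega)
      norm_num
      rw [h2] at h1
      nlinarith

theorem tame_shuffleExp (hA : IsA1Series A) : Tame (shuffleExp ((2 : ℝ) • A)) :=
  Tame.of_growth_le (growth_shuffleExp_le hA)

theorem tame_coordSeries (hA : IsA1Series A) (d : Letter) : Tame (coordSeries A d) := by
  have ha : Tame (coordSeries A .a) := Tame.of_growth_le fun k =>
    (growth_coordSeries_a_le hA k).trans (by simp)
  cases d
  · exact ha
  · refine Tame.of_lastDeriv fun e => ?_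
    rw [lastDeriv_coordSeries_b hA, sub_eq_add_neg, ← neg_one_smul ℝ]
    refine Tame.add ?_ (Tame.smul ?_ _)
    · split_ifs
      exacts [Tame.word_nil, Tame.zero]
    · split_ifs
      exacts [ha, Tame.zero]
  · refine Tame.of_lastDeriv fun e => ?_
    rw [lastDeriv_coordSeries_c]
    split_ifs
    exacts [tame_shuffleExp hA, Tame.zero]

end Coordinates

end LieScheffers
namespace LieScheffers

/-! ### Primitives -/

theorem absolutelyContinuousOnInterval_const (c a b : ℝ) :
    AbsolutelyContinuousOnInterval (fun _ => c) a b :=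
  (contDiffOn_const (n := 1)).absolutelyContinuousOnInterval

/-- The controls are only measurable, so derivatives are available only almost everywhere. Absolute
continuity is what makes them determine the function. -/
theorem AbsolutelyContinuousOnInterval.eq_of_ae_hasDerivAt {f g : ℝ → ℝ} {a b : ℝ}
    (hf : AbsolutelyContinuousOnInterval f a b) (hg : AbsolutelyContinuousOnInterval g a b)
    (h0 : f a = g a)
    (h : ∀ᵐ s, s ∈ uIcc a b → ∃ d, HasDerivAt f d s ∧ HasDerivAt g d s) : f b = g b := by
  obtain ⟨C, hC⟩ := (hf.fun_sub hg).const_of_ae_hasDerivAt_zero (by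
    filter_upwards [h] with s hs hs'
    obtain ⟨d, h1, h2⟩ := hs hs'
    simpa using h1.fun_sub h2)
  have ha := hC a left_mem_uIcc
  have hb := hC b right_mem_uIcc
  linarith

theorem absolutelyContinuousOnInterval_sum {ι : Type*} (s : Finset ι) {f : ι → ℝ → ℝ} {a b : ℝ}
    (h : ∀ i ∈ s, AbsolutelyContinuousOnInterval (f i) a b) :
    AbsolutelyContinuousOnInterval (fun x => ∑ i ∈ s, f i x) a b := by
  classical
  induction s using Finset.induction_on with
  | empty => simpa using absolutelyContinuousOnInterval_const 0 a b
  | insert i s hi ih =>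
    simp only [Finset.sum_insert hi]
    exact (h i (by simp)).fun_add (ih fun j hj => h j (by simp [hj]))

theorem lipschitzOnWith_of_eq_integral {f g : ℝ → ℝ} {c b B : ℝ}
    (hg : IntervalIntegrable g volume 0 b) (hB : ∀ s ∈ Icc 0 b, |g s| ≤ B)
    (hf : ∀ t ∈ Icc 0 b, f t = c + ∫ s in (0 : ℝ)..t, g s) :
    LipschitzOnWith B.toNNReal f (Icc 0 b) := by
  refine LipschitzOnWith.of_dist_le_mul fun t ht t' ht' => ?_
  have hb : 0 ≤ b := ht.1.trans ht.2
  have hI : ∀ t ∈ Icc 0 b, IntervalIntegrable g volume 0 t := fun t ht =>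
    hg.mono_set (by rw [uIcc_of_le ht.1, uIcc_of_le hb]; exact Icc_subset_Icc_right ht.2)
  have hB0 : 0 ≤ B := (abs_nonneg _).trans (hB t ht)
  rw [hf t ht, hf t' ht', Real.dist_eq, add_sub_add_left_eq_sub,
    intervalIntegral.integral_interval_sub_left (hI t ht) (hI t' ht'), Real.dist_eq,
    Real.coe_toNNReal _ hB0]
  refine intervalIntegral.norm_integral_le_of_norm_le_const (f := g) (C := B) fun s hs => hB s ?_
  have := uIoc_subset_uIcc hs
  exact (uIcc_subset_Icc ht' ht) this

theorem LipschitzOnWith.exists_comp_contDiff {f : ℝ → ℝ} {φ : ℝ → ℝ} {K : NNReal} {s : Set ℝ}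
    (hs : IsCompact s) (hf : LipschitzOnWith K f s) (hφ : ContDiff ℝ 1 φ) :
    ∃ K', LipschitzOnWith K' (φ ∘ f) s := by
  obtain ⟨L, hL⟩ := (hφ.locallyLipschitz.locallyLipschitzOn
    (s := f '' s)).exists_lipschitzOnWith_of_compact (hs.image_of_continuousOn hf.continuousOn)
  exact ⟨L * K, hL.comp hf (mapsTo_image f s)⟩

/-! ### Iterated integrals -/

/-- Bounded measurable controls. -/
structure IsControl (u : Letter → ℝ → ℝ) (T M : ℝ) : Prop where
  T_pos : 0 < T
  M_pos : 0 < M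
  aemeasurable : ∀ d, AEMeasurable (u d) (volume.restrict (Icc 0 T))
  abs_le : ∀ d, ∀ t ∈ Icc 0 T, |u d t| ≤ M

section Control

variable {u : Letter → ℝ → ℝ} {T M : ℝ}

theorem IsControl.intervalIntegrable (hu : IsControl u T M) (d : Letter) {t : ℝ}
    (ht : t ∈ Icc 0 T) : IntervalIntegrable (u d) volume 0 t := by
  have h : IntegrableOn (u d) (Icc 0 T) :=
    Integrable.of_bound (hu.aemeasurable d).aestronglyMeasurable M
      ((ae_restrict_iff' measurableSet_Icc).2 (Filter.Eventually.of_forall (hu.abs_le d)))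
  rw [intervalIntegrable_iff_integrableOn_Icc_of_le ht.1]
  exact h.mono_set (Icc_subset_Icc_right ht.2)

theorem IsControl.intervalIntegrable_mul (hu : IsControl u T M) (d : Letter) {f : ℝ → ℝ} {t : ℝ}
    (ht : t ∈ Icc 0 T) (hf : ContinuousOn f (Icc 0 t)) :
    IntervalIntegrable (fun s => f s * u d s) volume 0 t :=
  (hu.intervalIntegrable d ht).continuousOn_mul (by rwa [uIcc_of_le ht.1])

theorem IsControl.continuousOn_integral (hu : IsControl u T M) (d : Letter) {f : ℝ → ℝ} {t : ℝ}
    (ht : t ∈ Icc 0 T) (hf : ContinuousOn f (Icc 0 t)) :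
    ContinuousOn (fun x => ∫ s in (0 : ℝ)..x, f s * u d s) (Icc 0 t) := by
  have h := (hu.intervalIntegrable_mul d ht hf)
  rw [intervalIntegrable_iff_integrableOn_Icc_of_le ht.1, ← uIcc_of_le ht.1] at h
  rw [← uIcc_of_le ht.1]
  exact intervalIntegral.continuousOn_primitive_interval h

theorem continuousOn_iteratedInt (hu : IsControl u T M) (w : Word) :
    ContinuousOn (iteratedInt u w) (Icc 0 T) := by
  induction w with
  | nil => exact continuousOn_const
  | cons e v ih => exact hu.continuousOn_integral e (right_mem_Icc.2 hu.T_pos.le) ih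

/-- The domain of integration is a simplex of volume t^k/k!, and the integrand is bounded by M^k.
This factorial is the one built into `growth`. -/
theorem abs_iteratedInt_le (hu : IsControl u T M) (w : Word) {t : ℝ} (ht : t ∈ Icc 0 T) :
    |iteratedInt u w t| ≤ (M * t) ^ w.length / (w.length.factorial : ℝ) := by
  induction w generalizing t with
  | nil => simp [iteratedInt]
  | cons e v ih =>
    have hM := hu.M_pos.le
    have h : |∫ s in (0 : ℝ)..t, iteratedInt u v s * u e s| ≤
        ∫ s in (0 : ℝ)..t, (M ^ (v.length + 1) / (v.length.factorial : ℝ)) * s ^ v.length := by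
      have hc : Continuous fun s : ℝ =>
          (M ^ (v.length + 1) / (v.length.factorial : ℝ)) * s ^ v.length := by fun_prop
      rw [← Real.norm_eq_abs]
      refine intervalIntegral.norm_integral_le_of_norm_le ht.1 ?_ (hc.intervalIntegrable (μ := volume) _ _)
      refine Filter.Eventually.of_forall fun s hs => ?_
      have hs' : s ∈ Icc 0 T := ⟨hs.1.le, hs.2.trans ht.2⟩
      rw [Real.norm_eq_abs, abs_mul]
      refine (mul_le_mul (ih hs') (hu.abs_le e s hs') (abs_nonneg _)
        (div_nonneg (pow_nonneg (mul_nonneg hM hs'.1) _) (by positivity))).trans_eq ?_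
      rw [mul_pow]
      ring
    refine h.trans_eq ?_
    rw [intervalIntegral.integral_const_mul, integral_pow, List.length_cons, Nat.factorial_succ]
    push_cast
    have : (v.length.factorial : ℝ) ≠ 0 := by positivity
    field_simp
    ring

theorem continuousOn_homogeneousInt (hu : IsControl u T M) (S : Series) (k : ℕ) :
    ContinuousOn (homogeneousInt u S k) (Icc 0 T) :=
  continuousOn_finsetSum _ fun w _ => continuousOn_const.mul (continuousOn_iteratedInt hu w)

theorem abs_homogeneousInt_le (hu : IsControl u T M) (S : Series) (k : ℕ) {t : ℝ}
    (ht : t ∈ Icc 0 T) : |homogeneousInt u S k t| ≤ growth S k * (M * t) ^ k := by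
  unfold homogeneousInt growth
  refine (Finset.abs_sum_le_sum_abs _ _).trans ?_
  rw [div_mul_eq_mul_div, mul_div_assoc, Finset.sum_mul]
  refine Finset.sum_le_sum fun w hw => ?_
  rw [abs_mul]
  have := abs_iteratedInt_le hu w ht
  rw [mem_wordsOfLength.mp hw] at this
  exact mul_le_mul_of_nonneg_left this (abs_nonneg _)

theorem homogeneousInt_zero_right (S : Series) (t : ℝ) : homogeneousInt u S 0 t = S [] := by
  simp [homogeneousInt, sum_wordsOfLength_zero, iteratedInt]

theorem homogeneousInt_succ (hu : IsControl u T M) (S : Series) (k : ℕ) {t : ℝ}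
    (ht : t ∈ Icc 0 T) : homogeneousInt u S (k + 1) t =
      ∑ e, ∫ s in (0 : ℝ)..t, homogeneousInt u (lastDeriv e S) k s * u e s := by
  unfold homogeneousInt
  rw [sum_wordsOfLength_succ]
  refine Finset.sum_congr rfl fun e _ => ?_
  simp only [Finset.sum_mul]
  rw [intervalIntegral.integral_finsetSum]
  · refine Finset.sum_congr rfl fun w _ => ?_
    simp only [mul_assoc]
    rw [intervalIntegral.integral_const_mul]
    rfl
  · intro w _
    exact hu.intervalIntegrable_mul e ht
      (continuousOn_const.mul ((continuousOn_iteratedInt hu w).mono (Icc_subset_Icc_right ht.2)))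

theorem IsControl.absolutelyContinuousOnInterval_integral (hu : IsControl u T M) (d : Letter)
    {f : ℝ → ℝ} {t : ℝ} (ht : t ∈ Icc 0 T) (hf : ContinuousOn f (Icc 0 t)) :
    AbsolutelyContinuousOnInterval (fun x => ∫ s in (0 : ℝ)..x, f s * u d s) 0 t :=
  (hu.intervalIntegrable_mul d ht hf).absolutelyContinuousOnInterval_intervalIntegral left_mem_uIcc

theorem AbsolutelyContinuousOnInterval.congr {f g : ℝ → ℝ} {a b : ℝ}
    (hf : AbsolutelyContinuousOnInterval f a b) (h : EqOn g f (uIcc a b)) :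
    AbsolutelyContinuousOnInterval g a b := by
  rw [absolutelyContinuousOnInterval_iff] at hf ⊢
  intro ε hε
  obtain ⟨δ, hδ, H⟩ := hf ε hε
  refine ⟨δ, hδ, fun E hE hE' => ?_⟩
  refine lt_of_eq_of_lt (Finset.sum_congr rfl fun i hi => ?_) (H E hE hE')
  have := hE.1 i hi
  rw [h this.1, h this.2]

theorem absolutelyContinuousOnInterval_homogeneousInt (hu : IsControl u T M) (S : Series) (k : ℕ)
    {t : ℝ} (ht : t ∈ Icc 0 T) : AbsolutelyContinuousOnInterval (homogeneousInt u S k) 0 t := by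
  have hsub : uIcc 0 t ⊆ Icc 0 T := by
    rw [uIcc_of_le ht.1]
    exact Icc_subset_Icc_right ht.2
  cases k with
  | zero =>
    refine AbsolutelyContinuousOnInterval.congr
      (absolutelyContinuousOnInterval_const (S []) 0 t) fun s _ => ?_
    exact homogeneousInt_zero_right S s
  | succ k =>
    refine AbsolutelyContinuousOnInterval.congr
      (absolutelyContinuousOnInterval_sum Finset.univ fun e _ =>
        hu.absolutelyContinuousOnInterval_integral e ht
          ((continuousOn_homogeneousInt hu (lastDeriv e S) k).mono (Icc_subset_Icc_right ht.2)))
      fun s hs => ?_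
    exact homogeneousInt_succ hu S k (hsub hs)

/-- Only the endpoints fail. Thus identities valid on the closed interval can be differentiated
two-sidedly almost everywhere. -/
theorem ae_mem_Icc_imp_nhds (a b : ℝ) : ∀ᵐ s : ℝ, s ∈ Icc a b → Icc a b ∈ nhds s := by
  filter_upwards [Measure.ae_ne volume a, Measure.ae_ne volume b] with s h1 h2 hs
  exact Icc_mem_nhds (lt_of_le_of_ne hs.1 h1.symm) (lt_of_le_of_ne hs.2 h2)

theorem ae_hasDerivAt_homogeneousInt_succ (hu : IsControl u T M) (S : Series) (k : ℕ) :
    ∀ᵐ s, s ∈ Icc 0 T → HasDerivAt (homogeneousInt u S (k + 1))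
      (∑ e, homogeneousInt u (lastDeriv e S) k s * u e s) s := by
  have hT := hu.T_pos.le
  have h : ∀ e, ∀ᵐ s, s ∈ uIcc 0 T → ∀ c ∈ uIcc 0 T, HasDerivAt
      (fun x => ∫ s in c..x, homogeneousInt u (lastDeriv e S) k s * u e s)
      (homogeneousInt u (lastDeriv e S) k s * u e s) s := fun e =>
    (hu.intervalIntegrable_mul e (right_mem_Icc.2 hT)
      (continuousOn_homogeneousInt hu (lastDeriv e S) k)).ae_hasDerivAt_integral
  rw [← ae_all_iff] at h
  filter_upwards [h, ae_mem_Icc_imp_nhds 0 T] with s hs hn hsT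
  rw [uIcc_of_le hT] at hs
  have := HasDerivAt.fun_sum (u := Finset.univ) fun e _ => hs e hsT 0 (left_mem_Icc.2 hT)
  refine this.congr_of_eventuallyEq ?_
  filter_upwards [hn hsT] with x hx
  exact homogeneousInt_succ hu S k hx

/-- One formula for all degrees, so that the product rule can be applied to a whole antidiagonal.
The truncated `k - 1` is read only for k ≠ 0. -/
theorem ae_hasDerivAt_homogeneousInt (hu : IsControl u T M) (S : Series) (k : ℕ) :
    ∀ᵐ s, s ∈ Icc 0 T → HasDerivAt (homogeneousInt u S k)
      (if k = 0 then 0 else ∑ e, homogeneousInt u (lastDeriv e S) (k - 1) s * u e s) s := by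
  cases k with
  | zero =>
    have : homogeneousInt u S 0 = fun _ => S [] := funext fun s => homogeneousInt_zero_right S s
    simp [this, hasDerivAt_const]
  | succ k => simpa using ae_hasDerivAt_homogeneousInt_succ hu S k

/-- The iterated integrals of a shuffle product. -/
theorem homogeneousInt_shuffle (hu : IsControl u T M) (S R : Series) (k : ℕ) {t : ℝ}
    (ht : t ∈ Icc 0 T) : homogeneousInt u (shuffle S R) k t =
      ∑ p ∈ Finset.HasAntidiagonal.antidiagonal k,
        homogeneousInt u S p.1 t * homogeneousInt u R p.2 t := by
  have hadd : ∀ (P Q : Series) k s, homogeneousInt u (P + Q) k s =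
      homogeneousInt u P k s + homogeneousInt u Q k s := by
    intro P Q k s
    simp [homogeneousInt, add_mul, Finset.sum_add_distrib]
  have h00 : (0 : ℝ) ∈ Icc 0 T := left_mem_Icc.2 hu.T_pos.le
  have h0 : ∀ (P : Series) k, homogeneousInt u P (k + 1) 0 = 0 := by
    intro P k
    rw [homogeneousInt_succ hu P k h00]
    simp
  induction k generalizing S R t with
  | zero => simp [homogeneousInt_zero_right, shuffle_nil]
  | succ k ih =>
    -- Both sides vanish at 0. Their derivatives agree almost everywhere by the Leibniz rule for
    -- `lastDeriv` and the induction hypothesis in degree `k`.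
    refine AbsolutelyContinuousOnInterval.eq_of_ae_hasDerivAt
      (g := fun t => ∑ p ∈ Finset.HasAntidiagonal.antidiagonal (k + 1),
        homogeneousInt u S p.1 t * homogeneousInt u R p.2 t)
      (absolutelyContinuousOnInterval_homogeneousInt hu _ _ ht)
      (absolutelyContinuousOnInterval_sum _ fun p _ =>
        (absolutelyContinuousOnInterval_homogeneousInt hu _ _ ht).fun_mul
          (absolutelyContinuousOnInterval_homogeneousInt hu _ _ ht)) ?_ ?_
    · simp only [h0]
      symm
      refine Finset.sum_eq_zero fun p hp => ?_
      rw [Finset.HasAntidiagonal.mem_antidiagonal] at hp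
      rcases p with ⟨i, j⟩
      cases i with
      | succ i => simp [h0]
      | zero =>
        cases j with
        | succ j => simp [h0]
        | zero => simp at hp
    · filter_upwards [ae_hasDerivAt_homogeneousInt_succ hu (shuffle S R) k,
        ae_all_iff.2 (ae_hasDerivAt_homogeneousInt hu S),
        ae_all_iff.2 (ae_hasDerivAt_homogeneousInt hu R)] with s h1 h2 h3 hs
      rw [uIcc_of_le ht.1] at hs
      have hsT : s ∈ Icc 0 T := Icc_subset_Icc_right ht.2 hs
      refine ⟨_, h1 hsT, ?_⟩
      refine (HasDerivAt.fun_sum (u := Finset.HasAntidiagonal.antidiagonal (k + 1)) fun p _ =>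
        (h2 p.1 hsT).fun_mul (h3 p.2 hsT)).congr_deriv (Eq.symm ?_)
      -- In each half of the product rule the term that differentiates the degree 0 part is zero,
      -- and the others are indexed by the antidiagonal of `k`.
      rw [Finset.sum_add_distrib, Finset.Nat.sum_antidiagonal_succ,
        Finset.Nat.sum_antidiagonal_succ']
      simp only [lastDeriv_shuffle, hadd, ih _ _ hsT, if_true, zero_mul, mul_zero, zero_add,
        Nat.succ_ne_zero, if_false,
        Nat.add_sub_cancel, add_mul, Finset.sum_add_distrib, Finset.sum_mul, Finset.mul_sum]
      congr 1
      · rw [Finset.sum_comm]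
        exact Finset.sum_congr rfl fun p _ => Finset.sum_congr rfl fun e _ => by ring
      · rw [Finset.sum_comm]
        exact Finset.sum_congr rfl fun p _ => Finset.sum_congr rfl fun e _ => by ring

/-! ### Convergent series of iterated integrals -/

theorem mem_Icc_of_mem_Ico_min {t : ℝ} (ht : t ∈ Ico 0 (min T (1 / M))) : t ∈ Icc 0 T :=
  ⟨ht.1, (ht.2.trans_le (min_le_left _ _)).le⟩

theorem IsControl.mul_lt_one (hu : IsControl u T M) {t : ℝ} (ht : t ∈ Ico 0 (min T (1 / M))) :
    M * t < 1 := by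
  have := ht.2.trans_le (min_le_right _ _)
  rwa [lt_div_iff₀ hu.M_pos, mul_comm] at this

theorem IsControl.mul_nonneg (hu : IsControl u T M) {t : ℝ} (ht : t ∈ Ico 0 (min T (1 / M))) :
    0 ≤ M * t := _root_.mul_nonneg hu.M_pos.le ht.1

theorem Tame.summable_bound {S : Series} (hS : Tame S) (hu : IsControl u T M) {t : ℝ}
    (ht : t ∈ Ico 0 (min T (1 / M))) : Summable fun k => growth S k * (M * t) ^ k :=
  hS _ (hu.mul_nonneg ht) (hu.mul_lt_one ht)

theorem abs_homogeneousInt_le_of_le (hu : IsControl u T M) (S : Series) (k : ℕ) {s t : ℝ}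
    (ht : t ∈ Ico 0 (min T (1 / M))) (hs : s ∈ Icc 0 t) :
    |homogeneousInt u S k s| ≤ growth S k * (M * t) ^ k := by
  refine (abs_homogeneousInt_le hu S k
    (Icc_subset_Icc_right (mem_Icc_of_mem_Ico_min ht).2 hs)).trans ?_
  have := hu.M_pos.le
  exact mul_le_mul_of_nonneg_left (pow_le_pow_left₀ (_root_.mul_nonneg this hs.1)
    (mul_le_mul_of_nonneg_left hs.2 this) _) (growth_nonneg _ _)

theorem Tame.summable {S : Series} (hS : Tame S) (hu : IsControl u T M) {t : ℝ}
    (ht : t ∈ Ico 0 (min T (1 / M))) : Summable fun k => homogeneousInt u S k t :=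
  (hS.summable_bound hu ht).of_norm_bounded fun k =>
    abs_homogeneousInt_le_of_le hu S k ht (right_mem_Icc.2 ht.1)

theorem Tame.continuousOn {S : Series} (hS : Tame S) (hu : IsControl u T M) {t : ℝ}
    (ht : t ∈ Ico 0 (min T (1 / M))) : ContinuousOn (seriesInt u S) (Icc 0 t) :=
  continuousOn_tsum (fun k => (continuousOn_homogeneousInt hu S k).mono
    (Icc_subset_Icc_right (mem_Icc_of_mem_Ico_min ht).2)) (hS.summable_bound hu ht)
    fun k _ hs => abs_homogeneousInt_le_of_le hu S k ht hs

theorem Tame.seriesInt_shuffle {S R : Series} (hS : Tame S) (hR : Tame R) (hu : IsControl u T M)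
    {t : ℝ} (ht : t ∈ Ico 0 (min T (1 / M))) :
    seriesInt u (shuffle S R) t = seriesInt u S t * seriesInt u R t := by
  unfold seriesInt
  rw [tsum_mul_tsum_eq_tsum_sum_antidiagonal_of_summable_norm (hS.summable hu ht).norm
    (hR.summable hu ht).norm]
  exact tsum_congr fun k => homogeneousInt_shuffle hu S R k (mem_Icc_of_mem_Ico_min ht)

theorem seriesInt_smul (c : ℝ) (S : Series) (t : ℝ) :
    seriesInt u (c • S) t = c * seriesInt u S t := by
  unfold seriesInt
  rw [← tsum_mul_left]
  refine tsum_congr fun k => ?_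
  simp [homogeneousInt, Finset.mul_sum, mul_assoc]

theorem seriesInt_zero (t : ℝ) : seriesInt u 0 t = 0 := by
  simp [seriesInt, homogeneousInt]

theorem seriesInt_word_nil (t : ℝ) : seriesInt u (word []) t = 1 := by
  rw [seriesInt, tsum_eq_single 0]
  · rw [homogeneousInt_zero_right, word_nil_nil]
  · intro k hk
    refine Finset.sum_eq_zero fun w hw => ?_
    rw [mem_wordsOfLength] at hw
    cases w with
    | nil => exact absurd hw.symm hk
    | cons e v => rw [word_nil_cons, zero_mul]

/-- The degree-by-degree recursion is summed under the integral by dominated convergence; the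
dominating terms are constant in s, taken at the right endpoint t. -/
theorem seriesInt_eq_integral {S : Series} (hS : Tame S) (hS' : ∀ e, Tame (lastDeriv e S))
    (hu : IsControl u T M) {t : ℝ} (ht : t ∈ Ico 0 (min T (1 / M))) :
    seriesInt u S t =
      S [] + ∫ s in (0 : ℝ)..t, ∑ e, seriesInt u (lastDeriv e S) s * u e s := by
  have htT := mem_Icc_of_mem_Ico_min ht
  have hM := hu.M_pos.le
  unfold seriesInt
  rw [(hS.summable hu ht).tsum_eq_zero_add, homogeneousInt_zero_right]
  congr 1
  simp only [homogeneousInt_succ hu S _ htT]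
  rw [intervalIntegral.integral_finsetSum]
  · refine HasSum.tsum_eq (hasSum_sum fun e _ => ?_)
    refine intervalIntegral.hasSum_integral_of_dominated_convergence
      (fun k _ => growth (lastDeriv e S) k * (M * t) ^ k * M) ?_ ?_ ?_ ?_ ?_
    · intro k
      exact (hu.intervalIntegrable_mul e htT ((continuousOn_homogeneousInt hu _ k).mono
        (Icc_subset_Icc_right htT.2))).aestronglyMeasurable_restrict_uIoc
    · refine fun k => Filter.Eventually.of_forall fun s hs => ?_
      rw [uIoc_of_le ht.1] at hs
      rw [Real.norm_eq_abs, abs_mul]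
      exact mul_le_mul (abs_homogeneousInt_le_of_le hu _ k ht (Ioc_subset_Icc_self hs))
        (hu.abs_le e s ⟨hs.1.le, hs.2.trans htT.2⟩) (abs_nonneg _)
        (_root_.mul_nonneg (growth_nonneg _ _) (pow_nonneg (hu.mul_nonneg ht) _))
    · exact Filter.Eventually.of_forall fun s _ => ((hS' e).summable_bound hu ht).mul_right M
    · exact intervalIntegrable_const
    · refine Filter.Eventually.of_forall fun s hs => ?_
      rw [uIoc_of_le ht.1] at hs
      exact (((hS' e).summable hu ⟨hs.1.le, hs.2.trans_lt ht.2⟩).hasSum).mul_right _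
  · intro e _
    exact hu.intervalIntegrable_mul e htT ((hS' e).continuousOn hu ht)

/-! ### The Wei–Norman equations -/

/-- The matrix of the Wei–Norman equations `ξ_d' = ∑ₑ W_{d,e}(ξ) u_e`. -/
noncomputable def weiNorman (x : Letter → ℝ) : Letter → Letter → ℝ
  | .a, .a => 1
  | .a, .b => 2 * x .a
  | .a, .c => -(x .a) ^ 2
  | .b, .a => 0
  | .b, .b => 1
  | .b, .c => -x .a
  | .c, .a => 0
  | .c, .b => 0
  | .c, .c => Real.exp (2 * x .b)

variable {A : Series}

theorem exists_abs_sum_mul_le (hu : IsControl u T M) {g : Letter → ℝ → ℝ} {t : ℝ}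
    (ht : t ∈ Icc 0 T) (hg : ∀ e, ContinuousOn (g e) (Icc 0 t)) :
    ∃ B, ∀ s ∈ Icc 0 t, |∑ e, g e s * u e s| ≤ B := by
  have h : ∀ e, ∃ B, ∀ s ∈ Icc 0 t, ‖g e s‖ ≤ B := fun e =>
    isCompact_Icc.exists_bound_of_continuousOn (hg e)
  choose B hB using h
  refine ⟨∑ e, B e * M, fun s hs => (Finset.abs_sum_le_sum_abs _ _).trans
    (Finset.sum_le_sum fun e _ => ?_)⟩
  rw [abs_mul]
  exact mul_le_mul (hB e s hs) (hu.abs_le e s (Icc_subset_Icc_right ht.2 hs)) (abs_nonneg _)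
    ((norm_nonneg _).trans (hB e s hs))

theorem IsControl.intervalIntegrable_sum_mul (hu : IsControl u T M) {g : Letter → ℝ → ℝ} {t : ℝ}
    (ht : t ∈ Icc 0 T) (hg : ∀ e, ContinuousOn (g e) (Icc 0 t)) :
    IntervalIntegrable (fun s => ∑ e, g e s * u e s) volume 0 t := by
  simp only [sum_letter]
  exact ((hu.intervalIntegrable_mul _ ht (hg _)).add (hu.intervalIntegrable_mul _ ht (hg _))).add
    (hu.intervalIntegrable_mul _ ht (hg _))

theorem ae_hasDerivAt_of_eq_integral {f g : ℝ → ℝ} {c b : ℝ} (hb : 0 ≤ b)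
    (hg : IntervalIntegrable g volume 0 b)
    (hf : ∀ t ∈ Icc 0 b, f t = c + ∫ s in (0 : ℝ)..t, g s) :
    ∀ᵐ s, s ∈ Icc 0 b → HasDerivAt f (g s) s := by
  filter_upwards [hg.ae_hasDerivAt_integral, ae_mem_Icc_imp_nhds 0 b] with s hs hn hsb
  rw [uIcc_of_le hb] at hs
  refine ((hs hsb 0 (left_mem_Icc.2 hb)).const_add c).congr_of_eventuallyEq ?_
  filter_upwards [hn hsb] with x hx
  exact hf x hx

theorem seriesInt_coordSeries_a (hA : IsA1Series A) (hu : IsControl u T M) {t : ℝ}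
    (ht : t ∈ Ico 0 (min T (1 / M))) :
    seriesInt u (coordSeries A .a) t = ∫ s in (0 : ℝ)..t,
      ∑ e, weiNorman (fun d => seriesInt u (coordSeries A d) s) .a e * u e s := by
  have ha := tame_coordSeries hA .a
  rw [seriesInt_eq_integral ha ?_ hu ht, coordSeries_nil hA, zero_add]
  · refine intervalIntegral.integral_congr fun s hs => ?_
    rw [uIcc_of_le ht.1] at hs
    have hs' : s ∈ Ico 0 (min T (1 / M)) := ⟨hs.1, hs.2.trans_lt ht.2⟩
    simp only [sum_letter, lastDeriv_coordSeries_a_a hA, lastDeriv_coordSeries_a_b hA,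
      lastDeriv_coordSeries_a_c hA, seriesInt_word_nil, seriesInt_smul,
      ha.seriesInt_shuffle ha hu hs', weiNorman]
    ring
  · rintro (_ | _ | _)
    · rw [lastDeriv_coordSeries_a_a hA]
      exact Tame.word_nil
    · rw [lastDeriv_coordSeries_a_b hA]
      exact ha.smul _
    · rw [lastDeriv_coordSeries_a_c hA]
      exact (ha.shuffle_tame ha).smul _

theorem seriesInt_coordSeries_b (hA : IsA1Series A) (hu : IsControl u T M) {t : ℝ}
    (ht : t ∈ Ico 0 (min T (1 / M))) :
    seriesInt u (coordSeries A .b) t = ∫ s in (0 : ℝ)..t,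
      ∑ e, weiNorman (fun d => seriesInt u (coordSeries A d) s) .b e * u e s := by
  have ha := tame_coordSeries hA .a
  have h1 : lastDeriv .a (coordSeries A .b) = 0 := by simp [lastDeriv_coordSeries_b hA]
  have h2 : lastDeriv .b (coordSeries A .b) = word [] := by simp [lastDeriv_coordSeries_b hA]
  have h3 : lastDeriv .c (coordSeries A .b) = (-1 : ℝ) • coordSeries A .a := by
    simp [lastDeriv_coordSeries_b hA]
  rw [seriesInt_eq_integral (tame_coordSeries hA .b) ?_ hu ht, coordSeries_nil hA, zero_add]
  · refine intervalIntegral.integral_congr fun s hs => ?_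
    simp only [sum_letter, h1, h2, h3, seriesInt_word_nil, seriesInt_smul, seriesInt_zero,
      weiNorman]
    ring
  · rintro (_ | _ | _)
    · rw [h1]
      exact Tame.zero
    · rw [h2]
      exact Tame.word_nil
    · rw [h3]
      exact ha.smul _

/-- No rearrangement of the exponential series is needed: Υ(E) satisfies the linear equation y' = 2
Ξ_b' y, so Υ(E)·exp(-2Ξ_b) has zero derivative almost everywhere and starts at 1. -/
theorem seriesInt_shuffleExp (hA : IsA1Series A) (hu : IsControl u T M) {t : ℝ}
    (ht : t ∈ Ico 0 (min T (1 / M))) :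
    seriesInt u (shuffleExp ((2 : ℝ) • A)) t = Real.exp (2 * seriesInt u (coordSeries A .b) t) := by
  have ha := tame_coordSeries hA .a
  have hE := tame_shuffleExp hA
  have htT := mem_Icc_of_mem_Ico_min ht
  have hsub : ∀ s ∈ Icc 0 t, s ∈ Ico 0 (min T (1 / M)) := fun s hs => ⟨hs.1, hs.2.trans_lt ht.2⟩
  have htame : ∀ e, Tame (lastDeriv e (shuffleExp ((2 : ℝ) • A))) := by
    rintro (_ | _ | _)
    · rw [lastDeriv_shuffleExp_a hA]
      exact Tame.zero
    · rw [lastDeriv_shuffleExp_b hA]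
      exact hE.smul _
    · rw [lastDeriv_shuffleExp_c hA]
      exact (hE.shuffle_tame ha).smul _
  have hI := fun s (hs : s ∈ Icc 0 t) => seriesInt_eq_integral hE htame hu (hsub s hs)
  have hIb := fun s (hs : s ∈ Icc 0 t) =>
    (seriesInt_coordSeries_b hA hu (hsub s hs)).trans (zero_add _).symm
  have hWc : ∀ e, ContinuousOn
      (fun s => weiNorman (fun d => seriesInt u (coordSeries A d) s) .b e) (Icc 0 t) := by
    rintro (_ | _ | _)
    · exact continuousOn_const
    · exact continuousOn_const
    · exact (ha.continuousOn hu ht).neg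
  have hEc : ∀ e, ContinuousOn
      (seriesInt u (lastDeriv e (shuffleExp ((2 : ℝ) • A)))) (Icc 0 t) :=
    fun e => (htame e).continuousOn hu ht
  obtain ⟨B, hB⟩ := exists_abs_sum_mul_le hu htT hWc
  obtain ⟨B', hB'⟩ := exists_abs_sum_mul_le hu htT hEc
  have hgb := hu.intervalIntegrable_sum_mul htT hWc
  have hgE := hu.intervalIntegrable_sum_mul htT hEc
  have hLb := lipschitzOnWith_of_eq_integral hgb hB hIb
  have hLE := lipschitzOnWith_of_eq_integral hgE hB' hI
  obtain ⟨K, hK⟩ := LipschitzOnWith.exists_comp_contDiff (φ := fun x => Real.exp (-2 * x))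
    isCompact_Icc hLb (by fun_prop)
  rw [← uIcc_of_le ht.1] at hK hLE
  have key := AbsolutelyContinuousOnInterval.eq_of_ae_hasDerivAt
    (hLE.absolutelyContinuousOnInterval.fun_mul hK.absolutelyContinuousOnInterval)
    (absolutelyContinuousOnInterval_const 1 0 t) ?_ ?_
  · simp only [Function.comp_apply] at key
    rw [neg_mul, Real.exp_neg] at key
    exact (mul_inv_eq_one₀ (Real.exp_ne_zero _)).1 key
  · have h00 : (0 : ℝ) ∈ Icc 0 t := left_mem_Icc.2 ht.1
    simp only [Function.comp_apply]
    rw [hI 0 h00, hIb 0 h00, hA.shuffleExp_nil]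
    simp
  · filter_upwards [ae_hasDerivAt_of_eq_integral ht.1 hgb hIb,
      ae_hasDerivAt_of_eq_integral ht.1 hgE hI] with s h1 h2 hs
    rw [uIcc_of_le ht.1] at hs
    refine ⟨0, ?_, hasDerivAt_const _ _⟩
    have := (h2 hs).fun_mul ((h1 hs).const_mul (-2)).exp
    refine this.congr_deriv ?_
    simp only [sum_letter, lastDeriv_shuffleExp_a hA, lastDeriv_shuffleExp_b hA,
      lastDeriv_shuffleExp_c hA, seriesInt_smul, seriesInt_zero,
      hE.seriesInt_shuffle ha hu (hsub s hs), weiNorman]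
    ring

theorem seriesInt_coordSeries_c (hA : IsA1Series A) (hu : IsControl u T M) {t : ℝ}
    (ht : t ∈ Ico 0 (min T (1 / M))) :
    seriesInt u (coordSeries A .c) t = ∫ s in (0 : ℝ)..t,
      ∑ e, weiNorman (fun d => seriesInt u (coordSeries A d) s) .c e * u e s := by
  have hE := tame_shuffleExp hA
  rw [seriesInt_eq_integral (tame_coordSeries hA .c) ?_ hu ht, coordSeries_nil hA, zero_add]
  · refine intervalIntegral.integral_congr fun s hs => ?_
    rw [uIcc_of_le ht.1] at hs
    have hs' : s ∈ Ico 0 (min T (1 / M)) := ⟨hs.1, hs.2.trans_lt ht.2⟩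
    simp [sum_letter, lastDeriv_coordSeries_c, seriesInt_zero, weiNorman,
      seriesInt_shuffleExp hA hu hs']
  · intro e
    rw [lastDeriv_coordSeries_c]
    split_ifs
    exacts [hE, Tame.zero]

theorem seriesInt_coordSeries (hA : IsA1Series A) (hu : IsControl u T M) (d : Letter) {t : ℝ}
    (ht : t ∈ Ico 0 (min T (1 / M))) :
    seriesInt u (coordSeries A d) t = ∫ s in (0 : ℝ)..t,
      ∑ e, weiNorman (fun d => seriesInt u (coordSeries A d) s) d e * u e s := by
  cases d
  exacts [seriesInt_coordSeries_a hA hu ht, seriesInt_coordSeries_b hA hu ht,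
    seriesInt_coordSeries_c hA hu ht]

theorem continuousOn_weiNorman (hA : IsA1Series A) (hu : IsControl u T M) (d e : Letter) {t : ℝ}
    (ht : t ∈ Ico 0 (min T (1 / M))) : ContinuousOn
      (fun s => weiNorman (fun d => seriesInt u (coordSeries A d) s) d e) (Icc 0 t) := by
  have h := fun d => (tame_coordSeries hA d).continuousOn hu ht
  have ha := h .a
  have hb := h .b
  cases d <;> cases e <;> simp only [weiNorman] <;> fun_prop

theorem exists_lipschitzOnWith_seriesInt_coordSeries (hA : IsA1Series A) (hu : IsControl u T M)
    (d : Letter) {t : ℝ} (ht : t ∈ Ico 0 (min T (1 / M))) :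
    ∃ K, LipschitzOnWith K (seriesInt u (coordSeries A d)) (Icc 0 t) := by
  have htT := mem_Icc_of_mem_Ico_min ht
  have hc := fun e => continuousOn_weiNorman hA hu d e ht
  obtain ⟨B, hB⟩ := exists_abs_sum_mul_le hu htT hc
  exact ⟨_, lipschitzOnWith_of_eq_integral (hu.intervalIntegrable_sum_mul htT hc) hB fun s hs =>
    (seriesInt_coordSeries hA hu d ⟨hs.1, hs.2.trans_lt ht.2⟩).trans (zero_add _).symm⟩

theorem ae_hasDerivAt_seriesInt_coordSeries (hA : IsA1Series A) (hu : IsControl u T M)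
    (d : Letter) {t : ℝ} (ht : t ∈ Ico 0 (min T (1 / M))) :
    ∀ᵐ s, s ∈ Icc 0 t → HasDerivAt (seriesInt u (coordSeries A d))
      (∑ e, weiNorman (fun d => seriesInt u (coordSeries A d) s) d e * u e s) s :=
  ae_hasDerivAt_of_eq_integral ht.1
    (hu.intervalIntegrable_sum_mul (mem_Icc_of_mem_Ico_min ht)
      fun e => continuousOn_weiNorman hA hu d e ht)
    fun _ hs => (seriesInt_coordSeries hA hu d ⟨hs.1, hs.2.trans_lt ht.2⟩).trans (zero_add _).symm

end Control

end LieScheffers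
namespace LieScheffers

/-! ### Local flows in a normed space -/

section NormedSpace

open Filter Topology

variable {E : Type*} [NormedAddCommGroup E] [NormedSpace ℝ E]

/-- `Φ` is a local flow of `V`, defined for times in `(-ε, ε)` and initial points in `D`, with
values in `U`, and Lipschitz with constant `L`. -/
structure IsFlowBox (V : E → E) (U D : Set E) (ε L : ℝ) (Φ : E → ℝ → E) : Prop where
  isOpen : IsOpen D
  zero : ∀ e ∈ D, Φ e 0 = e
  hasDerivAt : ∀ e ∈ D, ∀ r ∈ Ioo (-ε) ε, HasDerivAt (Φ e) (V (Φ e r)) r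
  mem : ∀ e ∈ D, ∀ r ∈ Ioo (-ε) ε, Φ e r ∈ U
  norm_sub_le : ∀ e ∈ D, ∀ e' ∈ D, ∀ r ∈ Ioo (-ε) ε, ∀ r' ∈ Ioo (-ε) ε,
    ‖Φ e r - Φ e' r'‖ ≤ L * (‖e - e'‖ + |r - r'|)

/-- Picard–Lindelöf gives the Lipschitz dependence on the initial point. A local bound on ‖V‖ adds
the one on time, once joint continuity confines the flow to `U` and to the region of that bound. -/
theorem exists_isFlowBox [CompleteSpace E] {V : E → E} {e₀ : E} (hV : ContDiffAt ℝ 1 V e₀)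
    {U : Set E} (hU : U ∈ 𝓝 e₀) :
    ∃ D ∈ 𝓝 e₀, ∃ ε > 0, ∃ L, 0 ≤ L ∧ ∃ Φ, IsFlowBox V U D ε L Φ := by
  obtain ⟨ε, hε, a, r, L, K, hr, hpl⟩ := IsPicardLindelof.of_contDiffAt_one hV
  obtain ⟨Φ, hΦ, L', hL'⟩ :=
    (hpl 0).exists_forall_mem_closedBall_eq_hasDerivWithinAt_lipschitzOnWith
  simp only [zero_sub, zero_add] at hΦ hL'
  have hcont : ContinuousOn (Function.uncurry Φ) (Metric.closedBall e₀ r ×ˢ Icc (-ε) ε) :=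
    continuousOn_prod_of_continuousOn_lipschitzOnWith _ L'
      (fun x hx => HasDerivWithinAt.continuousOn (hΦ x hx).2) hL'
  have hnhds : Metric.closedBall e₀ r ×ˢ Icc (-ε) ε ∈ 𝓝 (e₀, (0 : ℝ)) :=
    prod_mem_nhds (Metric.closedBall_mem_nhds _ hr) (Icc_mem_nhds (by linarith) hε)
  have hU' : U ∩ {e | ‖V e‖ < ‖V e₀‖ + 1} ∈ 𝓝 e₀ :=
    inter_mem hU (hV.continuousAt.norm.eventually_lt_const (by linarith))
  have h0 : Function.uncurry Φ (e₀, 0) = e₀ := (hΦ e₀ (Metric.mem_closedBall_self r.2)).1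
  have hpre : Function.uncurry Φ ⁻¹' (U ∩ {e | ‖V e‖ < ‖V e₀‖ + 1}) ∈ 𝓝 (e₀, (0 : ℝ)) :=
    (hcont.continuousAt hnhds).preimage_mem_nhds (by rwa [h0])
  obtain ⟨δ, hδ, hball⟩ := Metric.mem_nhds_iff.1 (inter_mem hnhds hpre)
  -- In the sup metric a ball is a product, so the single radius `δ` limits both initial points and
  -- times.
  rw [← ball_prod_same, Real.ball_eq_Ioo, zero_sub, zero_add] at hball
  have hmem : ∀ e ∈ Metric.ball e₀ δ, ∀ s ∈ Ioo (-δ) δ,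
      (e ∈ Metric.closedBall e₀ r ∧ s ∈ Icc (-ε) ε) ∧ Φ e s ∈ U ∧ ‖V (Φ e s)‖ < ‖V e₀‖ + 1 :=
    fun e he s hs => hball (mk_mem_prod he hs)
  have hδε : ∀ s ∈ Ioo (-δ) δ, Icc (-ε) ε ∈ 𝓝 s := fun s hs => by
    refine Filter.mem_of_superset (Ioo_mem_nhds hs.1 hs.2) fun s' hs' => ?_
    exact (hmem e₀ (Metric.mem_ball_self hδ) s' hs').1.2
  have hderiv : ∀ e ∈ Metric.ball e₀ δ, ∀ s ∈ Ioo (-δ) δ, HasDerivAt (Φ e) (V (Φ e s)) s := by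
    intro e he s hs
    obtain ⟨⟨h1, h2⟩, -⟩ := hmem e he s hs
    exact ((hΦ e h1).2 s h2).hasDerivAt (hδε s hs)
  have hB : 0 ≤ ‖V e₀‖ + 1 := by positivity
  refine ⟨Metric.ball e₀ δ, Metric.ball_mem_nhds _ hδ, δ, hδ, max L' (‖V e₀‖ + 1),
    le_max_of_le_right hB, Φ, ⟨Metric.isOpen_ball, fun e he => ?_, hderiv, fun e he s hs => ?_, ?_⟩⟩
  · exact (hΦ e (hmem e he 0 ⟨by linarith, hδ⟩).1.1).1
  · exact (hmem e he s hs).2.1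
  · intro e he e' he' s hs s' hs'
    have h1 : ‖Φ e s - Φ e' s‖ ≤ L' * ‖e - e'‖ :=
      (hL' s (hmem e he s hs).1.2).norm_sub_le (hmem e he s hs).1.1 (hmem e' he' s hs).1.1
    have h2 : ‖Φ e' s - Φ e' s'‖ ≤ (‖V e₀‖ + 1) * ‖s - s'‖ :=
      (convex_Ioo (-δ) δ).norm_image_sub_le_of_norm_hasDerivWithin_le
        (fun x hx => (hderiv e' he' x hx).hasDerivWithinAt)
        (fun x hx => (hmem e' he' x hx).2.2.le) hs' hs
    calc ‖Φ e s - Φ e' s'‖ ≤ ‖Φ e s - Φ e' s‖ + ‖Φ e' s - Φ e' s'‖ :=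
          norm_sub_le_norm_sub_add_norm_sub ..
      _ ≤ L' * ‖e - e'‖ + (‖V e₀‖ + 1) * ‖s - s'‖ := add_le_add h1 h2
      _ ≤ max (L' : ℝ) (‖V e₀‖ + 1) * ‖e - e'‖ + max (L' : ℝ) (‖V e₀‖ + 1) * ‖s - s'‖ := by
          gcongr
          exacts [le_max_left _ _, le_max_right _ _]
      _ = _ := by rw [mul_add, Real.norm_eq_abs]

/-- First-order Taylor expansion, uniform on a compact set. Near each point, strict
differentiability costs η/2, and replacing the derivative there by the one at a nearby base point
costs another η/2. -/
theorem eventually_norm_sub_sub_fderiv_le {V : E → E} {K : Set E} (hK : IsCompact K)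
    (hV : ∀ p ∈ K, ContDiffAt ℝ 1 V p) {η : ℝ} (hη : 0 < η) :
    ∀ᶠ h in 𝓝 (0 : E), ∀ p ∈ K, ‖V (p + h) - V p - fderiv ℝ V p h‖ ≤ η * ‖h‖ := by
  refine hK.eventually_forall_of_forall_eventually fun p hp => ?_
  have h1 := ((hV p hp).hasStrictFDerivAt one_ne_zero).isLittleO.def (half_pos hη)
  have h2 : Tendsto (fun z : E × E => (z.2 + z.1, z.2)) (𝓝 (0, p)) (𝓝 (p, p)) := by
    have : Continuous fun z : E × E => (z.2 + z.1, z.2) := by fun_prop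
    simpa using this.tendsto (0, p)
  have h3 : ∀ᶠ q in 𝓝 p, ‖fderiv ℝ V q - fderiv ℝ V p‖ < η / 2 := by
    have : ContinuousAt (fderiv ℝ V) p :=
      ((hV p hp).fderiv_right (m := 0) (by norm_num)).continuousAt
    have h4 : Tendsto (fun q => ‖fderiv ℝ V q - fderiv ℝ V p‖) (𝓝 p) (𝓝 0) := by
      simpa using (this.sub (continuousAt_const (y := fderiv ℝ V p))).norm.tendsto
    exact h4.eventually_lt_const (half_pos hη)
  filter_upwards [h2.eventually h1, (continuous_snd.tendsto (0, p)).eventually h3] with z hz hz'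
  simp only [add_sub_cancel_left] at hz
  have h5 : V (z.2 + z.1) - V z.2 - fderiv ℝ V z.2 z.1 =
      (V (z.2 + z.1) - V z.2 - fderiv ℝ V p z.1) - (fderiv ℝ V z.2 - fderiv ℝ V p) z.1 := by
    rw [sub_apply]
    abel
  rw [h5]
  refine (norm_sub_le _ _).trans ?_
  have h6 := (fderiv ℝ V z.2 - fderiv ℝ V p).le_of_opNorm_le hz'.le z.1
  linarith

/-- Differentiability with respect to the initial value: solutions of the linearized equation are
derivatives of families of solutions. -/
theorem hasDerivWithinAt_of_linearized {V : E → E} {S : Set ℝ} {t₀ R C : ℝ} {γ : ℝ → ℝ → E}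
    {W : ℝ → E} (hR : 0 ≤ R) (hC : 0 ≤ C) (ht₀ : t₀ ∈ S)
    (hγ : ∀ᶠ t in 𝓝[S] t₀, ∀ ρ ∈ Icc 0 R, HasDerivAt (γ t) (V (γ t ρ)) ρ)
    (hV : ∀ ρ ∈ Icc 0 R, ContDiffAt ℝ 1 V (γ t₀ ρ))
    (hlip : ∀ᶠ t in 𝓝[S] t₀, ∀ ρ ∈ Icc 0 R, ‖γ t ρ - γ t₀ ρ‖ ≤ C * |t - t₀|)
    (h0 : HasDerivWithinAt (fun t => γ t 0) (W 0) S t₀)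
    (hW : ∀ ρ ∈ Icc 0 R, HasDerivAt W (fderiv ℝ V (γ t₀ ρ) (W ρ)) ρ) :
    HasDerivWithinAt (fun t => γ t R) (W R) S t₀ := by
  have hγ0 : ∀ ρ ∈ Icc 0 R, HasDerivAt (γ t₀) (V (γ t₀ ρ)) ρ := hγ.self_of_nhdsWithin ht₀
  have hγc : ContinuousOn (γ t₀) (Icc 0 R) := fun ρ hρ =>
    (hγ0 ρ hρ).continuousAt.continuousWithinAt
  have hAc : ContinuousOn (fun ρ => fderiv ℝ V (γ t₀ ρ)) (Icc 0 R) := fun ρ hρ =>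
    (((hV ρ hρ).fderiv_right (m := 0) (by norm_num)).continuousAt.comp
      (hγ0 ρ hρ).continuousAt).continuousWithinAt
  obtain ⟨K, hK⟩ := isCompact_Icc.exists_bound_of_continuousOn hAc
  have hcpt : IsCompact (γ t₀ '' Icc 0 R) := isCompact_Icc.image_of_continuousOn hγc
  rw [hasDerivWithinAt_iff_isLittleO, Asymptotics.isLittleO_iff]
  intro η hη
  have hG : 0 < gronwallBound 1 K C R + 1 := by
    have hK0 : 0 ≤ K := (norm_nonneg _).trans (hK 0 (left_mem_Icc.2 hR))
    have := gronwallBound_mono zero_le_one hC hK0 hR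
    rw [gronwallBound_x0] at this
    linarith
  -- Chosen so that the Grönwall bound, which is linear in its initial and forcing errors, comes out
  -- at most η |t - t₀|.
  set η' := η / (gronwallBound 1 K C R + 1) with hη'
  have hη'0 : 0 < η' := div_pos hη hG
  have hunif := eventually_norm_sub_sub_fderiv_le (V := V) hcpt
    (by rintro _ ⟨ρ, hρ, rfl⟩; exact hV ρ hρ) hη'0
  obtain ⟨δ, hδ, hunif⟩ := Metric.eventually_nhds_iff.1 hunif
  have hsmall : ∀ᶠ t in 𝓝[S] t₀, C * |t - t₀| < δ := by
    have : Tendsto (fun t : ℝ => C * |t - t₀|) (𝓝 t₀) (𝓝 0) := by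
      have : Continuous fun t : ℝ => C * |t - t₀| := by fun_prop
      simpa using this.tendsto t₀
    exact nhdsWithin_le_nhds (this.eventually_lt_const hδ)
  have h0' := (hasDerivWithinAt_iff_isLittleO.1 h0).def hη'0
  filter_upwards [hγ, hlip, hsmall, h0'] with t h1 h2 h3 h4
  -- Grönwall is applied to the first-order remainder of the family in t. Its derivative in ρ is at
  -- most K times the remainder plus the Taylor error of `V` along the orbit.
  have key := norm_le_gronwallBound_of_norm_deriv_right_le (a := 0) (b := R)
    (f := fun ρ => γ t ρ - γ t₀ ρ - (t - t₀) • W ρ)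
    (f' := fun ρ => V (γ t ρ) - V (γ t₀ ρ) - (t - t₀) • fderiv ℝ V (γ t₀ ρ) (W ρ))
    (δ := η' * |t - t₀|) (K := K) (ε := η' * (C * |t - t₀|)) ?_ ?_ h4 ?_ R (right_mem_Icc.2 hR)
  · refine key.trans ?_
    rw [sub_zero]
    have hlin : gronwallBound (η' * |t - t₀|) K (η' * (C * |t - t₀|)) R =
        η' * |t - t₀| * gronwallBound 1 K C R := by
      by_cases hK0 : K = 0
      · simp only [hK0, gronwallBound_K0]
        ring
      · simp only [gronwallBound_of_K_ne_0 hK0]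
        ring
    rw [hlin, Real.norm_eq_abs, mul_right_comm]
    refine mul_le_mul_of_nonneg_right ?_ (abs_nonneg _)
    rw [hη', div_mul_eq_mul_div, div_le_iff₀ hG]
    exact mul_le_mul_of_nonneg_left (by linarith) hη.le
  · intro ρ hρ
    exact (((h1 ρ hρ).sub (hγ0 ρ hρ)).sub
      ((hW ρ hρ).const_smul (t - t₀))).continuousAt.continuousWithinAt
  · intro ρ hρ
    have hρ' := Ico_subset_Icc_self hρ
    exact (((h1 ρ hρ').sub (hγ0 ρ hρ')).sub
      ((hW ρ hρ').const_smul (t - t₀))).hasDerivWithinAt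
  · intro ρ hρ
    have hρ' := Ico_subset_Icc_self hρ
    have h5 := hunif (y := γ t ρ - γ t₀ ρ) (by
      rw [dist_zero_right]
      exact (h2 ρ hρ').trans_lt h3) (γ t₀ ρ) (mem_image_of_mem _ hρ')
    rw [add_sub_cancel] at h5
    have h6 : V (γ t ρ) - V (γ t₀ ρ) - (t - t₀) • fderiv ℝ V (γ t₀ ρ) (W ρ) =
        fderiv ℝ V (γ t₀ ρ) (γ t ρ - γ t₀ ρ - (t - t₀) • W ρ) +
          (V (γ t ρ) - V (γ t₀ ρ) - fderiv ℝ V (γ t₀ ρ) (γ t ρ - γ t₀ ρ)) := by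
      rw [map_sub _ (γ t ρ - γ t₀ ρ), map_smul]
      abel
    rw [h6]
    refine (norm_add_le _ _).trans (add_le_add ?_ ?_)
    · exact (fderiv ℝ V (γ t₀ ρ)).le_of_opNorm_le (hK ρ hρ') _
    · exact h5.trans (mul_le_mul_of_nonneg_left (h2 ρ hρ') hη'0.le)

theorem isBigO_sub_of_hasDerivWithinAt {f : ℝ → E} {f' : E} {S : Set ℝ} {t₀ : ℝ}
    (h : HasDerivWithinAt f f' S t₀) :
    (fun t => f t - f t₀) =O[𝓝[S] t₀] fun t => t - t₀ :=
  h.isBigO_sub.comp_tendsto (k := fun t => (t, t₀)) (tendsto_id.prodMk tendsto_const_pure)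

/-- The derivative of a local flow along a curve of initial values and times. -/
theorem IsFlowBox.hasDerivWithinAt {V : E → E} {U D : Set E} {ε L : ℝ} {Φ : E → ℝ → E}
    (h : IsFlowBox V U D ε L Φ) (hL : 0 ≤ L) (hV : ∀ e ∈ U, ContDiffAt ℝ 1 V e) {S : Set ℝ}
    {t₀ : ℝ} (ht₀ : t₀ ∈ S) {ζ : ℝ → E} {r : ℝ → ℝ} {r' : ℝ} {W : ℝ → E}
    (hζ : HasDerivWithinAt ζ (W 0) S t₀) (hr : HasDerivWithinAt r r' S t₀) (hD : ζ t₀ ∈ D)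
    (hrε : r t₀ ∈ Ioo (-ε) ε)
    (hW : ∀ ρ ∈ Ioo (-ε) ε, HasDerivAt W (fderiv ℝ V (Φ (ζ t₀) ρ) (W ρ)) ρ) :
    HasDerivWithinAt (fun t => Φ (ζ t) (r t)) (W (r t₀) + r' • V (Φ (ζ t₀) (r t₀))) S t₀ := by
  have hDev : ∀ᶠ t in 𝓝[S] t₀, ζ t ∈ D := hζ.continuousWithinAt (h.isOpen.mem_nhds hD)
  have hrev : ∀ᶠ t in 𝓝[S] t₀, r t ∈ Ioo (-ε) ε :=
    hr.continuousWithinAt (Ioo_mem_nhds hrε.1 hrε.2)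
  have hε : 0 < ε := by linarith [hrε.1, hrε.2]
  obtain ⟨C, hC, hζC⟩ : ∃ C, 0 ≤ C ∧ ∀ᶠ t in 𝓝[S] t₀, ‖ζ t - ζ t₀‖ ≤ C * |t - t₀| := by
    obtain ⟨C, hC⟩ := (isBigO_sub_of_hasDerivWithinAt hζ).bound
    refine ⟨max C 0, le_max_right _ _, hC.mono fun t ht => ht.trans ?_⟩
    exact mul_le_mul_of_nonneg_right (le_max_left _ _) (norm_nonneg _)
  have hlip : ∀ᶠ t in 𝓝[S] t₀, ∀ ρ ∈ Ioo (-ε) ε,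
      ‖Φ (ζ t) ρ - Φ (ζ t₀) ρ‖ ≤ L * C * |t - t₀| := by
    filter_upwards [hDev, hζC] with t h1 h2 ρ hρ
    have h3 := h.norm_sub_le _ h1 _ hD ρ hρ ρ hρ
    rw [sub_self, abs_zero, add_zero] at h3
    rw [mul_assoc]
    exact h3.trans (mul_le_mul_of_nonneg_left h2 hL)
  -- the derivative at a fixed time
  have hfix : HasDerivWithinAt (fun t => Φ (ζ t) (r t₀)) (W (r t₀)) S t₀ := by
    have hζ0 : HasDerivWithinAt (fun t => Φ (ζ t) 0) (W 0) S t₀ := by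
      refine hζ.congr_of_eventuallyEq ?_ (h.zero _ hD)
      filter_upwards [hDev] with t ht using h.zero _ ht
    rcases le_total 0 (r t₀) with h0 | h0
    · have hsub : ∀ ρ ∈ Icc 0 (r t₀), ρ ∈ Ioo (-ε) ε := fun ρ hρ =>
        ⟨by linarith [hρ.1], hρ.2.trans_lt hrε.2⟩
      refine hasDerivWithinAt_of_linearized (V := V) (γ := fun t => Φ (ζ t)) (C := L * C) h0
        (mul_nonneg hL hC) ht₀ ?_ ?_ ?_ hζ0 fun ρ hρ => hW ρ (hsub ρ hρ)
      · filter_upwards [hDev] with t ht ρ hρ using h.hasDerivAt _ ht ρ (hsub ρ hρ)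
      · exact fun ρ hρ => hV _ (h.mem _ hD ρ (hsub ρ hρ))
      · filter_upwards [hlip] with t ht ρ hρ using ht ρ (hsub ρ hρ)
    -- Negative times reduce to positive ones by reversing time and replacing V by -V.
    · have hsub : ∀ ρ ∈ Icc 0 (-r t₀), -ρ ∈ Ioo (-ε) ε := fun ρ hρ =>
        ⟨by linarith [hρ.2, hrε.1], by linarith [hρ.1]⟩
      have := hasDerivWithinAt_of_linearized (V := -V) (γ := fun t ρ => Φ (ζ t) (-ρ))
        (W := fun ρ => W (-ρ)) (C := L * C) (S := S) (t₀ := t₀) (neg_nonneg.2 h0)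
        (mul_nonneg hL hC) ht₀ ?_ ?_ ?_ (by simpa using hζ0) ?_
      · simpa using this
      · filter_upwards [hDev] with t ht ρ hρ
        simpa [Function.comp_def] using (h.hasDerivAt _ ht _ (hsub ρ hρ)).scomp ρ (hasDerivAt_neg ρ)
      · exact fun ρ hρ => (hV _ (h.mem _ hD _ (hsub ρ hρ))).neg
      · filter_upwards [hlip] with t ht ρ hρ using ht _ (hsub ρ hρ)
      · intro ρ hρ
        rw [fderiv_neg]
        simpa [Function.comp_def] using (hW _ (hsub ρ hρ)).scomp ρ (hasDerivAt_neg ρ)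
  -- the variation of the time
  have hvar : (fun t => Φ (ζ t) (r t) - Φ (ζ t) (r t₀) - (r t - r t₀) • V (Φ (ζ t₀) (r t₀)))
      =o[𝓝[S] t₀] fun t => r t - r t₀ := by
    rw [Asymptotics.isLittleO_iff]
    intro η hη
    have hVc := (hV _ (h.mem _ hD _ hrε)).continuousAt
    obtain ⟨δ, hδ, hVδ⟩ := Metric.continuousAt_iff.1 hVc η hη
    have hnear : ∀ᶠ t in 𝓝[S] t₀, L * (‖ζ t - ζ t₀‖ + |r t - r t₀|) < δ := by
      have : ContinuousWithinAt (fun t => L * (‖ζ t - ζ t₀‖ + |r t - r t₀|)) S t₀ :=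
        continuousWithinAt_const.mul ((hζ.continuousWithinAt.sub continuousWithinAt_const).norm.add
          (hr.continuousWithinAt.sub continuousWithinAt_const).abs)
      have h1 := this.tendsto
      simp only [sub_self, norm_zero, abs_zero, add_zero, mul_zero] at h1
      exact h1.eventually_lt_const hδ
    filter_upwards [hDev, hrev, hnear] with t h1 h2 h3
    have hsub : ∀ ρ ∈ uIcc (r t₀) (r t), ρ ∈ Ioo (-ε) ε := fun ρ hρ =>
      (ordConnected_Ioo.uIcc_subset hrε h2) hρ
    -- Mean value inequality for the orbit minus its motion with constant velocity `V (Φ (ζ t₀) (r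
    -- t₀))`; continuity of V makes the difference of velocities at most η.
    have := (convex_uIcc (r t₀) (r t)).norm_image_sub_le_of_norm_hasDerivWithin_le
      (f := fun ρ => Φ (ζ t) ρ - ρ • V (Φ (ζ t₀) (r t₀)))
      (f' := fun ρ => V (Φ (ζ t) ρ) - V (Φ (ζ t₀) (r t₀))) (C := η) ?_ ?_ left_mem_uIcc right_mem_uIcc
    · convert this using 2
      rw [sub_smul]
      abel
    · intro ρ hρ
      simpa using ((h.hasDerivAt _ h1 ρ (hsub ρ hρ)).fun_sub
        ((hasDerivAt_id ρ).smul_const (V (Φ (ζ t₀) (r t₀))))).hasDerivWithinAt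
    · intro ρ hρ
      rw [← dist_eq_norm]
      refine (hVδ ?_).le
      rw [dist_eq_norm]
      refine (h.norm_sub_le _ h1 _ hD ρ (hsub ρ hρ) _ hrε).trans_lt (lt_of_le_of_lt ?_ h3)
      refine mul_le_mul_of_nonneg_left (add_le_add_right ?_ _) hL
      exact abs_sub_left_of_mem_uIcc hρ
  have h1 := hvar.trans_isBigO (isBigO_sub_of_hasDerivWithinAt hr)
  have h2 := hasDerivWithinAt_iff_isLittleO.1 hfix
  have h3 := (hasDerivWithinAt_iff_isLittleO.1 hr)
  have h4 : (fun t => (r t - r t₀ - (t - t₀) • r') • V (Φ (ζ t₀) (r t₀)))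
      =o[𝓝[S] t₀] fun t => t - t₀ := by
    have := h3.smul_isBigO
      (Asymptotics.isBigO_const_const (V (Φ (ζ t₀) (r t₀))) (one_ne_zero (α := ℝ)) (𝓝[S] t₀))
    simpa using this
  rw [hasDerivWithinAt_iff_isLittleO]
  refine ((h1.add h2).add h4).congr_left fun t => ?_
  simp only [smul_add, sub_smul, smul_eq_mul, mul_smul]
  abel

end NormedSpace

end LieScheffers
namespace LieScheffers

/-! ### Vector fields and tangent vectors of curves in a chart -/

section Manifold

open Filter Topology

variable {E : Type*} [NormedAddCommGroup E] [NormedSpace ℝ E]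
  {N : Type*} [TopologicalSpace N] [ChartedSpace E N]

/-- The derivative of the chart at `p₀`, in the point `q`. -/
noncomputable def chartDeriv (p₀ q : N) : E →L[ℝ] E :=
  mfderiv 𝓘(ℝ, E) 𝓘(ℝ, E) (extChartAt 𝓘(ℝ, E) p₀) q

/-- The expression of the vector field `V` in the chart at `p₀`. -/
noncomputable def chartField (p₀ : N) (V : (p : N) → TangentSpace 𝓘(ℝ, E) p) (e : E) : E :=
  chartDeriv p₀ ((extChartAt 𝓘(ℝ, E) p₀).symm e) (V ((extChartAt 𝓘(ℝ, E) p₀).symm e))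

/-- The curve `z` has the velocity `v` at `t`, within `S`. -/
def HasTangentWithinAt (z : ℝ → N) (v : E) (S : Set ℝ) (t : ℝ) : Prop :=
  HasMFDerivWithinAt 𝓘(ℝ, ℝ) 𝓘(ℝ, E) z S t
    ((1 : ℝ →L[ℝ] ℝ).smulRight (v : TangentSpace 𝓘(ℝ, E) (z t)))

theorem chartField_extChartAt (p₀ : N) (V : (p : N) → TangentSpace 𝓘(ℝ, E) p) {q : N}
    (hq : q ∈ (extChartAt 𝓘(ℝ, E) p₀).source) :
    chartField p₀ V (extChartAt 𝓘(ℝ, E) p₀ q) = chartDeriv (E := E) p₀ q (V q) := by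
  rw [chartField, (extChartAt 𝓘(ℝ, E) p₀).left_inv hq]

theorem hasTangentWithinAt_iff {z : ℝ → E} {v : E} {S : Set ℝ} {t : ℝ} :
    HasTangentWithinAt z v S t ↔ HasDerivWithinAt z v S t := by
  have h : (1 : ℝ →L[ℝ] ℝ).smulRight v = ContinuousLinearMap.toSpanSingleton ℝ v := by
    ext
    simp
  rw [hasDerivWithinAt_iff_hasFDerivWithinAt, ← h]
  exact hasMFDerivWithinAt_iff_hasFDerivWithinAt

theorem HasTangentWithinAt.mono_of_mem_nhdsWithin {z : ℝ → N} {v : E} {S S' : Set ℝ} {t : ℝ}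
    (h : HasTangentWithinAt z v S t) (hS : S ∈ 𝓝[S'] t) : HasTangentWithinAt z v S' t :=
  HasMFDerivWithinAt.mono_of_mem_nhdsWithin h hS

theorem HasTangentWithinAt.congr_of_eventuallyEq {z z' : ℝ → N} {v : E} {S : Set ℝ} {t : ℝ}
    (h : HasTangentWithinAt z v S t) (hz : z' =ᶠ[𝓝[S] t] z) (ht : z' t = z t) :
    HasTangentWithinAt z' v S t :=
  HasMFDerivWithinAt.congr_of_eventuallyEq (f := z) h hz ht

theorem HasTangentWithinAt.comp_hasMFDerivAt {E' : Type*} [NormedAddCommGroup E']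
    [NormedSpace ℝ E'] {N' : Type*} [TopologicalSpace N'] [ChartedSpace E' N'] {z : ℝ → N}
    {v : E} {S : Set ℝ} {t : ℝ} (h : HasTangentWithinAt z v S t) {g : N → N'} {g' : E →L[ℝ] E'}
    (hg : HasMFDerivAt 𝓘(ℝ, E) 𝓘(ℝ, E') g (z t) g') :
    HasTangentWithinAt (g ∘ z) (g' v) S t := by
  refine (hg.comp_hasMFDerivWithinAt t h).congr_mfderiv ?_
  refine ContinuousLinearMap.ext fun r => ?_
  exact g'.map_smul r v

variable [IsManifold 𝓘(ℝ, E) ∞ N]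

/-- The vector field `V` is smooth. -/
abbrev IsSmoothField (V : (p : N) → TangentSpace 𝓘(ℝ, E) p) : Prop :=
  ContMDiff 𝓘(ℝ, E) 𝓘(ℝ, E).tangent ∞ (fun p => (⟨p, V p⟩ : TangentBundle 𝓘(ℝ, E) N))

theorem isInvertible_mfderiv_extChartAt_symm {p₀ : N} {e : E}
    (he : e ∈ (extChartAt 𝓘(ℝ, E) p₀).target) :
    (mfderiv 𝓘(ℝ, E) 𝓘(ℝ, E) (extChartAt 𝓘(ℝ, E) p₀).symm e).IsInvertible := by
  have := isInvertible_mfderivWithin_extChartAt_symm (I := 𝓘(ℝ, E)) he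
  simpa only [modelWithCornersSelf_coe, range_id, mfderivWithin_univ] using this

/-- The derivatives of the chart and of its inverse are mutually inverse. Recognizing `chartField`
as a pullback yields its smoothness and its compatibility with Lie brackets. -/
theorem mpullback_extChartAt_symm {p₀ : N} (V : (p : N) → TangentSpace 𝓘(ℝ, E) p) {e : E}
    (he : e ∈ (extChartAt 𝓘(ℝ, E) p₀).target) :
    VectorField.mpullback 𝓘(ℝ, E) 𝓘(ℝ, E) (extChartAt 𝓘(ℝ, E) p₀).symm V e = chartField p₀ V e := by
  have h1 := mfderiv_extChartAt_comp_mfderivWithin_extChartAt_symm (I := 𝓘(ℝ, E)) he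
  have h2 := mfderivWithin_extChartAt_symm_comp_mfderiv_extChartAt (I := 𝓘(ℝ, E)) he
  simp only [modelWithCornersSelf_coe, range_id, mfderivWithin_univ] at h1 h2
  rw [VectorField.mpullback_apply, ContinuousLinearMap.inverse_eq h2 h1]
  rfl

theorem contMDiffAt_extChartAt_symm {p₀ : N} {e : E} (he : e ∈ (extChartAt 𝓘(ℝ, E) p₀).target) :
    ContMDiffAt 𝓘(ℝ, E) 𝓘(ℝ, E) ∞ (extChartAt 𝓘(ℝ, E) p₀).symm e :=
  (contMDiffOn_extChartAt_symm p₀).contMDiffAt ((isOpen_extChartAt_target p₀).mem_nhds he)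

theorem contDiffAt_chartField [CompleteSpace E] {p₀ : N} {V : (p : N) → TangentSpace 𝓘(ℝ, E) p}
    (hV : IsSmoothField V)
    {e : E} (he : e ∈ (extChartAt 𝓘(ℝ, E) p₀).target) :
    ContDiffAt ℝ 1 (chartField p₀ V) e := by
  have h1 : ContDiffAt ℝ 1
      (VectorField.mpullback 𝓘(ℝ, E) 𝓘(ℝ, E) (extChartAt 𝓘(ℝ, E) p₀).symm V) e := by
    rw [← contMDiffAt_vectorSpace_iff_contDiffAt]
    exact ((hV _).of_le (by norm_cast)).mpullback_vectorField_preimage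
      (contMDiffAt_extChartAt_symm he)
      (isInvertible_mfderiv_extChartAt_symm he) (by norm_cast)
  refine h1.congr_of_eventuallyEq ?_
  filter_upwards [(isOpen_extChartAt_target p₀).mem_nhds he] with e' he'
  exact (mpullback_extChartAt_symm V he').symm

theorem lieBracket_chartField [CompleteSpace E] {p₀ : N} {V W : (p : N) → TangentSpace 𝓘(ℝ, E) p}
    (hV : IsSmoothField V)
    (hW : IsSmoothField W)
    {e : E} (he : e ∈ (extChartAt 𝓘(ℝ, E) p₀).target) :
    VectorField.lieBracket ℝ (chartField p₀ V) (chartField p₀ W) e =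
      chartField p₀ (VectorField.mlieBracket 𝓘(ℝ, E) V W) e := by
  have : IsManifold 𝓘(ℝ, E) (minSmoothness ℝ 2) N :=
    IsManifold.of_le (n := ∞) (by simp; norm_cast)
  have : IsManifold 𝓘(ℝ, E) (minSmoothness ℝ 3) N :=
    IsManifold.of_le (n := ∞) (by simp; norm_cast)
  have hmem := (isOpen_extChartAt_target (I := 𝓘(ℝ, E)) p₀).mem_nhds he
  rw [← mpullback_extChartAt_symm _ he, VectorField.mpullback_mlieBracket (n := ∞)
    ((hV _).mdifferentiableAt (by simp)) ((hW _).mdifferentiableAt (by simp))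
    (contMDiffAt_extChartAt_symm he) (by simp; norm_cast), ← VectorField.mlieBracketWithin_univ,
    VectorField.mlieBracketWithin_eq_lieBracketWithin, ← VectorField.lieBracketWithin_univ]
  refine (Filter.EventuallyEq.lieBracketWithin_vectorField_eq (s := univ) ?_ ?_ ?_ ?_).symm
  · filter_upwards [mem_nhdsWithin_of_mem_nhds hmem] with e' he'
      using mpullback_extChartAt_symm V he'
  · exact mpullback_extChartAt_symm V he
  · filter_upwards [mem_nhdsWithin_of_mem_nhds hmem] with e' he'
      using mpullback_extChartAt_symm W he'
  · exact mpullback_extChartAt_symm W he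

theorem hasMFDerivAt_chartDeriv {p₀ q : N} (hq : q ∈ (extChartAt 𝓘(ℝ, E) p₀).source) :
    HasMFDerivAt 𝓘(ℝ, E) 𝓘(ℝ, E) (extChartAt 𝓘(ℝ, E) p₀) q (chartDeriv (E := E) p₀ q) :=
  (mdifferentiableAt_extChartAt (by rwa [extChartAt_source] at hq)).hasMFDerivAt

theorem HasTangentWithinAt.comp_extChartAt {z : ℝ → N} {v : E} {S : Set ℝ} {t : ℝ}
    (h : HasTangentWithinAt z v S t) {p₀ : N} (ht : z t ∈ (extChartAt 𝓘(ℝ, E) p₀).source) :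
    HasDerivWithinAt (extChartAt 𝓘(ℝ, E) p₀ ∘ z) (chartDeriv p₀ (z t) v) S t :=
  hasTangentWithinAt_iff.1 (h.comp_hasMFDerivAt (hasMFDerivAt_chartDeriv ht))

/-- Compose with the inverse chart. The eventual condition `hz` is needed because outside its source
the chart does not control `z`. -/
theorem HasTangentWithinAt.of_extChartAt {z : ℝ → N} {v : E} {S : Set ℝ} {t : ℝ} {p₀ : N}
    (hz : ∀ᶠ s in 𝓝[S] t, z s ∈ (extChartAt 𝓘(ℝ, E) p₀).source)
    (ht : z t ∈ (extChartAt 𝓘(ℝ, E) p₀).source)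
    (h : HasDerivWithinAt (extChartAt 𝓘(ℝ, E) p₀ ∘ z) (chartDeriv p₀ (z t) v) S t) :
    HasTangentWithinAt z v S t := by
  have h0 := (extChartAt 𝓘(ℝ, E) p₀).map_source ht
  have h1 := ((contMDiffAt_extChartAt_symm h0).mdifferentiableAt (by simp)).hasMFDerivAt
  have h2 := (hasTangentWithinAt_iff.2 h).comp_hasMFDerivAt h1
  have h4 := mfderivWithin_extChartAt_symm_comp_mfderiv_extChartAt' (I := 𝓘(ℝ, E)) ht
  simp only [modelWithCornersSelf_coe, range_id, mfderivWithin_univ] at h4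
  have h5 : mfderiv 𝓘(ℝ, E) 𝓘(ℝ, E) (extChartAt 𝓘(ℝ, E) p₀).symm
      (extChartAt 𝓘(ℝ, E) p₀ (z t)) (chartDeriv (E := E) p₀ (z t) v) = v :=
    DFunLike.congr_fun h4 v
  have h6 : HasTangentWithinAt ((extChartAt 𝓘(ℝ, E) p₀).symm ∘
      extChartAt 𝓘(ℝ, E) p₀ ∘ z) v S t :=
    (congrArg (fun w : E => HasTangentWithinAt _ w S t) h5).mp h2
  refine h6.congr_of_eventuallyEq ?_ ?_
  · filter_upwards [hz] with s hs using ((extChartAt 𝓘(ℝ, E) p₀).left_inv hs).symm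
  · exact ((extChartAt 𝓘(ℝ, E) p₀).left_inv ht).symm

end Manifold

end LieScheffers
namespace LieScheffers

/-! ### Flows on a manifold -/

section Manifold

open Filter Topology

variable {E : Type*} [NormedAddCommGroup E] [NormedSpace ℝ E]
  {N : Type*} [TopologicalSpace N] [ChartedSpace E N]

theorem FlowsTo.eq_of_time_eq_zero {V : (p : N) → TangentSpace 𝓘(ℝ, E) p} {p q : N}
    (h : FlowsTo V 0 p q) : q = p := by
  obtain ⟨γ, h0, h1, -⟩ := h
  rw [← h0, ← h1]

theorem IsMIntegralCurveOn.flowsTo {V : (p : N) → TangentSpace 𝓘(ℝ, E) p} {γ : ℝ → N} {S : Set ℝ}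
    (h : IsMIntegralCurveOn γ V S) {a b : ℝ} (hS : [[a, b]] ⊆ S) :
    FlowsTo V (b - a) (γ a) (γ b) := by
  refine ⟨γ ∘ (· + a), by simp, by simp, (h.comp_add a).mono fun t ht => hS ?_⟩
  have : t + a ∈ (fun x => x + a) '' [[0, b - a]] := mem_image_of_mem _ ht
  simpa using this

theorem FlowsTo.neg {V : (p : N) → TangentSpace 𝓘(ℝ, E) p} {s : ℝ} {p q : N}
    (h : FlowsTo V s p q) : FlowsTo ((-1 : ℝ) • V) (-s) p q := by
  obtain ⟨γ, h0, h1, h2⟩ := h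
  refine ⟨γ ∘ (· * (-1)), by simp [h0], by simp [h1], (h2.comp_mul (-1)).mono fun t ht => ?_⟩
  rw [mem_ofPred, mul_neg_one]
  rw [mem_uIcc] at ht ⊢
  rcases ht with ht | ht
  · right; constructor <;> linarith
  · left; constructor <;> linarith

theorem IsCompleteField.exists_flowsTo {V : (p : N) → TangentSpace 𝓘(ℝ, E) p}
    (h : IsCompleteField V) (s : ℝ) (p : N) : ∃ q, FlowsTo V s p q := by
  obtain ⟨γ, h0, h1⟩ := h p
  exact ⟨γ s, γ, h0, rfl, h1.isMIntegralCurveOn _⟩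

variable [IsManifold 𝓘(ℝ, E) ∞ N]

theorem IsSmoothField.neg {V : (p : N) → TangentSpace 𝓘(ℝ, E) p} (hV : IsSmoothField V) :
    IsSmoothField ((-1 : ℝ) • V) :=
  ContMDiff.const_smul_section (a := (-1 : ℝ)) hV

variable [CompleteSpace E]

/-- An integral curve on `[0, s]` can be extended to the left. -/
theorem exists_isMIntegralCurveOn_Ioo {V : (p : N) → TangentSpace 𝓘(ℝ, E) p}
    (hV : IsSmoothField V) {γ : ℝ → N} {s : ℝ} (hs : 0 < s)
    (hγ : IsMIntegralCurveOn γ V (Icc 0 s)) :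
    ∃ ε > 0, ∃ β : ℝ → N, EqOn β γ (Ici 0) ∧ IsMIntegralCurveOn β V (Ioo (-ε) s) := by
  obtain ⟨α, hα0, hα⟩ := exists_isMIntegralCurveAt_of_contMDiffAt_boundaryless (t₀ := 0)
    ((hV (γ 0)).of_le (by norm_cast) : ContMDiffAt 𝓘(ℝ, E) 𝓘(ℝ, E).tangent 1 _ (γ 0))
  obtain ⟨ε, hε, hα⟩ := isMIntegralCurveAt_iff'.1 hα
  rw [Real.ball_eq_Ioo, zero_sub, zero_add] at hα
  classical
  let β : ℝ → N := fun t => if t < 0 then α t else γ t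
  have hβγ : EqOn β γ (Ici 0) := fun t ht => if_neg (not_lt.2 ht)
  have hβα : EqOn β α (Iic 0) := fun t ht => by
    rcases (show t ≤ 0 from ht).lt_or_eq with h | h
    · exact if_pos h
    · rw [h, hα0]
      exact if_neg (lt_irrefl _)
  refine ⟨ε, hε, β, hβγ, ?_⟩
  have hl : ∀ t ∈ Ioc (-ε) 0, HasTangentWithinAt (E := E) β (V (β t)) (Ioc (-ε) 0) t := fun t ht => by
    have h1 : HasTangentWithinAt (E := E) α (V (α t)) (Ioo (-ε) ε) t := hα t ⟨ht.1, ht.2.trans_lt hε⟩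
    have h2 := (h1.mono_of_mem_nhdsWithin (S' := Ioc (-ε) 0) (mem_nhdsWithin_of_mem_nhds
      (Ioo_mem_nhds ht.1 (ht.2.trans_lt hε)))).congr_of_eventuallyEq
      ((hβα.mono Ioc_subset_Iic_self).eventuallyEq_of_mem self_mem_nhdsWithin) (hβα ht.2)
    exact (congrArg (fun q => HasTangentWithinAt (E := E) β (V q : E) _ t) (hβα ht.2)).mpr h2
  have hr : ∀ t ∈ Ico 0 s, HasTangentWithinAt (E := E) β (V (β t)) (Ico 0 s) t := fun t ht => by
    have h1 : HasTangentWithinAt (E := E) γ (V (γ t)) (Icc 0 s) t := hγ t (Ico_subset_Icc_self ht)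
    have h2 := (h1.mono_of_mem_nhdsWithin (S' := Ico 0 s)
      (mem_of_superset self_mem_nhdsWithin Ico_subset_Icc_self)).congr_of_eventuallyEq
      ((hβγ.mono Ico_subset_Ici_self).eventuallyEq_of_mem self_mem_nhdsWithin) (hβγ ht.1)
    exact (congrArg (fun q => HasTangentWithinAt (E := E) β (V q : E) _ t) (hβγ ht.1)).mpr h2
  intro t ht
  rcases lt_trichotomy t 0 with h | rfl | h
  · exact (hl t ⟨ht.1, h.le⟩).mono_of_mem_nhdsWithin
      (mem_nhdsWithin_of_mem_nhds (Ioc_mem_nhds ht.1 h))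
  -- At the junction the two one-sided derivatives agree, both being V at the common point.
  · refine HasMFDerivWithinAt.mono (HasMFDerivWithinAt.union (hl 0 ⟨ht.1, le_rfl⟩)
      (hr 0 ⟨le_rfl, hs⟩)) fun t ht => ?_
    rcases le_total t 0 with h | h
    exacts [Or.inl ⟨ht.1, h⟩, Or.inr ⟨h, ht.2⟩]
  · exact (hr t ⟨h.le, ht.2⟩).mono_of_mem_nhdsWithin
      (mem_nhdsWithin_of_mem_nhds (Ico_mem_nhds h ht.2))

/-- Uniqueness of integral curves is used on an open interval around the initial time, so both
curves are first extended to the left of 0. The endpoint s is then reached by continuity, limits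
being unique in a Hausdorff space. -/
theorem FlowsTo.unique [T2Space N] {V : (p : N) → TangentSpace 𝓘(ℝ, E) p}
    (hV : IsSmoothField V) {s : ℝ} {p q q' : N} (h : FlowsTo V s p q) (h' : FlowsTo V s p q') :
    q = q' := by
  wlog hs : 0 ≤ s generalizing s V
  · exact this hV.neg h.neg h'.neg (by linarith)
  rcases hs.eq_or_lt with rfl | hs
  · rw [h.eq_of_time_eq_zero, h'.eq_of_time_eq_zero]
  obtain ⟨γ, h0, h1, h2⟩ := h
  obtain ⟨γ', h0', h1', h2'⟩ := h'
  rw [uIcc_of_le hs.le] at h2 h2'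
  obtain ⟨ε, hε, β, hβ, hβV⟩ := exists_isMIntegralCurveOn_Ioo hV hs h2
  obtain ⟨ε', hε', β', hβ', hβV'⟩ := exists_isMIntegralCurveOn_Ioo hV hs h2'
  have hmin := lt_min hε hε'
  have heq : EqOn β β' (Ioo (-min ε ε') s) := by
    refine isMIntegralCurveOn_Ioo_eqOn_of_contMDiff_boundaryless (t₀ := 0) (v := V) ⟨by linarith, hs⟩
      (hV.of_le (by norm_cast)) (hβV.mono (Ioo_subset_Ioo_left ?_))
      (hβV'.mono (Ioo_subset_Ioo_left ?_)) ?_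
    · linarith [min_le_left ε ε']
    · linarith [min_le_right ε ε']
    · rw [hβ self_mem_Ici, hβ' self_mem_Ici, h0, h0']
  have heq' : EqOn γ γ' (Ico 0 s) := fun t ht => by
    rw [← hβ ht.1, ← hβ' ht.1]
    exact heq ⟨by linarith [ht.1], ht.2⟩
  rw [← h1, ← h1']
  have hcl : s ∈ closure (Ico 0 s) := by
    rw [closure_Ico hs.ne]
    exact right_mem_Icc.2 hs.le
  have : (𝓝[Ico 0 s] s).NeBot := mem_closure_iff_nhdsWithin_neBot.1 hcl
  have hc := (h2.continuousOn s (right_mem_Icc.2 hs.le)).mono Ico_subset_Icc_self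
  have hc' := (h2'.continuousOn s (right_mem_Icc.2 hs.le)).mono Ico_subset_Icc_self
  exact tendsto_nhds_unique_of_eventuallyEq hc hc' (heq'.eventuallyEq_of_mem self_mem_nhdsWithin)

end Manifold

end LieScheffers
namespace LieScheffers

/-! ### Transport of curves along flows -/

section Manifold

open Filter Topology

variable {E : Type*} [NormedAddCommGroup E] [NormedSpace ℝ E]
  {N : Type*} [TopologicalSpace N] [ChartedSpace E N]

/-- `f` is Lipschitz on some neighborhood of `t₀` in `S`. -/
def LipschitzNear {F : Type*} [PseudoEMetricSpace F] (f : ℝ → F) (S : Set ℝ) (t₀ : ℝ) : Prop :=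
  ∃ K, ∃ U ∈ 𝓝[S] t₀, LipschitzOnWith K f U

variable (E) in
/-- The curve `z` in a manifold is Lipschitz on some neighborhood of `t₀` in `S`. -/
def CurveLipschitzNear (z : ℝ → N) (S : Set ℝ) (t₀ : ℝ) : Prop :=
  ContinuousWithinAt z S t₀ ∧
    ∃ p₀ : N, z t₀ ∈ (extChartAt 𝓘(ℝ, E) p₀).source ∧
      LipschitzNear (extChartAt 𝓘(ℝ, E) p₀ ∘ z) S t₀

theorem LipschitzNear.continuousWithinAt {F : Type*} [PseudoEMetricSpace F] {f : ℝ → F} {S : Set ℝ}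
    {t₀ : ℝ} (h : LipschitzNear f S t₀) (ht₀ : t₀ ∈ S) : ContinuousWithinAt f S t₀ := by
  obtain ⟨K, U, hU, hf⟩ := h
  exact (hf.continuousOn t₀ (mem_of_mem_nhdsWithin ht₀ hU)).mono_of_mem_nhdsWithin hU

/-- A property of flows holds if it holds locally, for small times, and can be iterated. -/
theorem exists_forall_div_of_eventually {N : Type*} [TopologicalSpace N] {P : ℝ → N → Prop}
    (hP : ∀ p : N, ∀ᶠ x : ℝ × N in 𝓝 (0, p), P x.1 x.2) {γ : ℝ → N} {r : ℝ}
    (hγ : ContinuousOn γ [[0, r]]) :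
    ∃ n : ℕ, 0 < n ∧ ∀ s ∈ [[0, r]], P (r / n) (γ s) := by
  have h1 := (isCompact_uIcc.image_of_continuousOn hγ).eventually_forall_of_forall_eventually
    (x₀ := (0 : ℝ)) (P := P) fun p _ => hP p
  have h2 : Tendsto (fun n : ℕ => r / n) atTop (𝓝 0) := tendsto_const_div_atTop_nhds_zero_nat r
  obtain ⟨n, hn, hn0⟩ := ((h2.eventually h1).and (eventually_gt_atTop 0)).exists
  exact ⟨n, hn0, fun s hs => hn _ (mem_image_of_mem _ hs)⟩

variable [IsManifold 𝓘(ℝ, E) ∞ N]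

/-- C¹ maps are locally Lipschitz. This serves both to change charts and to compose a curve with a
smooth function. -/
theorem CurveLipschitzNear.comp_contMDiffAt {z : ℝ → N} {S : Set ℝ} {t₀ : ℝ}
    (h : CurveLipschitzNear E z S t₀) {F : Type*} [NormedAddCommGroup F] [NormedSpace ℝ F] {g : N → F}
    (hg : ContMDiffAt 𝓘(ℝ, E) 𝓘(ℝ, F) 1 g (z t₀)) : LipschitzNear (g ∘ z) S t₀ := by
  obtain ⟨hc, p₀, hp₀, K, U, hU, hK⟩ := h
  set φ := extChartAt 𝓘(ℝ, E) p₀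
  have h1 : ContMDiffAt 𝓘(ℝ, E) 𝓘(ℝ, E) 1 φ.symm (φ (z t₀)) :=
    (contMDiffAt_extChartAt_symm (φ.map_source hp₀)).of_le (by norm_cast)
  have h2 : ContDiffAt ℝ 1 (g ∘ φ.symm) (φ (z t₀)) := by
    refine ContMDiffAt.contDiffAt (ContMDiffAt.comp _ ?_ h1)
    rwa [φ.left_inv hp₀]
  obtain ⟨K', U', hU', hK'⟩ := h2.exists_lipschitzOnWith
  have h3 : ContinuousWithinAt (φ ∘ z) S t₀ :=
    (continuousAt_extChartAt' hp₀).comp_continuousWithinAt hc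
  refine ⟨K' * K, U ∩ z ⁻¹' φ.source ∩ (φ ∘ z) ⁻¹' U', inter_mem (inter_mem hU
    (hc ((isOpen_extChartAt_source p₀).mem_nhds hp₀))) (h3 hU'), ?_⟩
  have h4 := hK'.comp (hK.mono (s := U ∩ z ⁻¹' φ.source ∩ (φ ∘ z) ⁻¹' U') fun t ht => ht.1.1)
    (fun t ht => ht.2)
  intro t ht t' ht'
  simpa only [Function.comp_apply, φ.left_inv ht.1.2, φ.left_inv ht'.1.2] using h4 ht ht'

theorem IsFlowBox.flowsTo {V : (p : N) → TangentSpace 𝓘(ℝ, E) p} {p₀ : N} {U D : Set E} {ε L : ℝ}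
    {Φ : E → ℝ → E} (h : IsFlowBox (chartField p₀ V) U D ε L Φ)
    (hU : U ⊆ (extChartAt 𝓘(ℝ, E) p₀).target) {q : N} (hq : q ∈ (extChartAt 𝓘(ℝ, E) p₀).source)
    (hD : extChartAt 𝓘(ℝ, E) p₀ q ∈ D) {r : ℝ} (hr : r ∈ Ioo (-ε) ε) :
    FlowsTo V r q ((extChartAt 𝓘(ℝ, E) p₀).symm (Φ (extChartAt 𝓘(ℝ, E) p₀ q) r)) := by
  set φ := extChartAt 𝓘(ℝ, E) p₀
  refine ⟨fun s => φ.symm (Φ (φ q) s), ?_, rfl, fun s hs => ?_⟩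
  · change φ.symm (Φ (φ q) 0) = q
    rw [h.zero _ hD, φ.left_inv hq]
  · have hsub : [[0, r]] ⊆ Ioo (-ε) ε :=
      ordConnected_Ioo.uIcc_subset ⟨by linarith [hr.1, hr.2], by linarith [hr.1, hr.2]⟩ hr
    have hs' := hsub hs
    have hT : ∀ s ∈ [[0, r]], Φ (φ q) s ∈ φ.target := fun s hs => hU (h.mem _ hD s (hsub hs))
    refine HasTangentWithinAt.of_extChartAt (p₀ := p₀) ?_ (φ.map_target (hT s hs)) ?_
    · filter_upwards [self_mem_nhdsWithin] with s hs using φ.map_target (hT s hs)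
    · refine (h.hasDerivAt _ hD s hs').hasDerivWithinAt.congr_of_eventuallyEq ?_
        (φ.right_inv (hT s hs))
      filter_upwards [self_mem_nhdsWithin] with s hs using φ.right_inv (hT s hs)

variable [CompleteSpace E]

theorem exists_isFlowBox_chartField {V : (p : N) → TangentSpace 𝓘(ℝ, E) p} (hV : IsSmoothField V)
    (p₀ : N) {U : Set N} (hU : U ∈ 𝓝 p₀) :
    ∃ D ∈ 𝓝 (extChartAt 𝓘(ℝ, E) p₀ p₀), ∃ ε > 0, ∃ L, 0 ≤ L ∧ ∃ Φ,
      IsFlowBox (chartField p₀ V)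
        ((extChartAt 𝓘(ℝ, E) p₀).target ∩ (extChartAt 𝓘(ℝ, E) p₀).symm ⁻¹' U) D ε L Φ :=
  exists_isFlowBox (contDiffAt_chartField hV (mem_extChartAt_target p₀))
    (inter_mem (extChartAt_target_mem_nhds p₀)
      ((continuousAt_extChartAt_symm p₀).preimage_mem_nhds
        (by rwa [(extChartAt 𝓘(ℝ, E) p₀).left_inv (mem_extChartAt_source p₀)])))

/-- By uniqueness, any integral curve realizing the flow must end where the box says, and in
particular inside the chart. -/
theorem IsFlowBox.eq_of_flowsTo [T2Space N] {V : (p : N) → TangentSpace 𝓘(ℝ, E) p} (hV : IsSmoothField V)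
    {p₀ : N} {U D : Set E} {ε L : ℝ} {Φ : E → ℝ → E} (h : IsFlowBox (chartField p₀ V) U D ε L Φ)
    (hU : U ⊆ (extChartAt 𝓘(ℝ, E) p₀).target) {q y : N}
    (hq : q ∈ (extChartAt 𝓘(ℝ, E) p₀).source) (hD : extChartAt 𝓘(ℝ, E) p₀ q ∈ D) {r : ℝ}
    (hr : r ∈ Ioo (-ε) ε) (hy : FlowsTo V r q y) :
    y ∈ (extChartAt 𝓘(ℝ, E) p₀).source ∧
      extChartAt 𝓘(ℝ, E) p₀ y = Φ (extChartAt 𝓘(ℝ, E) p₀ q) r := by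
  have hT := hU (h.mem _ hD r hr)
  rw [hy.unique hV (h.flowsTo hU hq hD hr)]
  exact ⟨(extChartAt 𝓘(ℝ, E) p₀).map_target hT, (extChartAt 𝓘(ℝ, E) p₀).right_inv hT⟩

/-- Flows exist for small times and depend continuously on the time and on the initial value. -/
theorem eventually_exists_flowsTo {V : (p : N) → TangentSpace 𝓘(ℝ, E) p} (hV : IsSmoothField V)
    (p₀ : N) {U : Set N} (hU : U ∈ 𝓝 p₀) :
    ∀ᶠ x : N × ℝ in 𝓝 (p₀, 0), ∃ y ∈ U, FlowsTo V x.2 x.1 y := by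
  obtain ⟨D, hD, ε, hε, L, -, Φ, h⟩ := exists_isFlowBox_chartField hV p₀ hU
  have h1 := (continuousAt_extChartAt p₀).preimage_mem_nhds hD
  rw [nhds_prod_eq]
  filter_upwards [prod_mem_prod (inter_mem h1 (extChartAt_source_mem_nhds (I := 𝓘(ℝ, E)) p₀))
    (Ioo_mem_nhds (neg_lt_zero.2 hε) hε)] with x hx
  exact ⟨_, (h.mem _ hx.1.1 _ hx.2).2, h.flowsTo inter_subset_left hx.1.2 hx.1.1 hx.2⟩

end Manifold

end LieScheffers
-- Lipschitz curves under flows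
namespace LieScheffers

section Manifold

open Filter Topology

variable {E : Type*} [NormedAddCommGroup E] [NormedSpace ℝ E]
  {N : Type*} [TopologicalSpace N] [ChartedSpace E N]

/-- A flow of a family of points is a composition of flows for short times. -/
theorem exists_chain_of_flowsTo {V : (p : N) → TangentSpace 𝓘(ℝ, E) p} {S : Set ℝ} {t₀ : ℝ}
    (ht₀ : t₀ ∈ S) {ρ : ℝ → ℝ} {z y : ℝ → N} (hy : ∀ t ∈ S, FlowsTo V (ρ t) (z t) (y t))
    {P : ℝ → N → Prop} (hP : ∀ p : N, ∀ᶠ x : ℝ × N in 𝓝 (0, p), P x.1 x.2) :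
    ∃ n : ℕ, 0 < n ∧ ∃ c : ℕ → ℝ → N, EqOn (c 0) z S ∧ EqOn (c n) y S ∧
      ∀ i < n, (∀ t ∈ S, FlowsTo V (ρ t / n) (c i t) (c (i + 1) t)) ∧ P (ρ t₀ / n) (c i t₀) := by
  have : Nonempty (ℝ → N) := ⟨z⟩
  choose! γ h0 h1 hγ using hy
  obtain ⟨n, hn, hn'⟩ := exists_forall_div_of_eventually hP (hγ t₀ ht₀).continuousOn
  have hn0 : (0 : ℝ) < n := Nat.cast_pos.2 hn
  have hmem : ∀ t, ∀ i ≤ n, i * (ρ t / n) ∈ [[0, ρ t]] := fun t i hi => by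
    have h2 : (i : ℝ) / n ∈ Icc (0 : ℝ) 1 :=
      ⟨by positivity, (div_le_one hn0).2 (by exact_mod_cast hi)⟩
    have h3 : (i : ℝ) * (ρ t / n) = (i / n : ℝ) * ρ t := by ring
    rw [h3, mem_uIcc]
    rcases le_total 0 (ρ t) with h | h
    · left; constructor <;> nlinarith [h2.1, h2.2]
    · right; constructor <;> nlinarith [h2.1, h2.2]
  -- Each trajectory is cut into `n` pieces of equal duration. The number `n` depends on the
  -- trajectory at `t₀` only, where alone `P` is required.
  refine ⟨n, hn, fun i t => γ t (i * (ρ t / n)), fun t ht => ?_, fun t ht => ?_, fun i hi => ⟨fun t ht => ?_, ?_⟩⟩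
  · simp [h0 t ht]
  · simp only
    rw [mul_div_cancel₀ _ hn0.ne', h1 t ht]
  · have := IsMIntegralCurveOn.flowsTo (hγ t ht)
      (ordConnected_uIcc.uIcc_subset (hmem t i hi.le) (hmem t (i + 1) hi))
    convert this using 1
    push_cast
    ring
  · exact hn' _ (hmem t₀ i hi.le)

theorem CurveLipschitzNear.congr {z z' : ℝ → N} {S : Set ℝ} {t₀ : ℝ}
    (h : CurveLipschitzNear E z S t₀) (hz : EqOn z' z S) (ht₀ : t₀ ∈ S) :
    CurveLipschitzNear E z' S t₀ := by
  obtain ⟨hc, p₀, hp₀, K, U, hU, hK⟩ := h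
  refine ⟨hc.congr (fun t ht => hz ht) (hz ht₀), p₀, by rwa [hz ht₀], K, U ∩ S,
    inter_mem hU self_mem_nhdsWithin, fun t ht t' ht' => ?_⟩
  simpa only [Function.comp_apply, hz ht.2, hz ht'.2] using hK ht.1 ht'.1

/-- The flow of `V`, starting near `p` and for times near `r`, maps Lipschitz curves to Lipschitz
curves. -/
def TransportsLipschitz (V : (p : N) → TangentSpace 𝓘(ℝ, E) p) (r : ℝ) (p : N) : Prop :=
  ∀ ⦃S : Set ℝ⦄ ⦃t₀ : ℝ⦄ ⦃ρ : ℝ → ℝ⦄ ⦃z y : ℝ → N⦄, t₀ ∈ S →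
    (∀ t ∈ S, FlowsTo V (ρ t) (z t) (y t)) → ρ t₀ = r → z t₀ = p → CurveLipschitzNear E z S t₀ →
    LipschitzNear ρ S t₀ → CurveLipschitzNear E y S t₀

variable [IsManifold 𝓘(ℝ, E) ∞ N] [CompleteSpace E] [T2Space N]

/-- Inside a flow box the new curve is Φ applied to a Lipschitz curve of points and times, and Φ is
jointly Lipschitz. -/
theorem eventually_transportsLipschitz {V : (p : N) → TangentSpace 𝓘(ℝ, E) p}
    (hV : IsSmoothField V) (p₀ : N) :
    ∀ᶠ x : ℝ × N in 𝓝 (0, p₀), TransportsLipschitz V x.1 x.2 := by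
  obtain ⟨D, hD, ε, hε, L, hL, Φ, h⟩ := exists_isFlowBox_chartField hV p₀ univ_mem
  have h1 := (continuousAt_extChartAt p₀).preimage_mem_nhds hD
  rw [nhds_prod_eq]
  filter_upwards [prod_mem_prod (Ioo_mem_nhds (neg_lt_zero.2 hε) hε)
    (inter_mem h1 (extChartAt_source_mem_nhds (I := 𝓘(ℝ, E)) p₀))] with x hx
  intro S t₀ ρ z y ht₀ hy hρx hzx hz hρ
  obtain ⟨hxε, hxD, hxs⟩ := hx
  rw [← hρx] at hxε
  rw [← hzx] at hxD hxs
  set φ := extChartAt 𝓘(ℝ, E) p₀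
  obtain ⟨K, U, hU, hK⟩ := hz.comp_contMDiffAt (g := φ)
    (contMDiffAt_extChartAt' (by rwa [← extChartAt_source 𝓘(ℝ, E)]))
  obtain ⟨K', U', hU', hK'⟩ := hρ
  have hev : ∀ᶠ t in 𝓝[S] t₀, t ∈ S ∧ z t ∈ φ.source ∧ φ (z t) ∈ D ∧ ρ t ∈ Ioo (-ε) ε := by
    have h2 := ((continuousAt_extChartAt' hxs).comp_continuousWithinAt hz.1)
      (h.isOpen.mem_nhds hxD)
    have h3 := LipschitzNear.continuousWithinAt ⟨K', U', hU', hK'⟩ ht₀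
      (Ioo_mem_nhds hxε.1 hxε.2)
    filter_upwards [self_mem_nhdsWithin, hz.1 ((isOpen_extChartAt_source p₀).mem_nhds hxs), h2, h3]
      with t h4 h5 h6 h7 using ⟨h4, h5, h6, h7⟩
  have hflow : ∀ t, (t ∈ S ∧ z t ∈ φ.source ∧ φ (z t) ∈ D ∧ ρ t ∈ Ioo (-ε) ε) →
      y t ∈ φ.source ∧ φ (y t) = Φ (φ (z t)) (ρ t) := fun t ht =>
    h.eq_of_flowsTo hV inter_subset_left ht.2.1 ht.2.2.1 ht.2.2.2 (hy t ht.1)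
  have hlip : LipschitzNear (φ ∘ y) S t₀ := by
    refine ⟨Real.toNNReal (L * (K + K')), U ∩ U' ∩ _, inter_mem (inter_mem hU hU') hev,
      LipschitzOnWith.of_dist_le_mul fun t ht t' ht' => ?_⟩
    have hKK : 0 ≤ L * (K + K') := by positivity
    rw [Function.comp_apply, Function.comp_apply, (hflow t ht.2).2, (hflow t' ht'.2).2,
      dist_eq_norm, Real.coe_toNNReal _ hKK]
    refine (h.norm_sub_le _ ht.2.2.2.1 _ ht'.2.2.2.1 _ ht.2.2.2.2 _ ht'.2.2.2.2).trans ?_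
    have h2 := hK.dist_le_mul t ht.1.1 t' ht'.1.1
    have h3 := hK'.dist_le_mul t ht.1.2 t' ht'.1.2
    rw [dist_eq_norm] at h2
    rw [Real.dist_eq] at h3
    calc L * (‖φ (z t) - φ (z t')‖ + |ρ t - ρ t'|) ≤ L * (K * dist t t' + K' * dist t t') := by
          gcongr
          exact h2
      _ = _ := by ring
  have hs0 := (hflow t₀ (hev.self_of_nhdsWithin ht₀)).1
  refine ⟨?_, p₀, hs0, hlip⟩
  have h4 : ContinuousWithinAt (φ.symm ∘ φ ∘ y) S t₀ :=
    ContinuousAt.comp_continuousWithinAt (f := φ ∘ y)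
      (continuousAt_extChartAt_symm'' (φ.map_source hs0)) (hlip.continuousWithinAt ht₀)
  refine h4.congr_of_eventuallyEq ?_ (φ.left_inv hs0).symm
  filter_upwards [hev] with t ht using (φ.left_inv (hflow t ht).1).symm

theorem CurveLipschitzNear.flowsTo {V : (p : N) → TangentSpace 𝓘(ℝ, E) p} (hV : IsSmoothField V)
    {S : Set ℝ} {t₀ : ℝ} {ρ : ℝ → ℝ} {z y : ℝ → N} (hz : CurveLipschitzNear E z S t₀) (ht₀ : t₀ ∈ S)
    (hy : ∀ t ∈ S, FlowsTo V (ρ t) (z t) (y t)) (hρ : LipschitzNear ρ S t₀) :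
    CurveLipschitzNear E y S t₀ := by
  obtain ⟨n, -, c, hc0, hcn, hc⟩ :=
    exists_chain_of_flowsTo ht₀ hy (eventually_transportsLipschitz hV)
  have hρ' : LipschitzNear (fun t => ρ t / n) S t₀ := by
    obtain ⟨K, U, hU, hK⟩ := hρ
    refine ⟨‖(n : ℝ)⁻¹‖₊ * K, U, hU, ?_⟩
    simpa [div_eq_inv_mul, Function.comp_def] using
      (lipschitzWith_smul (n : ℝ)⁻¹).lipschitzOnWith (s := univ) |>.comp hK (mapsTo_univ _ _)
  have key : ∀ i ≤ n, CurveLipschitzNear E (c i) S t₀ := by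
    intro i
    induction i with
    | zero => exact fun _ => hz.congr hc0 ht₀
    | succ i ih => exact fun hi => (hc i hi).2 ht₀ (hc i hi).1 rfl rfl (ih (by omega)) hρ'
  exact (key n le_rfl).congr hcn.symm ht₀

end Manifold

end LieScheffers
-- Velocities of curves under flows
namespace LieScheffers

section Manifold

open Filter Topology

variable {E : Type*} [NormedAddCommGroup E] [NormedSpace ℝ E]
  {N : Type*} [TopologicalSpace N] [ChartedSpace E N] {ι : Type*} [Fintype ι]

/-- The value of a vector field in a point, as a vector of the model space. -/
def fieldVec (V : (p : N) → TangentSpace 𝓘(ℝ, E) p) (p : N) : E := V p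

/-- The linear combination of the vectors `X d p` with the coefficients `w d`. -/
def combination (X : ι → (p : N) → TangentSpace 𝓘(ℝ, E) p) (w : ι → ℝ) (p : N) : E :=
  ∑ d, w d • fieldVec (X d) p

theorem combination_add (X : ι → (p : N) → TangentSpace 𝓘(ℝ, E) p) (w w' : ι → ℝ) (p : N) :
    combination X (w + w') p = combination X w p + combination X w' p := by
  simp only [combination, Pi.add_apply, add_smul, Finset.sum_add_distrib]

theorem combination_single [DecidableEq ι] (X : ι → (p : N) → TangentSpace 𝓘(ℝ, E) p) (d : ι)
    (r : ℝ) (p : N) : combination X (Pi.single d r) p = r • fieldVec (X d) p := by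
  rw [combination, Finset.sum_eq_single d, Pi.single_eq_same]
  · intro e _ he
    rw [Pi.single_eq_of_ne he, zero_smul]
  · exact fun h => absurd (Finset.mem_univ d) h

theorem chartDeriv_fieldVec (V : (p : N) → TangentSpace 𝓘(ℝ, E) p) (p₀ : N) {q : N}
    (hq : q ∈ (extChartAt 𝓘(ℝ, E) p₀).source) :
    chartDeriv p₀ q (fieldVec V q) = chartField p₀ V (extChartAt 𝓘(ℝ, E) p₀ q) :=
  (chartField_extChartAt p₀ V hq).symm

theorem chartDeriv_combination (X : ι → (p : N) → TangentSpace 𝓘(ℝ, E) p) (w : ι → ℝ) (p₀ : N)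
    {q : N} (hq : q ∈ (extChartAt 𝓘(ℝ, E) p₀).source) :
    chartDeriv p₀ q (combination X w q) =
      ∑ d, w d • chartField p₀ (X d) (extChartAt 𝓘(ℝ, E) p₀ q) := by
  simp only [combination, map_sum, map_smul, chartDeriv_fieldVec _ p₀ hq]

/-- `w` solves the equation of the coefficients of a linear combination of vector fields that is
transported by a flow; here `C` is the matrix of the Lie bracket with the generator of the flow. -/
def IsTransportWeight (C : ι → ι → ℝ) (w : ℝ → ι → ℝ) : Prop :=
  ∀ ρ e, HasDerivAt (fun ρ => w ρ e) (-∑ d, w ρ d * C d e) ρ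

/-- The flow of `X d₀`, starting near `p` and for times near `r`, acts on tangent vectors that are
linear combinations of the fields `X d` as prescribed by the structure constants `C`. -/
def TransportsTangent (X : ι → (p : N) → TangentSpace 𝓘(ℝ, E) p) (C : ι → ι → ℝ) (d₀ : ι) (r : ℝ)
    (p : N) : Prop :=
  ∀ ⦃S : Set ℝ⦄ ⦃t₀ : ℝ⦄ ⦃ρ : ℝ → ℝ⦄ ⦃z y : ℝ → N⦄ ⦃ρ' : ℝ⦄ ⦃w : ℝ → ι → ℝ⦄, t₀ ∈ S →
    (∀ t ∈ S, FlowsTo (X d₀) (ρ t) (z t) (y t)) → ρ t₀ = r → z t₀ = p → IsTransportWeight C w →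
    HasTangentWithinAt z (combination X (w 0) (z t₀)) S t₀ → HasDerivWithinAt ρ ρ' S t₀ →
    HasTangentWithinAt y (combination X (w (ρ t₀)) (y t₀) + ρ' • fieldVec (X d₀) (y t₀)) S t₀

variable [IsManifold 𝓘(ℝ, E) ∞ N] [CompleteSpace E]

/-- Along an orbit of X_{d₀} the derivative of X_d is DX_d·X_{d₀} = DX_{d₀}·X_d + [X_{d₀}, X_d]. The
equation of the weights cancels the bracket terms, so the combination solves the linearized equation
and describes the differential of the flow. -/
theorem hasDerivAt_combination_chartField {X : ι → (p : N) → TangentSpace 𝓘(ℝ, E) p}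
    (hX : ∀ d, IsSmoothField (X d)) {C : ι → ι → ℝ} {d₀ : ι}
    (hC : ∀ d p, combination X (C d) p = VectorField.mlieBracket 𝓘(ℝ, E) (X d₀) (X d) p)
    {p₀ : N} {w : ℝ → ι → ℝ} (hw : IsTransportWeight C w) {β : ℝ → E} {ρ : ℝ}
    (hβ : HasDerivAt β (chartField p₀ (X d₀) (β ρ)) ρ)
    (hT : β ρ ∈ (extChartAt 𝓘(ℝ, E) p₀).target) :
    HasDerivAt (fun ρ => ∑ d, w ρ d • chartField p₀ (X d) (β ρ))
      (fderiv ℝ (chartField p₀ (X d₀)) (β ρ) (∑ d, w ρ d • chartField p₀ (X d) (β ρ))) ρ := by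
  have hF : ∀ d, HasFDerivAt (chartField p₀ (X d)) (fderiv ℝ (chartField p₀ (X d)) (β ρ)) (β ρ) :=
    fun d => ((contDiffAt_chartField (hX d) hT).differentiableAt one_ne_zero).hasFDerivAt
  have hbr : ∀ d, fderiv ℝ (chartField p₀ (X d)) (β ρ) (chartField p₀ (X d₀) (β ρ)) =
      fderiv ℝ (chartField p₀ (X d₀)) (β ρ) (chartField p₀ (X d) (β ρ)) +
        ∑ e, C d e • chartField p₀ (X e) (β ρ) := by
    intro d
    have h1 := lieBracket_chartField (hX d₀) (hX d) hT
    have hs := (extChartAt 𝓘(ℝ, E) p₀).map_target hT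
    have h2 : chartField p₀ (VectorField.mlieBracket 𝓘(ℝ, E) (X d₀) (X d)) (β ρ) =
        chartDeriv p₀ ((extChartAt 𝓘(ℝ, E) p₀).symm (β ρ))
          (combination X (C d) ((extChartAt 𝓘(ℝ, E) p₀).symm (β ρ))) := by
      rw [hC]
      rfl
    rw [h2, chartDeriv_combination X _ _ hs, (extChartAt 𝓘(ℝ, E) p₀).right_inv hT,
      VectorField.lieBracket] at h1
    rw [← h1]
    abel
  have h1 := HasDerivAt.fun_sum (u := Finset.univ) fun d _ =>
    (hw ρ d).smul ((hF d).comp_hasDerivAt ρ hβ)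
  refine h1.congr_deriv ?_
  simp only [Function.comp_apply, hbr, smul_add, Finset.sum_add_distrib, map_sum, map_smul]
  rw [add_assoc, add_eq_left]
  have h2 : ∑ d, w ρ d • ∑ e, C d e • chartField p₀ (X e) (β ρ) =
      ∑ e, (∑ d, w ρ d * C d e) • chartField p₀ (X e) (β ρ) := by
    simp only [Finset.smul_sum, Finset.sum_smul, smul_smul]
    exact Finset.sum_comm
  rw [h2, ← Finset.sum_add_distrib]
  exact Finset.sum_eq_zero fun e _ => by rw [neg_smul, add_neg_cancel]

variable [T2Space N]

theorem eventually_transportsTangent {X : ι → (p : N) → TangentSpace 𝓘(ℝ, E) p}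
    (hX : ∀ d, IsSmoothField (X d)) {C : ι → ι → ℝ} {d₀ : ι}
    (hC : ∀ d p, combination X (C d) p = VectorField.mlieBracket 𝓘(ℝ, E) (X d₀) (X d) p) (p₀ : N) :
    ∀ᶠ x : ℝ × N in 𝓝 (0, p₀), TransportsTangent X C d₀ x.1 x.2 := by
  obtain ⟨D, hD, ε, hε, L, hL, Φ, h⟩ := exists_isFlowBox_chartField (hX d₀) p₀ univ_mem
  have h1 := (continuousAt_extChartAt p₀).preimage_mem_nhds hD
  rw [nhds_prod_eq]
  filter_upwards [prod_mem_prod (Ioo_mem_nhds (neg_lt_zero.2 hε) hε)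
    (inter_mem h1 (extChartAt_source_mem_nhds (I := 𝓘(ℝ, E)) p₀))] with x hx
  intro S t₀ ρ z y ρ' w ht₀ hy hρx hzx hw hz hρ
  obtain ⟨hxε, hxD, hxs⟩ := hx
  rw [← hρx] at hxε
  rw [← hzx] at hxD hxs
  set φ := extChartAt 𝓘(ℝ, E) p₀
  have hzc : ContinuousWithinAt z S t₀ := HasMFDerivWithinAt.continuousWithinAt hz
  have hev : ∀ᶠ t in 𝓝[S] t₀, t ∈ S ∧ z t ∈ φ.source ∧ φ (z t) ∈ D ∧ ρ t ∈ Ioo (-ε) ε := by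
    have h2 := ((continuousAt_extChartAt' hxs).comp_continuousWithinAt hzc)
      (h.isOpen.mem_nhds hxD)
    have h3 := hρ.continuousWithinAt (Ioo_mem_nhds hxε.1 hxε.2)
    filter_upwards [self_mem_nhdsWithin, hzc ((isOpen_extChartAt_source p₀).mem_nhds hxs), h2, h3]
      with t h4 h5 h6 h7 using ⟨h4, h5, h6, h7⟩
  have hflow : ∀ᶠ t in 𝓝[S] t₀, y t ∈ φ.source ∧ φ (y t) = Φ (φ (z t)) (ρ t) := by
    filter_upwards [hev] with t ht using
      h.eq_of_flowsTo (hX d₀) inter_subset_left ht.2.1 ht.2.2.1 ht.2.2.2 (hy t ht.1)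
  obtain ⟨hys, hyΦ⟩ := hflow.self_of_nhdsWithin ht₀
  have hζ := hz.comp_extChartAt hxs
  have hT : ∀ r ∈ Ioo (-ε) ε, Φ (φ (z t₀)) r ∈ φ.target := fun r hr => (h.mem _ hxD r hr).1
  have hmain := h.hasDerivWithinAt hL (fun e he => contDiffAt_chartField (hX d₀) he.1) ht₀
    (ζ := φ ∘ z) (W := fun r => ∑ d, w r d • chartField p₀ (X d) (Φ (φ (z t₀)) r)) ?_ hρ hxD hxε
    fun r hr => hasDerivAt_combination_chartField hX hC hw (h.hasDerivAt _ hxD r hr) (hT r hr)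
  · refine HasTangentWithinAt.of_extChartAt (hflow.mono fun t ht => ht.1) hys
      ((hmain.congr_of_eventuallyEq (hflow.mono fun t ht => ht.2) hyΦ).congr_deriv ?_)
    rw [map_add, map_smul, chartDeriv_combination X _ _ hys, chartDeriv_fieldVec _ p₀ hys, hyΦ]
    rfl
  · refine hζ.congr_deriv ?_
    rw [chartDeriv_combination X _ _ hxs]
    simp only [h.zero _ hxD]
    rfl

/-- The velocity of a curve that is transported by the flow of `X d₀`. -/
theorem HasTangentWithinAt.flowsTo {X : ι → (p : N) → TangentSpace 𝓘(ℝ, E) p}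
    (hX : ∀ d, IsSmoothField (X d)) {C : ι → ι → ℝ} {d₀ : ι}
    (hC : ∀ d p, combination X (C d) p = VectorField.mlieBracket 𝓘(ℝ, E) (X d₀) (X d) p)
    (hC₀ : C d₀ = 0) {S : Set ℝ} {t₀ : ℝ} {ρ : ℝ → ℝ} {z y : ℝ → N} {ρ' : ℝ} {w : ℝ → ι → ℝ}
    (hw : IsTransportWeight C w) (hz : HasTangentWithinAt z (combination X (w 0) (z t₀)) S t₀)
    (ht₀ : t₀ ∈ S) (hy : ∀ t ∈ S, FlowsTo (X d₀) (ρ t) (z t) (y t))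
    (hρ : HasDerivWithinAt ρ ρ' S t₀) {w' : ι → ℝ} (hw' : ∀ e, e ≠ d₀ → w' e = w (ρ t₀) e)
    (hw₀ : w' d₀ = w (ρ t₀) d₀ + ρ') :
    HasTangentWithinAt y (combination X w' (y t₀)) S t₀ := by
  classical
  obtain ⟨n, hn, c, hc0, hcn, hc⟩ :=
    exists_chain_of_flowsTo ht₀ hy (eventually_transportsTangent hX hC)
  have hn0 : (n : ℝ) ≠ 0 := by exact_mod_cast hn.ne'
  have hρn : HasDerivWithinAt (fun t => ρ t / n) (ρ' / n) S t₀ := hρ.div_const n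
  -- After i short flows the weights have evolved for time iρ/n, and the variation of the flow time
  -- has added iρ'/n to the coefficient of X_{d₀}.
  have key : ∀ i ≤ n, HasTangentWithinAt (c i) (combination X
      (w (i * (ρ t₀ / n)) + Pi.single d₀ (i * (ρ' / n))) (c i t₀)) S t₀ := by
    intro i
    induction i with
    | zero =>
      intro _
      have h1 := hz.congr_of_eventuallyEq (hc0.eventuallyEq_of_mem self_mem_nhdsWithin) (hc0 ht₀)
      rw [← hc0 ht₀] at h1
      simpa using h1
    | succ i ih =>
      intro hi
      -- A constant multiple of X_{d₀} is preserved by its own flow, since `C d₀ = 0`.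
      have hwi : IsTransportWeight C fun r =>
          w (r + i * (ρ t₀ / n)) + Pi.single d₀ (i * (ρ' / n)) := by
        intro r e
        have h1 := ((hw (r + i * (ρ t₀ / n)) e).comp_add_const r (i * (ρ t₀ / n))).add_const
          ((Pi.single d₀ (i * (ρ' / n)) : ι → ℝ) e)
        refine h1.congr_deriv ?_
        congr 1
        refine Finset.sum_congr rfl fun d _ => ?_
        by_cases hd : d = d₀
        · rw [hd, hC₀]
          simp
        · simp [Pi.single_eq_of_ne hd]
      have h1 := (hc i hi).2 ht₀ (hc i hi).1 rfl rfl hwi (by simpa using ih (by omega)) hρn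
      rw [← combination_single X d₀, ← combination_add, add_assoc, ← Pi.single_add] at h1
      have e1 : ((i + 1 : ℕ) : ℝ) * (ρ t₀ / n) = ρ t₀ / n + i * (ρ t₀ / n) := by
        push_cast
        ring
      have e2 : ((i + 1 : ℕ) : ℝ) * (ρ' / n) = i * (ρ' / n) + ρ' / n := by
        push_cast
        ring
      rw [e1, e2]
      exact h1
  have h1 := (key n le_rfl).congr_of_eventuallyEq (hcn.symm.eventuallyEq_of_mem self_mem_nhdsWithin)
    (hcn ht₀).symm
  rw [hcn ht₀, mul_div_cancel₀ _ hn0, mul_div_cancel₀ _ hn0] at h1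
  have h2 : w' = w (ρ t₀) + Pi.single d₀ ρ' := by
    ext e
    by_cases he : e = d₀
    · rw [he]
      simp [hw₀]
    · simp [hw' e he, Pi.single_eq_of_ne he]
  rwa [h2]

end Manifold

end LieScheffers
namespace LieScheffers

/-! ### Products of flows of fields that span a copy of `𝔰𝔩₂` -/

section Manifold

open Filter Topology

variable {E : Type*} [NormedAddCommGroup E] [NormedSpace ℝ E]
  {N : Type*} [TopologicalSpace N] [ChartedSpace E N]

/-- The structure constants: `[X d, X e]` is the linear combination of the fields with the
coefficients `structureConst d e`. -/
def structureConst : Letter → Letter → Letter → ℝ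
  | .a, .b, .a => 2
  | .a, .c, .b => -1
  | .b, .a, .a => -2
  | .b, .c, .c => 2
  | .c, .a, .b => 1
  | .c, .b, .c => -2
  | _, _, _ => 0

/-- The commutation relations of the vector fields. -/
structure IsSl2Triple (X : Letter → (p : N) → TangentSpace 𝓘(ℝ, E) p) : Prop where
  lie_ab : ∀ p, VectorField.mlieBracket 𝓘(ℝ, E) (X .a) (X .b) p = (2 : ℝ) • X .a p
  lie_ac : ∀ p, VectorField.mlieBracket 𝓘(ℝ, E) (X .a) (X .c) p = -X .b p
  lie_bc : ∀ p, VectorField.mlieBracket 𝓘(ℝ, E) (X .b) (X .c) p = (2 : ℝ) • X .c p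

variable {X : Letter → (p : N) → TangentSpace 𝓘(ℝ, E) p}

theorem IsSl2Triple.combination_structureConst (h : IsSl2Triple X) (d e : Letter) (p : N) :
    combination X (structureConst d e) p = VectorField.mlieBracket 𝓘(ℝ, E) (X d) (X e) p := by
  have hab : fieldVec (VectorField.mlieBracket 𝓘(ℝ, E) (X .a) (X .b)) p =
      (2 : ℝ) • fieldVec (X .a) p := h.lie_ab p
  have hac : fieldVec (VectorField.mlieBracket 𝓘(ℝ, E) (X .a) (X .c)) p =
      -fieldVec (X .b) p := h.lie_ac p
  have hbc : fieldVec (VectorField.mlieBracket 𝓘(ℝ, E) (X .b) (X .c)) p =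
      (2 : ℝ) • fieldVec (X .c) p := h.lie_bc p
  have hswap : ∀ d e, fieldVec (VectorField.mlieBracket 𝓘(ℝ, E) (X d) (X e)) p =
      -fieldVec (VectorField.mlieBracket 𝓘(ℝ, E) (X e) (X d)) p := fun d e =>
    VectorField.mlieBracket_swap_apply
  have hself : ∀ d, fieldVec (VectorField.mlieBracket 𝓘(ℝ, E) (X d) (X d)) p = 0 := fun d =>
    congrFun VectorField.mlieBracket_self p
  change _ = fieldVec (VectorField.mlieBracket 𝓘(ℝ, E) (X d) (X e)) p
  have hsum : ∀ f : Letter → E, ∑ d, f d = f .a + f .b + f .c := fun f => by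
    rw [show (Finset.univ : Finset Letter) = {.a, .b, .c} from rfl]
    simp [add_assoc]
  rw [combination, hsum]
  cases d <;> cases e <;> simp only [structureConst, hself, hab, hac, hbc, zero_smul, add_zero,
    zero_add, neg_smul, one_smul]
  · rw [hswap, hab]
  · rw [hswap, hac, neg_neg]
  · rw [hswap, hbc]

theorem structureConst_self (d : Letter) : structureConst d d = 0 := by
  ext e
  cases d <;> cases e <;> rfl

theorem hasTangentWithinAt_const (x₀ : N) (S : Set ℝ) (t : ℝ) :
    HasTangentWithinAt (fun _ => x₀) (0 : E) S t := by
  refine (hasMFDerivWithinAt_const x₀ S t).congr_mfderiv ?_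
  ext
  exact (smul_zero _).symm

variable [IsManifold 𝓘(ℝ, E) ∞ N] [CompleteSpace E]

/-- Neighborhoods are chosen backwards: one where the last flow exists, then one that the middle
flow carries into it, and finally a range of times for the first flow. -/
theorem eventually_exists_isProductOfFlows (hX : ∀ d, IsSmoothField (X d)) (x₀ : N) :
    ∀ᶠ ξ : Letter → ℝ in 𝓝 0, ∃ y, IsProductOfFlows X ξ x₀ y := by
  have ha := eventually_exists_flowsTo (hX .a) x₀ univ_mem
  rw [nhds_prod_eq, eventually_prod_iff] at ha
  obtain ⟨Pa, hPa, Ra, hRa, ha⟩ := ha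
  have hb := eventually_exists_flowsTo (hX .b) x₀ hPa
  rw [nhds_prod_eq, eventually_prod_iff] at hb
  obtain ⟨Pb, hPb, Rb, hRb, hb⟩ := hb
  have hc := eventually_exists_flowsTo (hX .c) x₀ hPb
  have hcoord : ∀ d : Letter, Tendsto (fun ξ : Letter → ℝ => ξ d) (𝓝 0) (𝓝 0) := fun d =>
    (continuous_apply d).tendsto' _ _ rfl
  have hc' : ∀ᶠ r in 𝓝 (0 : ℝ), ∃ y ∈ {p | Pb p}, FlowsTo (X .c) r x₀ y :=
    (Continuous.prodMk_right x₀).tendsto' 0 _ rfl |>.eventually hc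
  filter_upwards [(hcoord .a).eventually hRa, (hcoord .b).eventually hRb,
    (hcoord .c).eventually hc'] with ξ h1 h2 ⟨p, hp, hcp⟩
  obtain ⟨q, hq, hbq⟩ := hb hp h2
  obtain ⟨y, -, hay⟩ := ha hq h1
  exact ⟨y, p, q, hcp, hbq, hay⟩

variable [T2Space N]

/-- The velocity of a product of flows whose times solve the equations of Wei and Norman. -/
theorem hasTangentWithinAt_of_isProductOfFlows (hX : ∀ d, IsSmoothField (X d)) (h : IsSl2Triple X)
    {S : Set ℝ} {t : ℝ} (ht : t ∈ S) {ξ : ℝ → Letter → ℝ} {u : Letter → ℝ} {x₀ : N} {x : ℝ → N}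
    (hξ : ∀ d, HasDerivWithinAt (fun s => ξ s d) (∑ e, weiNorman (ξ t) d e * u e) S t)
    (hx : ∀ s ∈ S, IsProductOfFlows X (ξ s) x₀ (x s)) :
    HasTangentWithinAt x (combination X u (x t)) S t := by
  have : Nonempty N := ⟨x₀⟩
  choose! p q hp hq hx using hx
  simp only [sum_letter] at hξ
  have hξa := hξ .a
  have hξb := hξ .b
  have hξc := hξ .c
  simp only [weiNorman] at hξa hξb hξc
  set γ := Real.exp (2 * ξ t .b) * u .c with hγ
  -- The initial point is fixed, so the first flow contributes only Ξ_c' X_c.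
  have h1 : HasTangentWithinAt p (combination X (fun e => if e = .c then γ else 0) (p t)) S t := by
    refine HasTangentWithinAt.flowsTo hX (h.combination_structureConst .c) (structureConst_self _)
      (w := 0) (z := fun _ => x₀) ?_ ?_ ht hp hξc ?_ ?_
    · intro ρ e
      simpa using hasDerivAt_const ρ (0 : ℝ)
    · simpa [combination] using hasTangentWithinAt_const x₀ S t
    · intro e he
      simp [he]
    · simp [hγ]
  -- The flow of X_b scales X_c by exp(-2Ξ_b), which cancels the exponential in Ξ_c' and leaves u_c;
  -- the coefficient of X_b is Ξ_b'.
  have h2 : HasTangentWithinAt q (combination X (fun e => match e with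
      | .a => 0
      | .b => u .b - ξ t .a * u .c
      | .c => u .c) (q t)) S t := by
    refine HasTangentWithinAt.flowsTo hX (h.combination_structureConst .b) (structureConst_self _)
      (w := fun ρ e => if e = .c then Real.exp (-(2 * ρ)) * γ else 0) ?_ ?_ ht hq hξb ?_ ?_
    · intro ρ e
      rw [sum_letter]
      cases e
      · simpa [structureConst] using hasDerivAt_const ρ (0 : ℝ)
      · simpa [structureConst] using hasDerivAt_const ρ (0 : ℝ)
      · have := (((hasDerivAt_id ρ).const_mul 2).neg.exp).mul_const γ
        simp only [structureConst]
        refine this.congr_deriv ?_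
        simp
        ring
    · simpa using h1
    · intro e he
      cases e
      · simp
      · exact absurd rfl he
      · simp only [if_true, hγ]
        rw [← mul_assoc, ← Real.exp_add, neg_add_cancel, Real.exp_zero, one_mul]
    · simp
      ring
  -- For the nilpotent action of X_a the weights solve w_c' = 0, w_b' = w_c, w_a' = -2 w_b, hence
  -- are polynomials. At ρ = Ξ_a the X_b weight is u_b, and adding Ξ_a' to the X_a weight gives u_a.
  refine HasTangentWithinAt.flowsTo hX (h.combination_structureConst .a) (structureConst_self _)
    (w := fun ρ e => match e with
      | .a => -(2 * (u .b - ξ t .a * u .c) * ρ) - u .c * ρ ^ 2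
      | .b => u .b - ξ t .a * u .c + u .c * ρ
      | .c => u .c) ?_ ?_ ht hx hξa ?_ ?_
  · intro ρ e
    rw [sum_letter]
    have hid := hasDerivAt_id ρ
    cases e
    · refine (((hid.const_mul (2 * (u .b - ξ t .a * u .c))).neg).sub
        ((hid.pow 2).const_mul (u .c))).congr_deriv ?_
      simp [structureConst]
      ring
    · refine ((hid.const_mul (u .c)).const_add (u .b - ξ t .a * u .c)).congr_deriv ?_
      simp [structureConst]
    · simpa [structureConst] using hasDerivAt_const ρ (u .c)
  · convert h2 using 3 with e
    cases e <;> simp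
  · intro e he
    cases e
    · exact absurd rfl he
    · simp only
      ring
    · rfl
  · simp only
    ring

theorem curveLipschitzNear_of_isProductOfFlows (hX : ∀ d, IsSmoothField (X d)) {S : Set ℝ} {t : ℝ}
    (ht : t ∈ S) {ξ : ℝ → Letter → ℝ} {x₀ : N} {x : ℝ → N}
    (hξ : ∀ d, LipschitzNear (fun s => ξ s d) S t)
    (hx : ∀ s ∈ S, IsProductOfFlows X (ξ s) x₀ (x s)) : CurveLipschitzNear E x S t := by
  have : Nonempty N := ⟨x₀⟩
  choose! p q hp hq hx using hx
  have h0 : CurveLipschitzNear E (fun _ => x₀) S t :=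
    ⟨continuousWithinAt_const, x₀, mem_extChartAt_source x₀, 0, univ, univ_mem,
      fun s _ s' _ => by simp⟩
  exact ((h0.flowsTo (hX .c) ht hp (hξ .c)).flowsTo (hX .b) ht hq (hξ .b)).flowsTo (hX .a) ht hx
    (hξ .a)

end Manifold

end LieScheffers
-- From velocities to the integral equation
namespace LieScheffers

section Manifold

open Filter Topology

variable {E : Type*} [NormedAddCommGroup E] [NormedSpace ℝ E]
  {N : Type*} [TopologicalSpace N] [ChartedSpace E N]
  {X : Letter → (p : N) → TangentSpace 𝓘(ℝ, E) p}

theorem HasTangentWithinAt.hasDerivWithinAt_comp {z : ℝ → N} {u : Letter → ℝ} {S : Set ℝ} {t : ℝ}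
    (h : HasTangentWithinAt z (combination X u (z t)) S t) {f : N → ℝ}
    (hf : MDifferentiableAt 𝓘(ℝ, E) 𝓘(ℝ, ℝ) f (z t)) :
    HasDerivWithinAt (f ∘ z) (∑ d, u d * mvfderiv 𝓘(ℝ, E) f (z t) (X d (z t))) S t := by
  have h1 : HasMFDerivAt 𝓘(ℝ, E) 𝓘(ℝ, ℝ) f (z t) (show E →L[ℝ] ℝ from mvfderiv 𝓘(ℝ, E) f (z t)) :=
    hf.hasMFDerivAt
  refine (hasTangentWithinAt_iff.1 (h.comp_hasMFDerivAt h1)).congr_deriv ?_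
  rw [combination, map_sum]
  refine Finset.sum_congr rfl fun d _ => ?_
  rw [map_smul]
  rfl

variable {A : Series} {u : Letter → ℝ → ℝ} {T M : ℝ}

theorem seriesInt_coordSeries_zero (hA : IsA1Series A) (hu : IsControl u T M) (d : Letter) :
    seriesInt u (coordSeries A d) 0 = 0 := by
  rw [seriesInt_coordSeries hA hu d
    ⟨le_rfl, lt_min hu.T_pos (one_div_pos.2 hu.M_pos)⟩, intervalIntegral.integral_same]

theorem exists_Icc_mem_nhdsWithin_Ico {τ t : ℝ} (ht : t ∈ Ico 0 τ) :
    ∃ s ∈ Ico 0 τ, Icc 0 s ∈ 𝓝[Ico 0 τ] t := by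
  obtain ⟨s, hts, hsτ⟩ := exists_between ht.2
  refine ⟨s, ⟨ht.1.trans hts.le, hsτ⟩, ?_⟩
  filter_upwards [self_mem_nhdsWithin, mem_nhdsWithin_of_mem_nhds (Iio_mem_nhds hts)] with r h1 h2
  exact ⟨h1.1, h2.le⟩

variable [IsManifold 𝓘(ℝ, E) ∞ N] [CompleteSpace E]

theorem exists_forall_exists_isProductOfFlows (hX : ∀ d, IsSmoothField (X d)) (hA : IsA1Series A)
    (hu : IsControl u T M) (x₀ : N) :
    ∃ ε > 0, ∀ t ∈ Ico 0 ε, ∃ y,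
      IsProductOfFlows X (fun d => seriesInt u (coordSeries A d) t) x₀ y := by
  have h0 : (0 : ℝ) ∈ Ico 0 (min T (1 / M)) :=
    ⟨le_rfl, lt_min hu.T_pos (one_div_pos.2 hu.M_pos)⟩
  obtain ⟨s, hs, hmem⟩ := exists_Icc_mem_nhdsWithin_Ico h0
  have h1 : Tendsto (fun t d => seriesInt u (coordSeries A d) t) (𝓝[Ico 0 (min T (1 / M))] 0)
      (𝓝 0) := by
    refine tendsto_pi_nhds.2 fun d => ?_
    have h2 := (((tame_coordSeries hA d).continuousOn hu hs) 0
      (left_mem_Icc.2 hs.1)).mono_of_mem_nhdsWithin hmem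
    have h3 := h2.tendsto
    rwa [seriesInt_coordSeries_zero hA hu d] at h3
  have h4 := h1.eventually (eventually_exists_isProductOfFlows hX x₀)
  rw [nhdsWithin_Ico_eq_nhdsGE h0.2] at h4
  obtain ⟨ε, hε, h5⟩ := mem_nhdsGE_iff_exists_Ico_subset.1 h4
  exact ⟨ε, hε, h5⟩

/-- The product of flows solves the initial value problem. -/
theorem isSolutionOn_of_isProductOfFlows [T2Space N] (hX : ∀ d, IsSmoothField (X d))
    (hX' : IsSl2Triple X) (hA : IsA1Series A) (hu : IsControl u T M) {x₀ : N} {τ : ℝ} (hτ : 0 < τ)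
    (hτ' : τ ≤ min T (1 / M)) {x : ℝ → N}
    (hx : ∀ t ∈ Ico 0 τ,
      IsProductOfFlows X (fun d => seriesInt u (coordSeries A d) t) x₀ (x t)) :
    IsSolutionOn X u x₀ τ x := by
  have hsub : Ico 0 τ ⊆ Ico 0 (min T (1 / M)) := Ico_subset_Ico_right hτ'
  have hlip : ∀ t ∈ Ico 0 τ, CurveLipschitzNear E x (Ico 0 τ) t := by
    intro t ht
    refine curveLipschitzNear_of_isProductOfFlows hX ht (fun d => ?_) hx
    obtain ⟨s, hs, hmem⟩ := exists_Icc_mem_nhdsWithin_Ico ht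
    obtain ⟨K, hK⟩ := exists_lipschitzOnWith_seriesInt_coordSeries hA hu d (hsub hs)
    exact ⟨K, Icc 0 s, hmem, hK⟩
  have hx0 : x 0 = x₀ := by
    obtain ⟨p, q, h1, h2, h3⟩ := hx 0 ⟨le_rfl, hτ⟩
    simp only [seriesInt_coordSeries_zero hA hu] at h1 h2 h3
    rw [h3.eq_of_time_eq_zero, h2.eq_of_time_eq_zero, h1.eq_of_time_eq_zero]
  refine ⟨fun t ht => (hlip t ht).1, hx0, fun f hf t ht => ?_⟩
  have hsub' : Icc 0 t ⊆ Ico 0 τ := fun s hs => ⟨hs.1, hs.2.trans_lt ht.2⟩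
  -- Local Lipschitz bounds become a global one on the compact interval, which gives absolute
  -- continuity.
  obtain ⟨K, hK⟩ := LocallyLipschitzOn.exists_lipschitzOnWith_of_compact (f := f ∘ x)
    (isCompact_Icc (a := 0) (b := t)) fun s hs => by
      obtain ⟨K, U, hU, hK⟩ := (hlip s (hsub' hs)).comp_contMDiffAt
        ((hf (x s)).of_le (by norm_cast))
      exact ⟨K, U, nhdsWithin_mono _ hsub' hU, hK⟩
  rw [← uIcc_of_le ht.1] at hK
  have hac := hK.absolutelyContinuousOnInterval
  have hderiv : ∀ᵐ s, s ∈ Icc 0 t → deriv (f ∘ x) s =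
      ∑ d, u d s * mvfderiv 𝓘(ℝ, E) f (x s) (X d (x s)) := by
    have h1 : ∀ᵐ s, ∀ d, s ∈ Icc 0 t → HasDerivAt (seriesInt u (coordSeries A d))
        (∑ e, weiNorman (fun d => seriesInt u (coordSeries A d) s) d e * u e s) s :=
      ae_all_iff.2 fun d => ae_hasDerivAt_seriesInt_coordSeries hA hu d (hsub ht)
    filter_upwards [h1, ae_mem_Icc_imp_nhds 0 t] with s h2 h3 hs
    have h4 := hasTangentWithinAt_of_isProductOfFlows hX hX' (hsub' hs)
      (ξ := fun s d => seriesInt u (coordSeries A d) s) (u := fun d => u d s)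
      (fun d => (h2 d hs).hasDerivWithinAt) hx
    -- Almost every `s` is interior to the interval, so the derivative within it is the ordinary
    -- derivative.
    exact ((h4.hasDerivWithinAt_comp ((hf (x s)).mdifferentiableAt (by simp))).hasDerivAt
      (mem_of_superset (h3 hs) hsub')).deriv
  have hderiv' : ∀ᵐ s, s ∈ Ι 0 t → deriv (f ∘ x) s =
      ∑ d, u d s * mvfderiv 𝓘(ℝ, E) f (x s) (X d (x s)) := by
    filter_upwards [hderiv] with s h1 hs
    rw [uIoc_of_le ht.1] at hs
    exact h1 (Ioc_subset_Icc_self hs)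
  refine ⟨hac.intervalIntegrable_deriv.congr_ae
    ((ae_restrict_iff' measurableSet_uIoc).2 hderiv'), ?_⟩
  rw [← intervalIntegral.integral_congr_ae hderiv', hac.integral_deriv_eq_sub]
  simp [hx0]

end Manifold

end LieScheffers

theorem mainTheorem6
    {E : Type*} [NormedAddCommGroup E] [NormedSpace ℝ E] [FiniteDimensional ℝ E]
    {N : Type*} [TopologicalSpace N] [ChartedSpace E N] [IsManifold 𝓘(ℝ, E) ∞ N] [T2Space N]
    (X : LieScheffers.Letter → (p : N) → TangentSpace 𝓘(ℝ, E) p)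
    (hX : ∀ d, ContMDiff 𝓘(ℝ, E) 𝓘(ℝ, E).tangent ∞ (fun p => (⟨p, X d p⟩ : TangentBundle 𝓘(ℝ, E) N)))
    (hab : ∀ p, VectorField.mlieBracket 𝓘(ℝ, E) (X .a) (X .b) p = (2 : ℝ) • X .a p)
    (hac : ∀ p, VectorField.mlieBracket 𝓘(ℝ, E) (X .a) (X .c) p = -X .b p)
    (hbc : ∀ p, VectorField.mlieBracket 𝓘(ℝ, E) (X .b) (X .c) p = (2 : ℝ) • X .c p)
    (T M : ℝ) (hT : 0 < T) (hM : 0 < M)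
    (u : LieScheffers.Letter → ℝ → ℝ)
    (hu : ∀ d, AEMeasurable (u d) (volume.restrict (Icc 0 T)))
    (huM : ∀ d, ∀ t ∈ Icc 0 T, |u d t| ≤ M)
    (x₀ : N) :
    ∃ A : LieScheffers.Series,
      -- `A` is the unique solution of the algebraic equation
      LieScheffers.IsA1Series A ∧ (∀ A', LieScheffers.IsA1Series A' → A' = A) ∧
      -- the series defining the three coordinates converge absolutely
      (∀ d, ∀ t ∈ Ico 0 (min T (1 / M)),
        Summable (fun k => LieScheffers.homogeneousInt u (LieScheffers.coordSeries A d) k t)) ∧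
      -- the product of flows is defined for small times
      (∃ ε > 0, ∀ t ∈ Ico 0 ε, ∃ y : N, LieScheffers.IsProductOfFlows X
        (fun d => LieScheffers.seriesInt u (LieScheffers.coordSeries A d) t) x₀ y) ∧
      -- as long as the product of flows is defined, it solves the equation
      (∀ τ, 0 < τ → τ ≤ min T (1 / M) → ∀ x : ℝ → N,
        (∀ t ∈ Ico 0 τ, LieScheffers.IsProductOfFlows X
          (fun d => LieScheffers.seriesInt u (LieScheffers.coordSeries A d) t) x₀ (x t)) →
        LieScheffers.IsSolutionOn X u x₀ τ x) ∧
      -- if the three fields are complete, it is defined and solves the equation up to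
      -- time `min T (1 / M)`
      ((∀ d, LieScheffers.IsCompleteField (X d)) →
        ∃ x : ℝ → N,
          (∀ t ∈ Ico 0 (min T (1 / M)), LieScheffers.IsProductOfFlows X
            (fun d => LieScheffers.seriesInt u (LieScheffers.coordSeries A d) t) x₀ (x t)) ∧
          LieScheffers.IsSolutionOn X u x₀ (min T (1 / M)) x) := by
  -- Finite dimension enters through completeness of the model space, as Picard–Lindelöf requires.
  have hE : CompleteSpace E := FiniteDimensional.complete ℝ E
  have hcontrol : LieScheffers.IsControl u T M := ⟨hT, hM, hu, huM⟩
  have htriple : LieScheffers.IsSl2Triple X := ⟨hab, hac, hbc⟩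
  obtain ⟨A, hA⟩ := LieScheffers.exists_isA1Series
  have hsol : ∀ τ, 0 < τ → τ ≤ min T (1 / M) → ∀ x : ℝ → N,
      (∀ t ∈ Ico 0 τ, LieScheffers.IsProductOfFlows X
        (fun d => LieScheffers.seriesInt u (LieScheffers.coordSeries A d) t) x₀ (x t)) →
      LieScheffers.IsSolutionOn X u x₀ τ x := fun τ hτ hτ' x hx =>
    LieScheffers.isSolutionOn_of_isProductOfFlows hX htriple hA hcontrol hτ hτ' hx
  refine ⟨A, hA, fun A' hA' => hA'.unique hA,
    fun d t ht => ((LieScheffers.tame_coordSeries hA d).summable hcontrol ht),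
    LieScheffers.exists_forall_exists_isProductOfFlows hX hA hcontrol x₀, hsol, fun hcomplete => ?_⟩
  -- `seriesInt` has a value at every `t`, whether or not the series converges there, so complete
  -- fields give a point for all `t`; only `t` below the bound matters afterwards.
  have hflow : ∀ t : ℝ, ∃ y, LieScheffers.IsProductOfFlows X
      (fun d => LieScheffers.seriesInt u (LieScheffers.coordSeries A d) t) x₀ y := fun t => by
    obtain ⟨p, hp⟩ := (hcomplete .c).exists_flowsTo _ x₀
    obtain ⟨q, hq⟩ := (hcomplete .b).exists_flowsTo _ p
    obtain ⟨y, hy⟩ := (hcomplete .a).exists_flowsTo _ q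
    exact ⟨y, p, q, hp, hq, hy⟩
  choose x hx using hflow
  exact ⟨x, fun t _ => hx t, hsol _ (lt_min hT (one_div_pos.2 hM)) le_rfl x fun t _ => hx t⟩
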